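/- Let $A\in\mathbb Z^{n\times n}$ be a symmetric matrix such that the quadratic form $Q(v)=\tfrac12 v^{T}Av$ has signature $(n-1,1)$; put $B(u,v)=u^{T}Av$. Fix $c_0\in\mathbb R^n$ with $Q(c_0)<0$ and let $$C_Q=\{c\in\mathbb R^n: Q(c)<0,\ B(c,c_0)<0\},\quad S_Q=\{c\in\mathbb Q^n: Q(c)=0,\ B(c,c_0)<0\},\quad \overline C_Q=C_Q\cup S_Q .$$ For $c\in C_Q$ put $R(c)=R^*(c)=\mathbb R^n$; for $c\in S_Q$ put $$R(c)=\{a\in\mathbb R^n: B(c,\ell)\ne0\text{ for all }\ell\in a+\mathbb Z^n\},\quad R^*(c)=\{a\in\mathbb R^n: B(c,\ell)\ne0\text{ for all }\ell\in a+A^{-1}\mathbb Z^n\}\subseteq R(c).$$ (If $c\in S_Q\cap\mathbb Z^n$, then $B(c,a)\notin\mathbb Z$ implies $a\in R^*(c)$, with equivalence if $c$ is primitive.) Let $f:\mathbb R^n\to\mathbb C$ be a homogeneous polynomial of degree $d$. With $\Delta=(\partial/\partial v)^{T}A^{-1}(\partial/\partial v)$, $\widehat f=\sum_{k\ge0}\frac{(-1)^k}{(8\pi)^kk!}\Delta^kf$,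 $\partial_c=\frac1{\sqrt{-Q(c)}}\sum_i c_i\frac{\partial}{\partial v_i}$, $E(z)=2\int_0^ze^{-\pi u^2}\,du$ and $\operatorname{sgn}(0)=0$, put $$p^c[f](v)=\sum_{k=0}^d\frac{(-1)^k}{(4\pi)^kk!}E^{(k)}\Bigl(\frac{B(c,v)}{\sqrt{-Q(c)}}\Bigr)\,\partial_c^k\widehat f(v)\ \ (c\in C_Q),\qquad p^c[f](v)=\operatorname{sgn}(B(c,v))\,\widehat f(v)\ \ (c\in S_Q).$$ For $c_1,c_2\in\overline C_Q$, $a,b\in\mathbb R^n$, $\tau\in\mathbb C$ with $y=\operatorname{Im}\tau>0$, and $q^x=e^{2\pi i x\tau}$, let $$\widehat\vartheta_{a,b}^{c_1,c_2}[f](\tau)=y^{-d/2}\sum_{\ell\in a+\mathbb Z^n}\bigl\{p^{c_1}[f](\ell y^{1/2})-p^{c_2}[f](\ell y^{1/2})\bigr\}\,q^{Q(\ell)}e^{2\pi iB(\ell,b)} .$$ Theorem. Let $c_1,c_2\in\overline C_Q$. The series converges absolutely for all $a\in R(c_1)\cap R(c_2)$, $b\in\mathbb R^n$ and $\operatorname{Im}\tau>0$.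 Write $\widehat\vartheta_{a,b}$ for $\widehat\vartheta_{a,b}^{c_1,c_2}[f]$, and let $A^*$ be the vector of diagonal entries of $A$. For all $a,b\in\mathbb R^n$ and $\tau$ with $\operatorname{Im}\tau>0$ for which the series converges absolutely (in particular for $a\in R(c_1)\cap R(c_2)$): 1. $\widehat\vartheta_{a+\lambda,b}(\tau)=\widehat\vartheta_{a,b}(\tau)$ for $\lambda\in\mathbb Z^n$; 2. $\widehat\vartheta_{a,b+\mu}(\tau)=e^{2\pi iB(a,\mu)}\,\widehat\vartheta_{a,b}(\tau)$ for $\mu\in A^{-1}\mathbb Z^n$; 3. $\widehat\vartheta_{-a,-b}(\tau)=(-1)^{d+1}\,\widehat\vartheta_{a,b}(\tau)$; 4. $\widehat\vartheta_{a,b}(\tau+1)=e^{-2\pi iQ(a)-\pi iB(A^{-1}A^*,a)}\,\widehat\vartheta_{a,\,a+b+\frac12A^{-1}A^*}(\tau)$, and $\widehat\vartheta_{a,b}(\tau+1)=e^{-2\pi iQ(a)}\,\widehat\vartheta_{a,a+b}(\tau)$ if all diagonal entries of $A$ are even. The group $A^{-1}\mathbb Z^n/\mathbb Z^n$ is finite,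 and for $a\in R(c_1)\cap R(c_2)$, $b\in R^*(c_1)\cap R^*(c_2)$ and $\operatorname{Im}\tau>0$: 5. $\displaystyle\widehat\vartheta_{a,b}\Bigl(-\frac1\tau\Bigr)=(-i\tau)^{n/2+d}\,\frac{i^{d+1}}{\sqrt{|\det A|}}\,e^{2\pi iB(a,b)}\sum_{p\in A^{-1}\mathbb Z^n/\mathbb Z^n}\widehat\vartheta_{b+p,-a}(\tau)$, with the principal branch of the power. -/

import Mathlib

namespace IndefTheta

noncomputable section

open Matrix

variable {n : ℕ}

/-- The integral matrix `A`, viewed as a real matrix. -/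
def realMat (A : Matrix (Fin n) (Fin n) ℤ) : Matrix (Fin n) (Fin n) ℝ :=
  A.map (fun k : ℤ => (k : ℝ))

/-- The bilinear form `B(u,v) = uᵀ A v`. -/
def B (A : Matrix (Fin n) (Fin n) ℤ) (u v : Fin n → ℝ) : ℝ :=
  u ⬝ᵥ (realMat A *ᵥ v)

/-- The quadratic form `Q(v) = (1/2) vᵀ A v`. -/
def Q (A : Matrix (Fin n) (Fin n) ℤ) (v : Fin n → ℝ) : ℝ :=
  (1 / 2 : ℝ) * B A v v

/-- The quadratic form of `A` has signature `(n-1,1)`.  (The form `v ↦ vᵀ A v = 2 Q(v)`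
has the same signature as `Q`; together the two conditions exclude degenerate forms.) -/
def HasSignature (A : Matrix (Fin n) (Fin n) ℤ) : Prop :=
  sigPos (realMat A).toQuadraticForm' + 1 = n ∧
    sigNeg (realMat A).toQuadraticForm' = 1

/-- The component `C_Q` of the negative cone which contains `c₀`. -/
def cone (A : Matrix (Fin n) (Fin n) ℤ) (c₀ : Fin n → ℝ) : Set (Fin n → ℝ) :=
  {c | Q A c < 0 ∧ B A c c₀ < 0}

/-- The set `S_Q` of rational cusps of the component containing `c₀`. -/
def cusps (A : Matrix (Fin n) (Fin n) ℤ) (c₀ : Fin n → ℝ) : Set (Fin n → ℝ) :=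
  {c | (∃ r : Fin n → ℚ, c = fun i => (r i : ℝ)) ∧ Q A c = 0 ∧ B A c c₀ < 0}

/-- `C_Q ∪ S_Q`. -/
def coneBar (A : Matrix (Fin n) (Fin n) ℤ) (c₀ : Fin n → ℝ) : Set (Fin n → ℝ) :=
  cone A c₀ ∪ cusps A c₀

/-- The lattice `ℤⁿ` in `ℝⁿ`. -/
def intLattice (n : ℕ) : AddSubgroup (Fin n → ℝ) :=
  ((Int.castAddHom ℝ).compLeft (Fin n)).range

/-- The dual lattice `A⁻¹ ℤⁿ` in `ℝⁿ`. -/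
def dualLattice (A : Matrix (Fin n) (Fin n) ℤ) : AddSubgroup (Fin n → ℝ) :=
  (intLattice n).map ((realMat A)⁻¹.mulVecLin).toAddMonoidHom

/-- The group `A⁻¹ ℤⁿ / ℤⁿ`. -/
abbrev DiscGroup (A : Matrix (Fin n) (Fin n) ℤ) : Type :=
  dualLattice A ⧸ (intLattice n).addSubgroupOf (dualLattice A)

/-- Admissible characteristics: no condition if `Q(c) < 0`; if `c` is a cusp (`Q(c) = 0`), no vector
of the translate `a + L` of the lattice `L` is orthogonal to `c`.  If `c` is a primitive integral
vector and `L = A⁻¹ ℤⁿ`, then `B(c, L) = ℤ`, and the condition reads `B(c,a) ∉ ℤ`. -/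
def admissible (A : Matrix (Fin n) (Fin n) ℤ) (L : AddSubgroup (Fin n → ℝ)) (c : Fin n → ℝ) :
    Set (Fin n → ℝ) :=
  {a | Q A c = 0 → ∀ l ∈ L, B A c (a + l) ≠ 0}

/-- If the cusp is an integral vector, `B(c,a) ∉ ℤ` implies admissibility for `A⁻¹ ℤⁿ`. -/
theorem mem_admissible_dual (A : Matrix (Fin n) (Fin n) ℤ) (hdet : A.det ≠ 0)
    (c : Fin n → ℤ) (a : Fin n → ℝ)
    (h : ∀ k : ℤ, B A (fun i => (c i : ℝ)) a ≠ k) :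
    a ∈ admissible A (dualLattice A) (fun i => (c i : ℝ)) := by
  rintro - l ⟨x, ⟨m, rfl⟩, rfl⟩ h0
  have hu : IsUnit (realMat A).det := by
    have : (realMat A).det = (A.det : ℝ) := by
      simpa [realMat, RingHom.mapMatrix_apply] using ((Int.castRingHom ℝ).map_det A).symm
    rw [this]
    exact isUnit_iff_ne_zero.mpr (by exact_mod_cast hdet)
  apply h (-∑ i, c i * m i)
  have h1 : B A (fun i => (c i : ℝ)) (a + (realMat A)⁻¹ *ᵥ (fun i => (m i : ℝ)))
      = B A (fun i => (c i : ℝ)) a + ∑ i, (c i : ℝ) * m i := by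
    simp only [B, Matrix.mulVec_add, dotProduct_add, Matrix.mulVec_mulVec,
      Matrix.mul_nonsing_inv _ hu, Matrix.one_mulVec]
    rfl
  have h2 : B A (fun i => (c i : ℝ)) (a + (realMat A)⁻¹ *ᵥ (fun i => (m i : ℝ))) = 0 := h0
  push_cast
  linarith

/-- If the cusp `c` is such that `B(c, ℤⁿ) ⊆ ℤ` (for instance, if `c` is integral), then `B(c,a) ∉ ℤ`
implies admissibility for `ℤⁿ`. -/
theorem mem_admissible_int (A : Matrix (Fin n) (Fin n) ℤ) (c : Fin n → ℝ) (a : Fin n → ℝ)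
    (hc : ∀ l ∈ intLattice n, ∃ k : ℤ, B A c l = k)
    (h : ∀ k : ℤ, B A c a ≠ k) :
    a ∈ admissible A (intLattice n) c := by
  rintro - l hl h0
  obtain ⟨k, hk⟩ := hc l hl
  apply h (-k)
  have h1 : B A c (a + l) = B A c a + B A c l := by
    simp only [B, Matrix.mulVec_add, dotProduct_add]
  push_cast
  linarith

/-- The odd error function `E(z) = 2 ∫_0^z e^{-π u²} du`. -/
def E (z : ℝ) : ℝ :=
  2 * ∫ u in (0 : ℝ)..z, Real.exp (-Real.pi * u ^ 2)

/-- The Laplacian `Δ = (∂/∂v)ᵀ A⁻¹ (∂/∂v)` on polynomials. -/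
def laplacian (A : Matrix (Fin n) (Fin n) ℤ) (f : MvPolynomial (Fin n) ℂ) :
    MvPolynomial (Fin n) ℂ :=
  ∑ i, ∑ j, MvPolynomial.C ((((realMat A)⁻¹ i j : ℝ)) : ℂ) *
    MvPolynomial.pderiv i (MvPolynomial.pderiv j f)

/-- `e^{-Δ/8π} f = ∑ₖ (-1)^k / ((8π)^k k!) Δ^k f`.  The exponential series is finite: `Δ` lowers the
degree, so the terms with `k` larger than the degree of `f` vanish. -/
def hat (A : Matrix (Fin n) (Fin n) ℤ) (f : MvPolynomial (Fin n) ℂ) : MvPolynomial (Fin n) ℂ :=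
  ∑ k ∈ Finset.range (f.totalDegree + 1),
    MvPolynomial.C ((-1) ^ k / ((8 * (Real.pi : ℂ)) ^ k * (k.factorial : ℂ))) *
      (laplacian A)^[k] f

/-- The normalized directional derivative `∂_c = (-Q(c))^{-1/2} ∑ᵢ cᵢ ∂/∂vᵢ` on polynomials. -/
def dirDeriv (A : Matrix (Fin n) (Fin n) ℤ) (c : Fin n → ℝ) (f : MvPolynomial (Fin n) ℂ) :
    MvPolynomial (Fin n) ℂ :=
  MvPolynomial.C (((1 / Real.sqrt (-Q A c) : ℝ)) : ℂ) *
    ∑ i, MvPolynomial.C ((c i : ℝ) : ℂ) * MvPolynomial.pderiv i f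

/-- The value at a real vector of a polynomial with complex coefficients. -/
def evalReal (f : MvPolynomial (Fin n) ℂ) (v : Fin n → ℝ) : ℂ :=
  MvPolynomial.eval (fun i => ((v i : ℝ) : ℂ)) f

/-- `p^c[f](v)` for a polynomial `f` of degree `d`: the first case is `c ∈ C_Q`, the second one
`c ∈ S_Q` (where `Q(c) = 0`). -/
def p (A : Matrix (Fin n) (Fin n) ℤ) (d : ℕ) (c : Fin n → ℝ) (f : MvPolynomial (Fin n) ℂ)
    (v : Fin n → ℝ) : ℂ :=
  if Q A c < 0 then
    ∑ k ∈ Finset.range (d + 1),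
      (-1) ^ k / ((4 * (Real.pi : ℂ)) ^ k * (k.factorial : ℂ)) *
        ((iteratedDeriv k E (B A c v / Real.sqrt (-Q A c)) : ℝ) : ℂ) *
        evalReal ((dirDeriv A c)^[k] (hat A f)) v
  else
    ((Real.sign (B A c v) : ℝ) : ℂ) * evalReal (hat A f) v

/-- The summand of the non-holomorphic theta series at `ℓ`, without the factor `y^{-d/2}`:
`{p^{c₁}[f](ℓ y^{1/2}) - p^{c₂}[f](ℓ y^{1/2})} q^{Q(ℓ)} e^{2π i B(ℓ,b)}`,
where `y = Im τ` and `q^x = e^{2π i x τ}`. -/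
def thetaTerm (A : Matrix (Fin n) (Fin n) ℤ) (d : ℕ) (c₁ c₂ : Fin n → ℝ)
    (f : MvPolynomial (Fin n) ℂ) (b : Fin n → ℝ) (τ : ℂ) (l : Fin n → ℝ) : ℂ :=
  (p A d c₁ f (Real.sqrt τ.im • l) - p A d c₂ f (Real.sqrt τ.im • l)) *
    Complex.exp (2 * Real.pi * Complex.I * τ * (Q A l : ℂ)) *
    Complex.exp (2 * Real.pi * Complex.I * (B A l b : ℂ))

/-- The non-holomorphic theta series: `y^{-d/2}` times the sum over `ℓ ∈ a + ℤⁿ`. -/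
def theta (A : Matrix (Fin n) (Fin n) ℤ) (d : ℕ) (c₁ c₂ : Fin n → ℝ)
    (f : MvPolynomial (Fin n) ℂ) (a b : Fin n → ℝ) (τ : ℂ) : ℂ :=
  ((τ.im ^ (-(d : ℝ) / 2) : ℝ) : ℂ) *
    ∑' l : intLattice n, thetaTerm A d c₁ c₂ f b τ (a + (l : Fin n → ℝ))

/-- The vector `A⁻¹ A*`, where `A*` is the vector of diagonal entries of `A`. -/
def invDiag (A : Matrix (Fin n) (Fin n) ℤ) : Fin n → ℝ :=
  (realMat A)⁻¹ *ᵥ (fun i => (A i i : ℝ))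

end

end IndefTheta

/-! The law under `τ ↦ -1/τ` is reduced to that of theta series with rapidly decreasing summands. In
the interior of the cone, let `u(t)` be a path of vectors with `Q(u) = -1`. The derivative of
`p^{u(t)}[f]` replaces `E` by `E'` and `f̂` by `(B(u',·) - ∂_{u'}/4π) f̂` (`hasDerivAt_pSum_left`).
The product with `q^Q` is then a polynomial times a Gaussian, and it decays because `2Q(v) +
B(u,v)²` is positive definite. Hence the theta series is an integral over `t` of such theta series,
and each fiber transforms by Poisson summation.

The Fourier transform of a fiber comes from that of one Gaussian. Conjugation by `e^{-Δ/8π}` turns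
multiplication by `B(w,·)` into the creation operator `B(w,·) - ∂_w/4π`, because `[Δ, B(w,·)] =
2∂_w`. So all `f̂` arise from `1` by creation operators (`hat_induction`). For the Gaussian one
diagonalizes: the term in `E'` turns `τ` into its conjugate in the single negative direction
(`fourier_gaussian`). Since the Fourier transform exchanges derivatives and linear factors, each
creation operator contributes a factor `-τ` (`fourier_psi`).

Exchanging sum and integral requires a majorant uniform in `t`, also when the path starts at a cusp
and `u(t)` is unbounded. Put `T(c,e;v) = B(c,v)B(e,v) - B(c,e)Q(v)`, as in the stress-energy tensor
of a scalar field. The decay exponent is `T(c,c;v)/(-Q(c))`, and along a segment `T` is bounded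
below by its endpoint terms, since the mixed term is nonnegative (`stress_nonneg`). Rationality and
admissibility give `|B(c,ℓ)| ≥ δ` at the cusp. Thus the exponent is at least a multiple of `1/t +
t‖ℓ‖²` up to a constant, and this dominates both `‖ℓ‖` and the scale `(-Q)^{-1/2}`
(`exists_stress_segPath_ge`). The limit at the cusp is the sign function, because `E → ±1` and the
terms with derivatives of `E` die out.

Two arbitrary endpoints are joined through `c₀`, so that each segment has at most one cusp. The
other laws hold summand by summand. -/

namespace IndefTheta

noncomputable section

open Matrix

variable {n : ℕ}

/-! ### Algebra of the forms `B` and `Q`. -/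

section Forms

variable (A : Matrix (Fin n) (Fin n) ℤ)

theorem realMat_transpose {A : Matrix (Fin n) (Fin n) ℤ} (hA : A.IsSymm) :
    (realMat A)ᵀ = realMat A := by
  ext i j
  simp [realMat, hA.apply i j]

theorem B_add_left (u v w : Fin n → ℝ) : B A (u + v) w = B A u w + B A v w := by
  simp [B, add_dotProduct]

theorem B_add_right (u v w : Fin n → ℝ) : B A u (v + w) = B A u v + B A u w := by
  simp [B, mulVec_add, dotProduct_add]

theorem B_smul_left (r : ℝ) (u v : Fin n → ℝ) : B A (r • u) v = r * B A u v := by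
  simp [B, smul_dotProduct]

theorem B_smul_right (r : ℝ) (u v : Fin n → ℝ) : B A u (r • v) = r * B A u v := by
  simp [B, mulVec_smul, dotProduct_smul]

theorem B_neg_left (u v : Fin n → ℝ) : B A (-u) v = -B A u v := by
  simp [B, neg_dotProduct]

theorem B_neg_right (u v : Fin n → ℝ) : B A u (-v) = -B A u v := by
  simp [B, mulVec_neg, dotProduct_neg]

theorem B_sub_right (u v w : Fin n → ℝ) : B A u (v - w) = B A u v - B A u w := by
  rw [sub_eq_add_neg, B_add_right, B_neg_right, sub_eq_add_neg]

theorem B_zero_left (v : Fin n → ℝ) : B A 0 v = 0 := by simp [B]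

theorem B_zero_right (v : Fin n → ℝ) : B A v 0 = 0 := by simp [B]

theorem B_comm {A : Matrix (Fin n) (Fin n) ℤ} (hA : A.IsSymm) (u v : Fin n → ℝ) :
    B A u v = B A v u := by
  unfold B
  rw [dotProduct_mulVec, ← mulVec_transpose, realMat_transpose hA, dotProduct_comm]

theorem two_mul_Q (v : Fin n → ℝ) : 2 * Q A v = B A v v := by
  unfold Q; ring

theorem B_self (v : Fin n → ℝ) : B A v v = 2 * Q A v := (two_mul_Q A v).symm

theorem Q_smul (r : ℝ) (v : Fin n → ℝ) : Q A (r • v) = r ^ 2 * Q A v := by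
  unfold Q; rw [B_smul_left, B_smul_right]; ring

theorem Q_neg (v : Fin n → ℝ) : Q A (-v) = Q A v := by
  unfold Q; rw [B_neg_left, B_neg_right]; ring

theorem Q_zero : Q A (0 : Fin n → ℝ) = 0 := by
  unfold Q; rw [B_zero_left]; ring

theorem Q_add {A : Matrix (Fin n) (Fin n) ℤ} (hA : A.IsSymm) (u v : Fin n → ℝ) :
    Q A (u + v) = Q A u + Q A v + B A u v := by
  unfold Q; rw [B_add_left, B_add_right, B_add_right, B_comm hA v u]; ring

/-- `B` as a continuous bilinear map. -/
def BL : (Fin n → ℝ) →L[ℝ] (Fin n → ℝ) →L[ℝ] ℝ :=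
  LinearMap.toContinuousLinearMap
    { toFun := fun u => LinearMap.toContinuousLinearMap
        { toFun := fun v => B A u v
          map_add' := B_add_right A u
          map_smul' := fun r v => by simp [B_smul_right] }
      map_add' := fun u v => by ext w; simp [B_add_left]
      map_smul' := fun r u => by ext w; simp [B_smul_left] }

@[simp] theorem BL_apply (u v : Fin n → ℝ) : BL A u v = B A u v := rfl

@[fun_prop] theorem continuous_B {X : Type*} [TopologicalSpace X] {f g : X → Fin n → ℝ}
    (hf : Continuous f) (hg : Continuous g) : Continuous fun x => B A (f x) (g x) := by
  simp only [← BL_apply]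
  exact ((BL A).continuous.comp hf).clm_apply hg

@[fun_prop] theorem continuous_Q {X : Type*} [TopologicalSpace X] {f : X → Fin n → ℝ}
    (hf : Continuous f) : Continuous fun x => Q A (f x) := by
  unfold Q; fun_prop

theorem exists_abs_B_le : ∃ C : ℝ, 0 < C ∧ ∀ u v, |B A u v| ≤ C * ‖u‖ * ‖v‖ := by
  refine ⟨‖BL A‖ + 1, by positivity, fun u v => ?_⟩
  rw [← BL_apply, ← Real.norm_eq_abs]
  refine ((BL A).le_opNorm₂ u v).trans ?_
  gcongr
  linarith

end Forms

/-! ### Lorentzian geometry: positivity on orthogonal complements and the majorants. -/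

section Signature

variable {A : Matrix (Fin n) (Fin n) ℤ}

theorem toQuadraticForm_realMat (v : Fin n → ℝ) :
    (realMat A).toQuadraticForm' v = B A v v := by
  simp [Matrix.toQuadraticForm', B, Matrix.toLinearMap₂'_apply']

/-- The form is positive definite on the orthogonal complement of a negative vector. -/
theorem Q_pos_of_orthogonal (hA : A.IsSymm) (hsig : HasSignature A) {c u : Fin n → ℝ}
    (hc : Q A c < 0) (hcu : B A c u = 0) (hu : u ≠ 0) : 0 < Q A u := by
  by_contra! hu0
  have hli : LinearIndependent ℝ ![c, u] := by
    rw [LinearIndependent.pair_iff]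
    intro s t hst
    have h1 : B A c (s • c + t • u) = 0 := by rw [hst, B_zero_right]
    rw [B_add_right, B_smul_right, B_smul_right, hcu, B_self] at h1
    have hs : s = 0 := by
      rcases mul_eq_zero.mp (show s * (2 * Q A c) = 0 by linarith) with h | h
      · exact h
      · linarith
    subst hs
    simp only [zero_smul, zero_add, smul_eq_zero, hu, or_false] at hst
    exact ⟨rfl, hst⟩
  have hrank := finrank_span_eq_card hli
  -- A plane on which the form is nonpositive would force `sigPos ≤ n - 2`, whereas the signature
  -- gives `n - 1`.
  have key := QuadraticForm.sigPos_add_finrank_le_of_nonpos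
    (Q := (realMat A).toQuadraticForm') (V := Submodule.span ℝ (Set.range ![c, u])) (by
      intro x hx
      rw [Matrix.range_cons, Matrix.range_cons, Matrix.range_empty, Set.union_empty,
        Set.singleton_union, Submodule.mem_span_pair] at hx
      obtain ⟨s, t, rfl⟩ := hx
      rw [toQuadraticForm_realMat, B_self, Q_add hA, Q_smul, Q_smul, B_smul_left, B_smul_right,
        hcu]
      nlinarith [mul_nonneg (sq_nonneg s) (neg_nonneg.mpr hc.le),
        mul_nonneg (sq_nonneg t) (neg_nonneg.mpr hu0)])
  rw [hrank] at key
  have h1 := hsig.1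
  simp only [Fintype.card_fin, Module.finrank_fin_fun] at key
  omega

theorem det_realMat : (realMat A).det = (A.det : ℝ) := by
  simpa [realMat, RingHom.mapMatrix_apply] using ((Int.castRingHom ℝ).map_det A).symm

/-- A kernel vector would be orthogonal to `c` and have `Q = 0`, against positivity on the
complement of `c`. -/
theorem isUnit_det_realMat (hA : A.IsSymm) (hsig : HasSignature A) {c : Fin n → ℝ}
    (hc : Q A c < 0) : IsUnit (realMat A).det := by
  rw [isUnit_iff_ne_zero]
  intro h
  obtain ⟨u, hu, hAu⟩ := Matrix.exists_mulVec_eq_zero_iff.mpr h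
  have h1 : ∀ w, B A w u = 0 := fun w => by simp [B, hAu]
  have := Q_pos_of_orthogonal hA hsig hc (h1 c) hu
  rw [Q, h1] at this
  simp at this

/-- The polarized stress-energy form `B(c,v) B(e,v) - B(c,e) Q(v)`. -/
def stress (A : Matrix (Fin n) (Fin n) ℤ) (c e v : Fin n → ℝ) : ℝ :=
  B A c v * B A e v - B A c e * Q A v

/-- Divided by `-Q(c)` this is `2Q(v) + B(c,v)²/(-Q(c))`, the positive definite majorant which
appears as the exponent of all Gaussians below. -/
theorem stress_self (c v : Fin n → ℝ) :
    stress A c c v = B A c v ^ 2 - 2 * Q A c * Q A v := by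
  unfold stress; rw [B_self]; ring

theorem continuous_stress (c e : Fin n → ℝ) : Continuous (stress A c e) := by
  unfold stress; fun_prop

/-- Write `v = u + r c` with `u` orthogonal to `c`. The value becomes `2r²Q(c)² + 2(-Q(c))Q(u)`, a
sum of nonnegative terms which do not both vanish. -/
theorem stress_self_pos (hA : A.IsSymm) (hsig : HasSignature A) {c v : Fin n → ℝ}
    (hc : Q A c < 0) (hv : v ≠ 0) : 0 < stress A c c v := by
  rw [stress_self]
  set r := B A c v / (2 * Q A c) with hr
  have hrc : B A c v = r * (2 * Q A c) := (div_mul_cancel₀ _ (mul_ne_zero two_ne_zero (ne_of_lt (by assumption)))).symm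
  set u := v - r • c with hu
  have hcu : B A c u = 0 := by
    rw [hu, B_sub_right, B_smul_right, B_self, hrc]; ring
  have hv' : v = u + r • c := by rw [hu]; abel
  have hQ : Q A v = Q A u + r ^ 2 * Q A c := by
    rw [hv', Q_add hA, Q_smul, B_smul_right, B_comm hA u c, hcu]; ring
  rw [hrc, hQ]
  have key : (r * (2 * Q A c)) ^ 2 - 2 * Q A c * (Q A u + r ^ 2 * Q A c)
      = 2 * r ^ 2 * Q A c ^ 2 + 2 * (-Q A c) * Q A u := by ring
  rw [key]
  by_cases hu0 : u = 0
  · have hr0 : r ≠ 0 := by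
      rintro h0
      apply hv
      rw [hv', hu0, h0]; simp
    rw [hu0, Q_zero]
    have h2 : 0 < Q A c ^ 2 := sq_pos_of_neg hc
    have h3 : 0 < r ^ 2 := sq_pos_of_ne_zero hr0
    simp only [mul_zero, add_zero]
    positivity
  · have h1 := Q_pos_of_orthogonal hA hsig hc hcu hu0
    have : 0 < 2 * (-Q A c) * Q A u := by
      have : 0 < -Q A c := by linarith
      positivity
    positivity

theorem stress_self_smul (c v : Fin n → ℝ) (r : ℝ) :
    stress A c c (r • v) = r ^ 2 * stress A c c v := by
  rw [stress_self, stress_self, B_smul_right, Q_smul]; ring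

/-- The constant is the minimum over the compact unit sphere; homogeneity of degree 2 extends the
bound. -/
theorem exists_stress_self_ge (hA : A.IsSymm) (hsig : HasSignature A) {c : Fin n → ℝ}
    (hc : Q A c < 0) : ∃ ε > 0, ∀ v, ε * ‖v‖ ^ 2 ≤ stress A c c v := by
  have hne : (Metric.sphere (0 : Fin n → ℝ) 1).Nonempty := by
    have hc0 : c ≠ 0 := by rintro rfl; rw [Q_zero] at hc; exact lt_irrefl _ hc
    exact ⟨(‖c‖)⁻¹ • c, by simp [norm_smul, hc0]⟩
  obtain ⟨x, hx, hmin⟩ := (isCompact_sphere (0 : Fin n → ℝ) 1).exists_isMinOn hne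
    (continuous_stress (A := A) c c).continuousOn
  have hx0 : x ≠ 0 := by rintro rfl; simp at hx
  refine ⟨stress A c c x, stress_self_pos hA hsig hc hx0, fun v => ?_⟩
  by_cases hv : v = 0
  · subst hv; simp [stress_self, B_zero_right, Q_zero]
  have hv' : 0 < ‖v‖ := norm_pos_iff.mpr hv
  have h1 : stress A c c x ≤ stress A c c ((‖v‖)⁻¹ • v) :=
    hmin (by simp [norm_smul, hv])
  rw [stress_self_smul] at h1
  calc stress A c c x * ‖v‖ ^ 2 ≤ ((‖v‖)⁻¹ ^ 2 * stress A c c v) * ‖v‖ ^ 2 := by gcongr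
    _ = stress A c c v := by field_simp

/-- The dominant energy condition: the polarized form is nonnegative for causal vectors in the same
component of the cone. -/
theorem stress_nonneg (hA : A.IsSymm) (hsig : HasSignature A) {c e : Fin n → ℝ}
    (hc : Q A c ≤ 0) (he : Q A e < 0) (hce : B A c e ≤ 0) (v : Fin n → ℝ) :
    0 ≤ stress A c e v := by
  have hpos : ∀ u, B A e u = 0 → 0 ≤ Q A u := by
    intro u hu
    by_cases h : u = 0
    · rw [h, Q_zero]
    · exact (Q_pos_of_orthogonal hA hsig he hu h).le
  set s := B A e c / (2 * Q A e) with hs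
  set r := B A e v / (2 * Q A e) with hr
  have hsc : B A e c = s * (2 * Q A e) := (div_mul_cancel₀ _ (mul_ne_zero two_ne_zero (ne_of_lt (by assumption)))).symm
  have hrc : B A e v = r * (2 * Q A e) := (div_mul_cancel₀ _ (mul_ne_zero two_ne_zero (ne_of_lt (by assumption)))).symm
  set x := c - s • e with hx
  set u := v - r • e with hu
  have hex : B A e x = 0 := by
    rw [hx, B_sub_right, B_smul_right, B_self, hsc]; ring
  have heu : B A e u = 0 := by
    rw [hu, B_sub_right, B_smul_right, B_self, hrc]; ring
  have hc' : c = x + s • e := by rw [hx]; abel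
  have hv' : v = u + r • e := by rw [hu]; abel
  have hQc : Q A c = Q A x + s ^ 2 * Q A e := by
    rw [hc', Q_add hA, Q_smul, B_smul_right, B_comm hA x e, hex]; ring
  have hQv : Q A v = Q A u + r ^ 2 * Q A e := by
    rw [hv', Q_add hA, Q_smul, B_smul_right, B_comm hA u e, heu]; ring
  have hBcv : B A c v = B A x u + s * r * (2 * Q A e) := by
    rw [hc', hv', B_add_left, B_add_right, B_add_right, B_smul_left, B_smul_left, B_smul_right,
      B_smul_right, heu, B_comm hA x e, hex, B_self]; ring
  have hs0 : 0 ≤ s := by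
    rw [hs, B_comm hA]
    exact div_nonneg_of_nonpos hce (by linarith)
  -- Cauchy–Schwarz on the complement of `e`, read off from the discriminant of `t ↦ Q(x + t u) ≥
  -- 0`.
  have hcs : B A x u ^ 2 ≤ 4 * Q A x * Q A u := by
    have h := fun t : ℝ => hpos (x + t • u) (by rw [B_add_right, B_smul_right, hex, heu]; ring)
    have h' : ∀ t : ℝ, 0 ≤ Q A u * (t * t) + B A x u * t + Q A x := fun t => by
      have := h t
      rw [Q_add hA, Q_smul, B_smul_right] at this
      nlinarith [this]
    have := discrim_le_zero h'
    rw [discrim] at this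
    linarith
  unfold stress
  rw [hBcv, hrc, B_comm hA c e, hsc, hQv]
  set q := -Q A e with hq
  have hq0 : 0 < q := by linarith
  have hqe : Q A e = -q := by rw [hq]; ring
  rw [hqe] at *
  have hQx := hpos x hex
  have hQu := hpos u heu
  have hxs : Q A x ≤ s ^ 2 * q := by linarith
  -- The quantity to be bounded is `2q (s(Q(u) + r²q) - r B(x,u))`. The squares compare by
  -- Cauchy–Schwarz, `Q(x) ≤ s²q` (that is, `Q(c) ≤ 0`) and `4 r²q Q(u) ≤ (Q(u) + r²q)²`.
  have hsq : (r * B A x u) ^ 2 ≤ (s * (Q A u + r ^ 2 * q)) ^ 2 := by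
    calc (r * B A x u) ^ 2 = r ^ 2 * B A x u ^ 2 := by ring
      _ ≤ r ^ 2 * (4 * (s ^ 2 * q) * Q A u) := by
          gcongr
          refine hcs.trans ?_
          gcongr
      _ ≤ (s * (Q A u + r ^ 2 * q)) ^ 2 := by
          nlinarith [mul_nonneg (sq_nonneg s) (sq_nonneg (Q A u - r ^ 2 * q))]
  have := abs_le.mp (abs_le_of_sq_le_sq hsq (by positivity))
  nlinarith [this.1, this.2]

theorem stress_segment (hA : A.IsSymm) (c e v : Fin n → ℝ) (t : ℝ) :
    stress A ((1 - t) • c + t • e) ((1 - t) • c + t • e) v =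
      (1 - t) ^ 2 * stress A c c v + 2 * t * (1 - t) * stress A c e v
        + t ^ 2 * stress A e e v := by
  unfold stress
  simp only [B_add_left, B_add_right, B_smul_left, B_smul_right]
  rw [B_comm hA e c]
  ring

end Signature

end

end IndefTheta

/-! ### Diagonalization and the Fourier transform of the Gaussian. -/

namespace IndefTheta

noncomputable section

open Matrix

variable {n : ℕ}

/-- A unit vector for a positive definite symmetric form extends to an orthonormal basis. -/
theorem exists_orthonormal_basis_extending {E ι : Type*} [AddCommGroup E] [Module ℝ E]
    [FiniteDimensional ℝ E] [Fintype ι] [DecidableEq ι] (S : E → E → ℝ)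
    (hadd : ∀ u v w, S (u + v) w = S u w + S v w) (hsmul : ∀ (r : ℝ) u v, S (r • u) v = r * S u v)
    (hsymm : ∀ u v, S u v = S v u) (hpos : ∀ u, u ≠ 0 → 0 < S u u) (e : E) (he : S e e = 1)
    (i₀ : ι) (hcard : Module.finrank ℝ E = Fintype.card ι) :
    ∃ b : Module.Basis ι ℝ E, b i₀ = e ∧ ∀ i j, S (b i) (b j) = if i = j then 1 else 0 := by
  have h0 : S 0 0 = 0 := by simpa using hsmul 0 0 0
  let core : InnerProductSpace.Core ℝ E :=
    { inner := S
      conj_inner_symm := fun u v => by simpa using hsymm v u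
      re_inner_nonneg := fun u => by
        by_cases hu : u = 0
        · subst hu; simp [h0]
        · simpa using (hpos u hu).le
      add_left := hadd
      smul_left := fun u v r => by simpa using hsmul r u v
      definite := fun u hu => by
        by_contra hne
        exact (hpos u hne).ne' hu }
  let : NormedAddCommGroup E := core.toNormedAddCommGroup
  let : InnerProductSpace ℝ E := InnerProductSpace.ofCore core.toCore
  have hinner : ∀ u v : E, inner ℝ u v = S u v := fun _ _ => rfl
  have hon : Orthonormal ℝ (Set.domRestrict ({i₀} : Set ι) (fun _ : ι => e)) := by
    rw [orthonormal_iff_ite]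
    rintro ⟨i, hi⟩ ⟨j, hj⟩
    have : i = j := by rw [Set.mem_singleton_iff.mp hi, Set.mem_singleton_iff.mp hj]
    subst this
    have h1 : inner ℝ e e = (1 : ℝ) := he
    rw [if_pos rfl]
    exact h1
  obtain ⟨b, hb⟩ := hon.exists_orthonormalBasis_extension_of_card_eq hcard
  refine ⟨b.toBasis, by simpa using hb i₀ rfl, fun i j => ?_⟩
  rw [← hinner]
  simpa using orthonormal_iff_ite.mp b.orthonormal i j

/-- The normalized linear form `v ↦ B(c,v) / √(-Q(c))`. -/
def height (A : Matrix (Fin n) (Fin n) ℤ) (c v : Fin n → ℝ) : ℝ :=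
  B A c v / Real.sqrt (-Q A c)

/-- The signs of the diagonalized form. -/
def lorentzSign (j₀ j : Fin n) : ℝ := if j = j₀ then -1 else 1

/-- The columns of `M` are an orthonormal basis for the majorant `B(u,v) + h(u)h(v)`, `h` the
height, starting with `e = c/√(-2Q(c))`. Here `B(e,e) = -1` and `h(e) = -√2`, so `e` is a unit
vector; orthogonality to `e` for the majorant is vanishing of `h`. Thus `B` and `h` become diagonal
together, and the determinant follows from `MᵀAM = diag(±1)` with a single minus sign. -/
theorem exists_adapted_matrix {A : Matrix (Fin n) (Fin n) ℤ} (hA : A.IsSymm)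
    (hsig : HasSignature A) {c : Fin n → ℝ} (hc : Q A c < 0) :
    ∃ (M : Matrix (Fin n) (Fin n) ℝ) (j₀ : Fin n),
      (∀ x y, B A (M *ᵥ x) (M *ᵥ y) = ∑ j, lorentzSign j₀ j * x j * y j) ∧
      (∀ x, height A c (M *ᵥ x) = -Real.sqrt 2 * x j₀) ∧
      |M.det| = 1 / Real.sqrt |(A.det : ℝ)| := by
  have hn : 0 < n := by have := hsig.1; omega
  set j₀ : Fin n := ⟨0, hn⟩
  have hq : 0 < -Q A c := by linarith
  set r := Real.sqrt (-Q A c) with hr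
  have hr0 : 0 < r := Real.sqrt_pos.mpr hq
  have hr2 : r ^ 2 = -Q A c := Real.sq_sqrt hq.le
  set s2 := Real.sqrt 2 with hs2
  have hs20 : 0 < s2 := Real.sqrt_pos.mpr two_pos
  have hs22 : s2 ^ 2 = 2 := Real.sq_sqrt two_pos.le
  set e := (1 / (s2 * r)) • c with he
  have hhe : height A c e = -s2 := by
    rw [height, ← hr, he, B_smul_right, B_self, show Q A c = -r ^ 2 by linarith]
    field_simp
    linarith
  have hBe : ∀ u, B A e u = height A c u / s2 := by
    intro u
    rw [he, B_smul_left, height, ← hr]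
    field_simp
  obtain ⟨b, hb0, hb⟩ := exists_orthonormal_basis_extending
    (S := fun u v => B A u v + height A c u * height A c v) (E := Fin n → ℝ) (ι := Fin n)
    (by intro u v w; simp only [height, B_add_left, B_add_right]; ring)
    (by intro t u v; simp only [height, B_smul_left, B_smul_right]; ring)
    (by intro u v; simp only [height]; rw [B_comm hA u v]; ring)
    (by
      intro u hu
      have h1 := stress_self_pos hA hsig hc hu
      rw [stress_self] at h1
      rw [height, ← hr, B_self]
      have h2 : 2 * Q A u + B A c u / r * (B A c u / r) =
          (B A c u ^ 2 - 2 * Q A c * Q A u) / r ^ 2 := by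
        rw [show Q A c = -r ^ 2 by linarith]
        field_simp
        ring
      rw [h2]
      positivity)
    e (by
      rw [hBe, hhe]
      field_simp
      nlinarith) j₀ (by simp)
  have hh : ∀ j, height A c (b j) = if j = j₀ then -s2 else 0 := by
    intro j
    have := hb j₀ j
    rw [hb0, hBe, hhe] at this
    have h3 : height A c (b j) = -s2 * (if j₀ = j then 1 else 0) := by
      rw [← this]; field_simp; rw [hs22]; ring
    rw [h3]
    by_cases h : j = j₀
    · simp [h]
    · simp [h, Ne.symm h]
  have hBb : ∀ i j, B A (b i) (b j) = if i = j then lorentzSign j₀ j else 0 := by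
    intro i j
    have h1 := hb i j
    simp only [hh] at h1
    unfold lorentzSign
    by_cases hij : i = j
    · subst hij
      simp only [if_true] at h1 ⊢
      split_ifs at h1 ⊢ <;> nlinarith
    · simp only [hij, if_false] at h1 ⊢
      have : ¬ (i = j₀ ∧ j = j₀) := fun h => hij (h.1.trans h.2.symm)
      split_ifs at h1 <;> simp_all
  set M : Matrix (Fin n) (Fin n) ℝ := Matrix.of fun i j => b j i with hM
  have hMx : ∀ x, M *ᵥ x = ∑ j, x j • b j := by
    intro x
    ext i
    simp [hM, mulVec, dotProduct, mul_comm]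
  have hBM : ∀ u y, B A u (M *ᵥ y) = ∑ j, y j * B A u (b j) := by
    intro u y
    rw [hMx]
    simp only [← BL_apply, map_sum, map_smul, smul_eq_mul]
  have hMAM : Mᵀ * realMat A * M = Matrix.diagonal (lorentzSign j₀) := by
    ext i j
    have h1 := hBb i j
    rw [Matrix.diagonal_apply]
    have h2 : (Mᵀ * realMat A * M) i j = B A (b i) (b j) := by
      rw [Matrix.mul_assoc]
      simp [Matrix.mul_apply, B, dotProduct, mulVec, hM]
    rw [h2, h1]
    by_cases hij : i = j
    · subst hij; simp
    · simp [hij]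
  have hdet : M.det ^ 2 * (A.det : ℝ) = -1 := by
    have h1 := congrArg Matrix.det hMAM
    rw [Matrix.det_mul, Matrix.det_mul, Matrix.det_transpose, Matrix.det_diagonal,
      det_realMat] at h1
    have h2 : ∏ j, lorentzSign j₀ j = -1 := by simp [lorentzSign]
    rw [h2] at h1
    linarith
  refine ⟨M, j₀, ?_, ?_, ?_⟩
  · intro x y
    rw [hBM]
    refine Finset.sum_congr rfl fun j _ => ?_
    rw [B_comm hA, hBM, Finset.sum_eq_single j]
    · rw [hBb]; simp; ring
    · intro i _ hij
      rw [hBb, if_neg (Ne.symm hij), mul_zero]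
    · simp
  · intro x
    rw [height, hBM]
    have h3 : ∀ j, B A c (b j) = r * height A c (b j) := by
      intro j; rw [height, ← hr]; field_simp
    simp only [h3, hh]
    rw [← hr]
    simp
    field_simp
  · have h1 : |M.det| ^ 2 * |(A.det : ℝ)| = 1 := by
      rw [← abs_pow, ← abs_mul, hdet]; simp
    have hA0 : 0 < |(A.det : ℝ)| := by
      rcases (abs_nonneg (A.det : ℝ)).eq_or_lt with h | h
      · rw [← h] at h1; simp at h1
      · exact h
    have h2 : |M.det| ^ 2 = (1 / Real.sqrt |(A.det : ℝ)|) ^ 2 := by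
      rw [div_pow, Real.sq_sqrt hA0.le, one_pow]
      field_simp
      exact h1
    exact (pow_left_inj₀ (abs_nonneg _) (by positivity) two_ne_zero).mp h2

/-- The Gaussian `exp(2πiτ Q(v)) exp(-π y x²)`, where `x` is the normalized height of `v` and
`y = Im τ`. -/
def gaussian (A : Matrix (Fin n) (Fin n) ℤ) (c : Fin n → ℝ) (τ : ℂ) (v : Fin n → ℝ) : ℂ :=
  Complex.exp (2 * Real.pi * Complex.I * τ * (Q A v : ℂ) -
    Real.pi * (τ.im : ℂ) * ((height A c v : ℝ) : ℂ) ^ 2)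

/-- The constant in the Fourier transform of the Gaussian. -/
def gaussFactor (A : Matrix (Fin n) (Fin n) ℤ) (τ : ℂ) : ℂ :=
  ((1 / Real.sqrt |(A.det : ℝ)| : ℝ) : ℂ) * ((-Complex.I * τ) ^ (1 / 2 : ℂ)) ^ (n - 1) *
    (Complex.I * (starRingEnd ℂ) τ) ^ (1 / 2 : ℂ)

theorem integral_comp_mulVec {E : Type*} [NormedAddCommGroup E] [NormedSpace ℝ E]
    (M : Matrix (Fin n) (Fin n) ℝ) (hM : M.det ≠ 0) (F : (Fin n → ℝ) → E) :
    ∫ v, F v = |M.det| • ∫ x, F (M *ᵥ x) := by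
  have hmap := Real.map_matrix_volume_pi_eq_smul_volume_pi hM
  have hemb : MeasurableEmbedding (Matrix.toLin' M) := by
    have : Function.Injective (Matrix.toLin' M) := by
      intro x y hxy
      exact Matrix.mulVec_injective_of_isUnit ((Matrix.isUnit_iff_isUnit_det M).mpr
        (isUnit_iff_ne_zero.mpr hM)) hxy
    exact ((Matrix.toLin' M).continuous_of_finiteDimensional.measurableEmbedding this)
  have h2 : ∫ x, F (M *ᵥ x) = ∫ v, F v ∂(MeasureTheory.Measure.map (Matrix.toLin' M)
      MeasureTheory.volume) := by
    rw [hemb.integral_map]; rfl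
  rw [h2, hmap, MeasureTheory.integral_smul_measure, smul_smul,
    ENNReal.toReal_ofReal (abs_nonneg _), ← abs_mul, mul_inv_cancel₀ hM, abs_one, one_smul]

/-- In adapted coordinates the integral is a product of one-dimensional Gaussian integrals. The
squared height equals `2x²` in the negative coordinate, and `σ - 2i Im σ` is the conjugate of `σ`:
the negative direction sees the conjugate parameter, so that all coefficients have positive real
part. -/
theorem fourier_gaussian {A : Matrix (Fin n) (Fin n) ℤ} (hA : A.IsSymm)
    (hsig : HasSignature A) {c : Fin n → ℝ} (hc : Q A c < 0) {τ : ℂ} (hτ : 0 < τ.im)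
    (u : Fin n → ℝ) :
    ∫ v, Complex.exp (-2 * Real.pi * Complex.I * (B A v u : ℂ)) * gaussian A c (-1 / τ) v =
      gaussFactor A τ * gaussian A c τ u := by
  obtain ⟨M, j₀, hB, hh, hdet⟩ := exists_adapted_matrix hA hsig hc
  have hdetA : (0 : ℝ) < |(A.det : ℝ)| := by
    rw [← det_realMat]
    exact abs_pos.mpr (isUnit_det_realMat hA hsig hc).ne_zero
  have hM0 : M.det ≠ 0 := by
    rw [← abs_pos, hdet]; positivity
  have hτ0 : τ ≠ 0 := by rintro rfl; simp at hτ
  have hcτ0 : (starRingEnd ℂ) τ ≠ 0 := by simpa using hτ0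
  have hpi : (Real.pi : ℂ) ≠ 0 := by exact_mod_cast Real.pi_ne_zero
  have h2C : ((Real.sqrt 2 : ℝ) : ℂ) ^ 2 = 2 := by
    rw [← Complex.ofReal_pow, Real.sq_sqrt two_pos.le]; simp
  -- the coefficients of the diagonalized exponent
  set β : ℂ → Fin n → ℂ := fun σ j =>
    if j = j₀ then Real.pi * Complex.I * (starRingEnd ℂ) σ else -(Real.pi * Complex.I * σ)
    with hβ
  have him : ∀ σ : ℂ, (starRingEnd ℂ) σ = σ - 2 * Complex.I * (σ.im : ℂ) := by
    intro σ
    apply Complex.ext <;> simp; ring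
  have hQ : ∀ x, (Q A (M *ᵥ x) : ℂ) = (1 / 2 : ℂ) * ∑ j, (lorentzSign j₀ j : ℂ) * (x j : ℂ) ^ 2 := by
    intro x
    rw [Q, hB]
    push_cast
    congr 1
    refine Finset.sum_congr rfl fun j _ => by ring
  have hg : ∀ σ x, gaussian A c σ (M *ᵥ x) = Complex.exp (-∑ j, β σ j * (x j : ℂ) ^ 2) := by
    intro σ x
    rw [gaussian, hQ, hh]
    congr 1
    have hsingle : (Real.pi * (σ.im : ℂ) * ((-Real.sqrt 2 * x j₀ : ℝ) : ℂ) ^ 2)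
        = ∑ j, if j = j₀ then 2 * Real.pi * (σ.im : ℂ) * (x j : ℂ) ^ 2 else 0 := by
      rw [Finset.sum_ite_eq' Finset.univ j₀]
      simp only [Finset.mem_univ, if_true]
      push_cast
      rw [mul_pow, neg_sq, h2C]; ring
    rw [hsingle, Finset.mul_sum, Finset.mul_sum, ← Finset.sum_sub_distrib,
      ← Finset.sum_neg_distrib]
    refine Finset.sum_congr rfl fun j _ => ?_
    simp only [hβ, lorentzSign]
    split_ifs with h
    · rw [him]; push_cast; linear_combination (-2 * Real.pi * σ.im * (x j : ℂ) ^ 2) * Complex.I_sq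
    · push_cast; ring
  obtain ⟨ω, rfl⟩ : ∃ ω, M *ᵥ ω = u := ⟨M⁻¹ *ᵥ u, by
    rw [mulVec_mulVec, Matrix.mul_nonsing_inv _ (isUnit_iff_ne_zero.mpr hM0), one_mulVec]⟩
  set σ : ℂ := -1 / τ with hσ
  have hσim : 0 < σ.im := by
    rw [hσ, neg_div, one_div, Complex.neg_im, Complex.inv_im]
    have : 0 < Complex.normSq τ := Complex.normSq_pos.mpr hτ0
    rw [neg_div, neg_neg]; positivity
  have hβre : ∀ j, 0 < (β σ j).re := by
    intro j
    simp only [hβ]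
    split_ifs
    · simpa using by positivity
    · simpa using by positivity
  -- These quotients are both the bases of the square roots in `gaussFactor` and, up to `-π`, the
  -- coefficients of the transformed exponent.
  have hβinv : ∀ j, (Real.pi : ℂ) / β σ j =
      if j = j₀ then Complex.I * (starRingEnd ℂ) τ else -Complex.I * τ := by
    intro j
    simp only [hβ, hσ]
    split_ifs
    · rw [map_div₀, map_neg, map_one]
      field_simp
      rw [Complex.I_sq]
    · field_simp
      rw [Complex.I_sq, neg_neg]
  rw [integral_comp_mulVec M hM0]
  have hint : ∀ x : Fin n → ℝ,
      Complex.exp (-2 * Real.pi * Complex.I * (B A (M *ᵥ x) (M *ᵥ ω) : ℂ)) *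
        gaussian A c σ (M *ᵥ x) =
      Complex.exp (-∑ j, β σ j * (x j : ℂ) ^ 2 +
        ∑ j, (-2 * Real.pi * Complex.I * lorentzSign j₀ j * ω j) * x j) := by
    intro x
    rw [hg, hB, ← Complex.exp_add, add_comm]
    congr 2
    push_cast
    rw [Finset.mul_sum]
    exact Finset.sum_congr rfl fun j _ => by ring
  simp_rw [hint]
  rw [GaussianFourier.integral_cexp_neg_sum_mul_add hβre, Finset.prod_mul_distrib,
    ← Complex.exp_sum, hg, hdet, gaussFactor, Complex.real_smul]
  have hprod : ∏ j, ((Real.pi : ℂ) / β σ j) ^ (1 / 2 : ℂ) =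
      ((-Complex.I * τ) ^ (1 / 2 : ℂ)) ^ (n - 1) *
        (Complex.I * (starRingEnd ℂ) τ) ^ (1 / 2 : ℂ) := by
    simp_rw [hβinv]
    rw [← Finset.mul_prod_erase Finset.univ _ (Finset.mem_univ j₀), if_pos rfl, mul_comm]
    congr 1
    rw [Finset.prod_congr rfl (g := fun _ => (-Complex.I * τ) ^ (1 / 2 : ℂ))]
    · simp
    · intro j hj
      rw [if_neg (Finset.ne_of_mem_erase hj)]
  rw [hprod, ← mul_assoc, ← mul_assoc]
  congr 2
  rw [← Finset.sum_neg_distrib]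
  refine Finset.sum_congr rfl fun j _ => ?_
  have hsq : ((lorentzSign j₀ j : ℝ) : ℂ) ^ 2 = 1 := by
    unfold lorentzSign; split_ifs <;> simp
  have hβ0 : β σ j ≠ 0 := by
    intro h; have := hβre j; rw [h] at this; simp at this
  have h1 : (-2 * Real.pi * Complex.I * lorentzSign j₀ j * ω j : ℂ) ^ 2 / (4 * β σ j) =
      -(Real.pi : ℂ) * (Real.pi / β σ j) * (ω j : ℂ) ^ 2 := by
    have : (-2 * Real.pi * Complex.I * lorentzSign j₀ j * ω j : ℂ) ^ 2 =
        -4 * Real.pi ^ 2 * (ω j : ℂ) ^ 2 := by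
      linear_combination (4 * Real.pi ^ 2 * (ω j : ℂ) ^ 2 * (lorentzSign j₀ j : ℂ) ^ 2) *
        Complex.I_sq - (4 * Real.pi ^ 2 * (ω j : ℂ) ^ 2) * hsq
    rw [this]
    field_simp
  rw [h1, hβinv]
  simp only [hβ]
  split_ifs <;> ring

end

end IndefTheta

/-! ### Exponentially decaying lattice sums and Poisson summation. -/

namespace IndefTheta

noncomputable section

open Matrix MeasureTheory

variable {n : ℕ}

/-- The lattice `ℤⁿ ⊆ ℝⁿ` is a copy of `ℤⁿ`. -/
def latticeEquiv (n : ℕ) : (Fin n → ℤ) ≃+ intLattice n :=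
  AddMonoidHom.ofInjective (f := (Int.castAddHom ℝ).compLeft (Fin n)) (by
    intro k m h
    funext i
    have h1 : (k i : ℝ) = m i := congrFun h i
    exact_mod_cast h1)

@[simp] theorem latticeEquiv_apply (k : Fin n → ℤ) (i : Fin n) :
    (latticeEquiv n k : Fin n → ℝ) i = k i := rfl

instance : Countable (intLattice n) := (latticeEquiv n).symm.injective.countable

theorem summable_exp_neg_abs_int {ε : ℝ} (hε : 0 < ε) :
    Summable fun k : ℤ => Real.exp (-ε * |(k : ℝ)|) := by
  have h : Summable fun m : ℕ => Real.exp (-ε * m) := by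
    simpa [mul_comm] using Real.summable_exp_nat_mul_iff.mpr (neg_lt_zero.mpr hε)
  exact Summable.of_nat_of_neg (by simpa using h) (by simpa using h)

theorem summable_prod_exp_neg_abs {ε : ℝ} (hε : 0 < ε) (n : ℕ) :
    Summable fun k : Fin n → ℤ => ∏ i, Real.exp (-ε * |(k i : ℝ)|) := by
  induction n with
  | zero => exact Summable.of_finite
  | succ m ih =>
    rw [← (Fin.consEquiv fun _ => ℤ).summable_iff]
    have h := (summable_exp_neg_abs_int hε).mul_of_nonneg ih (fun _ => (Real.exp_pos _).le)
      (fun _ => Finset.prod_nonneg fun _ _ => (Real.exp_pos _).le)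
    refine h.congr fun x => ?_
    simp [Fin.consEquiv, Fin.prod_univ_succ]

/-- Compares the sup norm with the `ℓ¹` norm, so that sums and integrals over `n` coordinates
factor. The divisor `n + 1` instead of `n` covers `n = 0`. -/
theorem exp_neg_norm_le_prod {ε : ℝ} (hε : 0 < ε) (v : Fin n → ℝ) :
    Real.exp (-ε * ‖v‖) ≤ ∏ i, Real.exp (-(ε / (n + 1)) * |v i|) := by
  rw [← Real.exp_sum, Real.exp_le_exp, ← Finset.mul_sum]
  have h1 : ∑ i, |v i| ≤ n * ‖v‖ := by
    calc ∑ i, |v i| ≤ ∑ _i : Fin n, ‖v‖ := Finset.sum_le_sum fun i _ => norm_le_pi_norm v i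
      _ = n * ‖v‖ := by simp
  have h2 : ε / (n + 1) * ∑ i, |v i| ≤ ε * ‖v‖ := by
    calc ε / (n + 1) * ∑ i, |v i| ≤ ε / (n + 1) * ((n + 1) * ‖v‖) := by
          gcongr; nlinarith [norm_nonneg v]
      _ = ε * ‖v‖ := by field_simp
  linarith

theorem summable_exp_neg_norm_add {ε : ℝ} (hε : 0 < ε) (a : Fin n → ℝ) :
    Summable fun l : intLattice n => Real.exp (-ε * ‖a + (l : Fin n → ℝ)‖) := by
  rw [← (latticeEquiv n).toEquiv.summable_iff]
  have h := (summable_prod_exp_neg_abs (ε := ε / (n + 1)) (by positivity) n).mul_left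
    (Real.exp (ε * ‖a‖))
  refine Summable.of_nonneg_of_le (fun _ => (Real.exp_pos _).le) (fun k => ?_) h
  refine le_trans ?_ (mul_le_mul_of_nonneg_left
    (exp_neg_norm_le_prod hε (latticeEquiv n k : Fin n → ℝ)) (Real.exp_pos _).le)
  rw [← Real.exp_add]
  refine Real.exp_le_exp.mpr ?_
  have := norm_sub_le (a + (latticeEquiv n k : Fin n → ℝ)) a
  rw [add_sub_cancel_left] at this
  change -ε * ‖a + (latticeEquiv n k : Fin n → ℝ)‖ ≤ _
  nlinarith

theorem integrable_exp_neg_abs {ε : ℝ} (hε : 0 < ε) :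
    Integrable fun x : ℝ => Real.exp (-ε * |x|) := by
  rw [← integrableOn_univ, ← Set.Iic_union_Ioi (a := (0 : ℝ)), integrableOn_union]
  constructor
  · refine (integrableOn_exp_mul_Iic hε 0).congr_fun (fun x hx => ?_) measurableSet_Iic
    simp only [abs_of_nonpos (Set.mem_Iic.mp hx)]
    congr 1; ring
  · refine (exp_neg_integrableOn_Ioi 0 hε).congr_fun (fun x hx => ?_) measurableSet_Ioi
    simp only [abs_of_pos (Set.mem_Ioi.mp hx)]

theorem integrable_exp_neg_norm {ε : ℝ} (hε : 0 < ε) :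
    Integrable fun v : Fin n → ℝ => Real.exp (-ε * ‖v‖) := by
  have h : Integrable fun v : Fin n → ℝ => ∏ i, Real.exp (-(ε / (n + 1)) * |v i|) :=
    Integrable.fintype_prod (f := fun _ (x : ℝ) => Real.exp (-(ε / (n + 1)) * |x|))
      fun _ => integrable_exp_neg_abs (by positivity)
  refine h.mono' (by fun_prop) (Filter.Eventually.of_forall fun v => ?_)
  rw [Real.norm_of_nonneg (Real.exp_pos _).le]
  exact exp_neg_norm_le_prod hε v

/-- The half-open unit cube. -/
def unitCube (n : ℕ) : Set (Fin n → ℝ) := {x | ∀ i, x i ∈ Set.Ioc ((0 : Fin n → ℝ) i) ((0 : Fin n → ℝ) i + 1)}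

theorem unitCube_eq : unitCube n = Set.pi Set.univ fun _ => Set.Ioc (0 : ℝ) 1 := by
  ext x; simp [unitCube]

theorem measurableSet_unitCube : MeasurableSet (unitCube n) := by
  rw [unitCube_eq]
  exact MeasurableSet.univ_pi fun _ => measurableSet_Ioc

theorem isAddFundamentalDomain_unitCube :
    IsAddFundamentalDomain (intLattice n) (unitCube n) (volume : Measure (Fin n → ℝ)) := by
  refine IsAddFundamentalDomain.mk' measurableSet_unitCube.nullMeasurableSet fun x => ?_
  have h := fun i => existsUnique_add_zsmul_mem_Ioc (one_pos : (0 : ℝ) < 1) (x i) 0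
  choose k hk huniq using h
  refine ⟨latticeEquiv n k, fun i => ?_, fun l hl => ?_⟩
  · have := hk i
    simp only [zsmul_eq_mul, mul_one] at this
    simpa [AddSubgroup.vadd_def, add_comm] using this
  · obtain ⟨m, rfl⟩ := (latticeEquiv n).surjective l
    congr 1
    funext i
    apply huniq i
    have := hl i
    simpa [AddSubgroup.vadd_def, add_comm] using this

theorem norm_le_one_of_mem_unitCube {x : Fin n → ℝ} (hx : x ∈ unitCube n) : ‖x‖ ≤ 1 := by
  rw [pi_norm_le_iff_of_nonneg zero_le_one]
  intro i
  have := hx i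
  simp only [Pi.zero_apply, zero_add, Set.mem_Ioc] at this
  rw [Real.norm_eq_abs, abs_le]
  constructor <;> linarith [this.1, this.2]

theorem mFourier_coe (k : Fin n → ℤ) (x : Fin n → ℝ) :
    UnitAddTorus.mFourier k (fun i => (x i : UnitAddCircle)) =
      Complex.exp (2 * Real.pi * Complex.I * ((∑ i, k i * x i : ℝ) : ℂ)) := by
  simp only [UnitAddTorus.mFourier, ContinuousMap.coe_mk, fourier_coe_apply]
  rw [← Complex.exp_sum]
  congr 1
  push_cast
  rw [Finset.mul_sum]
  exact Finset.sum_congr rfl fun i _ => by ring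

/-- Poisson summation over `ℤⁿ` for continuous functions of exponential decay. -/
theorem poisson_summation (F : (Fin n → ℝ) → ℂ) (hF : Continuous F) {C ε : ℝ} (hε : 0 < ε)
    (hdecay : ∀ v, ‖F v‖ ≤ C * Real.exp (-ε * ‖v‖))
    (hsum : Summable fun k : Fin n → ℤ =>
      ∫ v, Complex.exp (-(2 * Real.pi * Complex.I * ((∑ i, k i * v i : ℝ) : ℂ))) * F v)
    (a : Fin n → ℝ) :
    ∑' l : intLattice n, F (a + l) =
      ∑' k : Fin n → ℤ,
        (∫ v, Complex.exp (-(2 * Real.pi * Complex.I * ((∑ i, k i * v i : ℝ) : ℂ))) * F v) *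
          Complex.exp (2 * Real.pi * Complex.I * ((∑ i, k i * a i : ℝ) : ℂ)) := by
  have hC : 0 ≤ C := by
    have := (norm_nonneg _).trans (hdecay 0)
    simpa using this
  have hFint : Integrable F := ((integrable_exp_neg_norm hε).const_mul C).mono'
    hF.aestronglyMeasurable (Filter.Eventually.of_forall hdecay)
  have hbound : ∀ (R : ℝ) (x : Fin n → ℝ) (l : intLattice n), ‖x‖ ≤ R →
      ‖F (x + l)‖ ≤ C * Real.exp (ε * R) * Real.exp (-ε * ‖(0 : Fin n → ℝ) + l‖) := by
    intro R x l hx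
    refine (hdecay _).trans ?_
    rw [mul_assoc, ← Real.exp_add]
    gcongr
    have := norm_sub_le (x + (l : Fin n → ℝ)) x
    rw [add_sub_cancel_left] at this
    rw [zero_add]
    nlinarith
  have hsumb : ∀ R : ℝ, Summable fun l : intLattice n =>
      C * Real.exp (ε * R) * Real.exp (-ε * ‖(0 : Fin n → ℝ) + l‖) := fun R =>
    (summable_exp_neg_norm_add hε 0).mul_left _
  -- The periodization of `F`: it is continuous by locally uniform convergence and descends to the
  -- torus, where its Fourier series is taken.
  set G : (Fin n → ℝ) → ℂ := fun x => ∑' l : intLattice n, F (x + l) with hG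
  have hGcont : Continuous G := by
    rw [continuous_iff_continuousAt]
    intro x
    have h1 : ContinuousOn G (Metric.ball 0 (‖x‖ + 1)) :=
      continuousOn_tsum (fun l => (hF.comp (by fun_prop)).continuousOn) (hsumb (‖x‖ + 1))
        (fun l y hy => hbound _ y l (by simpa using (mem_ball_zero_iff.mp hy).le))
    exact h1.continuousAt (Metric.isOpen_ball.mem_nhds (by simp))
  have hGper : ∀ (x : Fin n → ℝ) (l : intLattice n), G (x + l) = G x := by
    intro x l
    calc G (x + l) = ∑' m : intLattice n, F (x + ((l + m : intLattice n) : Fin n → ℝ)) :=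
          tsum_congr fun m => by simp [add_assoc]
      _ = G x := (Equiv.addLeft l).tsum_eq (fun m : intLattice n => F (x + m))
  have hquot : Topology.IsQuotientMap
      (⟨fun (x : Fin n → ℝ) i => (x i : UnitAddCircle), by fun_prop⟩ :
        C(Fin n → ℝ, UnitAddTorus (Fin n))) :=
    (IsOpenQuotientMap.piMap (f := fun (_ : Fin n) (x : ℝ) => (x : UnitAddCircle))
      fun _ => QuotientAddGroup.isOpenQuotientMap_mk).isQuotientMap
  have hfac : Function.FactorsThrough (⟨G, hGcont⟩ : C(Fin n → ℝ, ℂ))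
      (⟨fun (x : Fin n → ℝ) i => (x i : UnitAddCircle), by fun_prop⟩ :
        C(Fin n → ℝ, UnitAddTorus (Fin n))) := by
    intro x y hxy
    have h1 : ∀ i, ∃ k : ℤ, y i = x i + k := by
      intro i
      have := congrFun hxy i
      obtain ⟨k, hk⟩ := (QuotientAddGroup.eq_iff_sub_mem.trans
        AddSubgroup.mem_zmultiples_iff).mp this.symm
      refine ⟨k, ?_⟩
      simp only [zsmul_eq_mul, mul_one] at hk
      linarith
    choose k hk using h1
    have : y = x + (latticeEquiv n k : Fin n → ℝ) := by
      ext i; simpa using hk i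
    simp only [ContinuousMap.coe_mk, this, hGper]
  set f : C(UnitAddTorus (Fin n), ℂ) := hquot.lift ⟨G, hGcont⟩ hfac with hf
  have hfx : ∀ x : Fin n → ℝ, f (fun i => (x i : UnitAddCircle)) = G x := by
    intro x
    exact DFunLike.congr_fun (hquot.lift_comp ⟨G, hGcont⟩ hfac) x
  -- Unfolding: the character is periodic, so the integral over the unit cube of the sum over the
  -- lattice is the integral over the whole space.
  have hcoef : ∀ k : Fin n → ℤ, UnitAddTorus.mFourierCoeff f k =
      ∫ v, Complex.exp (-(2 * Real.pi * Complex.I * ((∑ i, k i * v i : ℝ) : ℂ))) * F v := by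
    intro k
    set e : (Fin n → ℝ) → ℂ := fun v =>
      Complex.exp (-(2 * Real.pi * Complex.I * ((∑ i, k i * v i : ℝ) : ℂ))) with he
    have hecont : Continuous e := by
      simp only [he]
      fun_prop
    have henorm : ∀ v, ‖e v‖ = 1 := by
      intro v
      have : -(2 * Real.pi * Complex.I * ((∑ i, k i * v i : ℝ) : ℂ)) =
          ((-(2 * Real.pi * ∑ i, k i * v i) : ℝ) : ℂ) * Complex.I := by push_cast; ring
      simp only [he]
      rw [this, Complex.norm_exp_ofReal_mul_I]
    have heper : ∀ (v : Fin n → ℝ) (l : intLattice n), e (v + l) = e v := by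
      intro v l
      obtain ⟨m, rfl⟩ := (latticeEquiv n).surjective l
      simp only [he]
      rw [Complex.exp_eq_exp_iff_exists_int]
      refine ⟨-∑ i, k i * m i, ?_⟩
      simp only [Pi.add_apply, latticeEquiv_apply, mul_add, Finset.sum_add_distrib]
      push_cast
      ring
    have hint : Integrable fun v => e v * F v := by
      refine hFint.norm.mono' (hecont.mul hF).aestronglyMeasurable
        (Filter.Eventually.of_forall fun v => ?_)
      rw [norm_mul, henorm, one_mul]
    rw [isAddFundamentalDomain_unitCube.integral_eq_tsum'' _ hint,
      UnitAddTorus.mFourierCoeff_eq_integral f k 0]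
    have h2 : ∀ x : Fin n → ℝ, UnitAddTorus.mFourier (-k) (fun i => (x i : UnitAddCircle)) •
        f (fun i => (x i : UnitAddCircle)) = ∑' l : intLattice n, e (l +ᵥ x) * F (l +ᵥ x) := by
      intro x
      rw [hfx, mFourier_coe, smul_eq_mul, hG, ← tsum_mul_left]
      refine tsum_congr fun l => ?_
      rw [AddSubgroup.vadd_def, vadd_eq_add, add_comm (l : Fin n → ℝ) x, heper]
      congr 1
      simp only [he]
      congr 1
      push_cast
      simp
    simp_rw [h2]
    change ∫ x in unitCube n, _ = _
    symm
    apply integral_tsum_of_summable_integral_norm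
    · intro l
      have hc : Continuous fun x : Fin n → ℝ => (l : Fin n → ℝ) + x := by fun_prop
      exact (hint.comp_add_left (l : Fin n → ℝ)).integrableOn
    · refine Summable.of_nonneg_of_le (fun l => integral_nonneg fun _ => norm_nonneg _)
        (fun l => ?_) (hsumb 1)
      have hvol : (volume : Measure (Fin n → ℝ)).real (unitCube n) = 1 := by
        rw [unitCube_eq, measureReal_def, volume_pi_pi]
        simp
      have hfin : (volume : Measure (Fin n → ℝ)) (unitCube n) < ⊤ := by
        by_contra h
        rw [measureReal_def, not_lt_top_iff.mp h] at hvol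
        simp at hvol
      have h3 := norm_setIntegral_le_of_norm_le_const hfin
        (f := fun x => ‖e (l +ᵥ x) * F (l +ᵥ x)‖)
        (C := C * Real.exp (ε * 1) * Real.exp (-ε * ‖(0 : Fin n → ℝ) + l‖)) (fun x hx => by
          rw [norm_norm, norm_mul, henorm, one_mul, AddSubgroup.vadd_def, vadd_eq_add, add_comm]
          exact hbound 1 x l (norm_le_one_of_mem_unitCube hx))
      rw [hvol, mul_one] at h3
      exact (le_abs_self _).trans h3
  have key := (UnitAddTorus.hasSum_mFourier_series_apply_of_summable (f := f)
    (by simpa only [funext hcoef] using hsum) (fun i => (a i : UnitAddCircle))).tsum_eq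
  rw [hfx] at key
  simp only [smul_eq_mul, hcoef, mFourier_coe] at key
  exact key.symm

end

end IndefTheta

/-! ### Differential operators on polynomials and generation of `f̂` by creation operators. -/

namespace IndefTheta

noncomputable section

open Matrix MvPolynomial

variable {n : ℕ}

section Polynomials

/-- The derivation `∂_w = ∑ᵢ wᵢ ∂/∂vᵢ`. -/
def dirDer (w : Fin n → ℝ) : Derivation ℂ (MvPolynomial (Fin n) ℂ) (MvPolynomial (Fin n) ℂ) :=
  ∑ i, ((w i : ℝ) : ℂ) • pderiv i

theorem dirDer_apply (w : Fin n → ℝ) (f : MvPolynomial (Fin n) ℂ) :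
    dirDer w f = ∑ i, C ((w i : ℝ) : ℂ) * pderiv i f := by
  have h := congrArg (fun D => D f) (map_sum Derivation.coeFnAddMonoidHom
    (fun i => ((w i : ℝ) : ℂ) • (pderiv i : Derivation ℂ (MvPolynomial (Fin n) ℂ) _)) Finset.univ)
  simp only [Finset.sum_apply] at h
  refine h.trans (Finset.sum_congr rfl fun i _ => ?_)
  exact smul_eq_C_mul _ _

/-- The commutator is again a derivation, and it vanishes on the variables. -/
theorem dirDer_comm (u w : Fin n → ℝ) (f : MvPolynomial (Fin n) ℂ) :
    dirDer u (dirDer w f) = dirDer w (dirDer u f) := by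
  have h : ⁅dirDer u, dirDer w⁆ = 0 := by
    apply MvPolynomial.derivation_ext
    intro i
    rw [Derivation.commutator_apply]
    simp [dirDer_apply, pderiv_X, Pi.single_apply]
  have := congrArg (fun D => D f) h
  rwa [Derivation.commutator_apply, Derivation.zero_apply, sub_eq_zero] at this

theorem dirDer_iterate_comm (u w : Fin n → ℝ) (k : ℕ) (f : MvPolynomial (Fin n) ℂ) :
    dirDer u ((dirDer w)^[k] f) = (dirDer w)^[k] (dirDer u f) :=
  ((Function.Commute.iterate_right (f := dirDer u) (g := dirDer w)
    (fun f => dirDer_comm u w f) k) f)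

theorem dirDer_smul_left (r : ℝ) (w : Fin n → ℝ) (f : MvPolynomial (Fin n) ℂ) :
    dirDer (r • w) f = (r : ℂ) • dirDer w f := by
  simp only [dirDer_apply, Pi.smul_apply, smul_eq_mul, Finset.smul_sum, smul_eq_C_mul,
    Complex.ofReal_mul, C_mul, mul_assoc]

theorem dirDer_iterate_smul (w : Fin n → ℝ) (k : ℕ) (a : ℂ) (f : MvPolynomial (Fin n) ℂ) :
    (dirDer w)^[k] (a • f) = a • (dirDer w)^[k] f :=
  Function.Commute.iterate_left (f := dirDer w) (g := fun f => a • f)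
    (fun f => (dirDer w).map_smul a f) k f

theorem dirDer_iterate_sub (w : Fin n → ℝ) (k : ℕ) (f g : MvPolynomial (Fin n) ℂ) :
    (dirDer w)^[k] (f - g) = (dirDer w)^[k] f - (dirDer w)^[k] g :=
  iterate_map_sub (dirDer w) k f g

theorem dirDer_iterate_smul_left (r : ℝ) (w : Fin n → ℝ) (k : ℕ) (f : MvPolynomial (Fin n) ℂ) :
    (dirDer (r • w))^[k] f = ((r : ℂ) ^ k) • (dirDer w)^[k] f := by
  induction k with
  | zero => simp
  | succ k ih =>
    rw [Function.iterate_succ_apply', ih, dirDer_smul_left, Derivation.map_smul, smul_smul,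
      Function.iterate_succ_apply', pow_succ']

theorem dirDeriv_eq (A : Matrix (Fin n) (Fin n) ℤ) (c : Fin n → ℝ) :
    dirDeriv A c = dirDer ((1 / Real.sqrt (-Q A c)) • c) := by
  funext f
  rw [dirDer_smul_left, dirDeriv, dirDer_apply, smul_eq_C_mul]

/-- The linear form `v ↦ B(w,v)` as a polynomial. -/
def linPoly (A : Matrix (Fin n) (Fin n) ℤ) (w : Fin n → ℝ) : MvPolynomial (Fin n) ℂ :=
  ∑ i, C (((realMat A *ᵥ w) i : ℝ) : ℂ) * X i

theorem pderiv_linPoly (A : Matrix (Fin n) (Fin n) ℤ) (w : Fin n → ℝ) (i : Fin n) :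
    pderiv i (linPoly A w) = C (((realMat A *ᵥ w) i : ℝ) : ℂ) := by
  simp [linPoly, pderiv_X, Pi.single_apply]

theorem dirDer_linPoly (A : Matrix (Fin n) (Fin n) ℤ) (u w : Fin n → ℝ) :
    dirDer u (linPoly A w) = C ((B A u w : ℝ) : ℂ) := by
  simp only [dirDer_apply, pderiv_linPoly, B, dotProduct]
  simp

theorem dirDer_linPoly_mul (A : Matrix (Fin n) (Fin n) ℤ) (u w : Fin n → ℝ)
    (f : MvPolynomial (Fin n) ℂ) :
    dirDer u (linPoly A w * f) = linPoly A w * dirDer u f + ((B A u w : ℝ) : ℂ) • f := by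
  rw [Derivation.leibniz, dirDer_linPoly, smul_eq_mul, smul_eq_mul, smul_eq_C_mul]
  ring

/-- Leibniz rule with a factor whose second derivatives vanish. The truncated `k - 1` at `k = 0` is
harmless, its coefficient being `0`. -/
theorem dirDer_iterate_linPoly_mul (A : Matrix (Fin n) (Fin n) ℤ) (u w : Fin n → ℝ)
    (f : MvPolynomial (Fin n) ℂ) (k : ℕ) :
    (dirDer u)^[k] (linPoly A w * f) = linPoly A w * (dirDer u)^[k] f +
      ((k : ℂ) * ((B A u w : ℝ) : ℂ)) • (dirDer u)^[k - 1] f := by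
  induction k with
  | zero => simp
  | succ k ih =>
    rw [Function.iterate_succ_apply', ih, map_add, dirDer_linPoly_mul, Derivation.map_smul,
      ← Function.iterate_succ_apply' (dirDer u)]
    rcases k with _ | k
    · simp
    · rw [← Function.iterate_succ_apply' (dirDer u) (k + 1 - 1)]
      simp only [Nat.add_sub_cancel, Nat.succ_eq_add_one]
      rw [add_assoc, ← add_smul]
      congr 2
      push_cast
      ring

theorem laplacian_add (A : Matrix (Fin n) (Fin n) ℤ) (f g : MvPolynomial (Fin n) ℂ) :
    laplacian A (f + g) = laplacian A f + laplacian A g := by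
  simp only [laplacian, map_add, mul_add, Finset.sum_add_distrib]

theorem laplacian_smul (A : Matrix (Fin n) (Fin n) ℤ) (a : ℂ) (f : MvPolynomial (Fin n) ℂ) :
    laplacian A (a • f) = a • laplacian A f := by
  simp only [laplacian, Derivation.map_smul, Finset.smul_sum, mul_smul_comm]

/-- The Laplacian as a linear map. -/
def laplacianₗ (A : Matrix (Fin n) (Fin n) ℤ) :
    MvPolynomial (Fin n) ℂ →ₗ[ℂ] MvPolynomial (Fin n) ℂ where
  toFun := laplacian A
  map_add' := laplacian_add A
  map_smul' := laplacian_smul A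

theorem laplacian_iterate (A : Matrix (Fin n) (Fin n) ℤ) (k : ℕ) :
    (laplacian A)^[k] = ⇑((laplacianₗ A) ^ k) := by
  rw [Module.End.coe_pow]; rfl

theorem pderiv_dirDer_comm (i : Fin n) (w : Fin n → ℝ) (f : MvPolynomial (Fin n) ℂ) :
    pderiv i (dirDer w f) = dirDer w (pderiv i f) := by
  have h : (pderiv i : Derivation ℂ (MvPolynomial (Fin n) ℂ) _) = dirDer (Pi.single i 1) := by
    apply MvPolynomial.derivation_ext
    intro j
    simp [dirDer_apply, pderiv_X, Pi.single_apply, apply_ite]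
  rw [h, dirDer_comm]

theorem laplacian_dirDer (A : Matrix (Fin n) (Fin n) ℤ) (w : Fin n → ℝ)
    (f : MvPolynomial (Fin n) ℂ) :
    laplacian A (dirDer w f) = dirDer w (laplacian A f) := by
  simp only [laplacian, map_sum, Derivation.leibniz, pderiv_dirDer_comm, smul_eq_mul]
  refine Finset.sum_congr rfl fun i _ => Finset.sum_congr rfl fun j _ => ?_
  have : dirDer w (C ((((realMat A)⁻¹ i j : ℝ)) : ℂ) : MvPolynomial (Fin n) ℂ) = 0 := by
    rw [← algebraMap_eq, Derivation.map_algebraMap]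
  rw [this, mul_zero, add_zero]

/-- The commutator `[Δ, B(w,·)] = 2∂_w`: the gradient of `B(w,·)` is `Aw`, which `A⁻¹` turns back
into `w`. The two equal cross terms use the symmetry of `A⁻¹`. -/
theorem laplacian_linPoly_mul {A : Matrix (Fin n) (Fin n) ℤ} (hA : A.IsSymm)
    (hdet : IsUnit (realMat A).det) (w : Fin n → ℝ) (f : MvPolynomial (Fin n) ℂ) :
    laplacian A (linPoly A w * f) = linPoly A w * laplacian A f + (2 : ℂ) • dirDer w f := by
  have hinv : (realMat A)⁻¹ *ᵥ (realMat A *ᵥ w) = w := by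
    rw [mulVec_mulVec, Matrix.nonsing_inv_mul _ hdet, one_mulVec]
  have hsymm : ∀ i j, (realMat A)⁻¹ i j = (realMat A)⁻¹ j i := by
    intro i j
    have : ((realMat A)⁻¹)ᵀ = (realMat A)⁻¹ := by
      rw [Matrix.transpose_nonsing_inv, realMat_transpose hA]
    exact congrFun (congrFun this j) i
  have hw : ∀ i, ∑ j, (realMat A)⁻¹ i j * (realMat A *ᵥ w) j = w i := fun i => congrFun hinv i
  have hterm : ∀ i j, pderiv i (pderiv j (linPoly A w * f)) =
      linPoly A w * pderiv i (pderiv j f) + C (((realMat A *ᵥ w) i : ℝ) : ℂ) * pderiv j f +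
        C (((realMat A *ᵥ w) j : ℝ) : ℂ) * pderiv i f := by
    intro i j
    simp only [Derivation.leibniz, pderiv_linPoly, map_add, smul_eq_mul, pderiv_C, mul_zero]
    ring
  have h1 : ∑ i, ∑ j, C ((((realMat A)⁻¹ i j : ℝ)) : ℂ) *
      (C (((realMat A *ᵥ w) j : ℝ) : ℂ) * pderiv i f) = dirDer w f := by
    rw [dirDer_apply]
    refine Finset.sum_congr rfl fun i _ => ?_
    rw [← hw i]
    simp only [Complex.ofReal_sum, map_sum, Finset.sum_mul, Complex.ofReal_mul, C_mul, mul_assoc]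
  have h2 : ∑ i, ∑ j, C ((((realMat A)⁻¹ i j : ℝ)) : ℂ) *
      (C (((realMat A *ᵥ w) i : ℝ) : ℂ) * pderiv j f) = dirDer w f := by
    rw [Finset.sum_comm, ← h1]
    refine Finset.sum_congr rfl fun i _ => Finset.sum_congr rfl fun j _ => ?_
    rw [hsymm j i]
  have h3 : ∑ i, ∑ j, C ((((realMat A)⁻¹ i j : ℝ)) : ℂ) *
      (linPoly A w * pderiv i (pderiv j f)) = linPoly A w * laplacian A f := by
    simp only [laplacian, Finset.mul_sum]
    exact Finset.sum_congr rfl fun i _ => Finset.sum_congr rfl fun j _ => mul_left_comm _ _ _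
  have h4 : laplacian A (linPoly A w * f) = linPoly A w * laplacian A f + dirDer w f +
      dirDer w f := by
    rw [← h3]
    nth_rewrite 2 [← h1]
    rw [← h2, ← Finset.sum_add_distrib, ← Finset.sum_add_distrib]
    refine Finset.sum_congr rfl fun i _ => ?_
    rw [← Finset.sum_add_distrib, ← Finset.sum_add_distrib]
    refine Finset.sum_congr rfl fun j _ => ?_
    rw [hterm, mul_add, mul_add]
  rw [h4, two_smul, add_assoc]

theorem laplacian_iterate_linPoly_mul {A : Matrix (Fin n) (Fin n) ℤ} (hA : A.IsSymm)
    (hdet : IsUnit (realMat A).det) (w : Fin n → ℝ) (f : MvPolynomial (Fin n) ℂ) (k : ℕ) :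
    (laplacian A)^[k] (linPoly A w * f) = linPoly A w * (laplacian A)^[k] f +
      (2 * (k : ℂ)) • dirDer w ((laplacian A)^[k - 1] f) := by
  induction k with
  | zero => simp
  | succ k ih =>
    rw [Function.iterate_succ_apply', ih, laplacian_add, laplacian_linPoly_mul hA hdet,
      laplacian_smul, laplacian_dirDer, ← Function.iterate_succ_apply' (laplacian A)]
    rcases k with _ | k
    · simp
    · rw [← Function.iterate_succ_apply' (laplacian A) (k + 1 - 1)]
      simp only [Nat.add_sub_cancel, Nat.succ_eq_add_one]
      rw [add_assoc, ← add_smul]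
      congr 2
      push_cast
      ring

theorem laplacian_isHomogeneous (A : Matrix (Fin n) (Fin n) ℤ) {f : MvPolynomial (Fin n) ℂ}
    {d : ℕ} (hf : f.IsHomogeneous d) : (laplacian A f).IsHomogeneous (d - 1 - 1) := by
  refine IsHomogeneous.sum _ _ _ fun i _ => IsHomogeneous.sum _ _ _ fun j _ => ?_
  have := (isHomogeneous_C (Fin n) ((((realMat A)⁻¹ i j : ℝ)) : ℂ)).mul
    ((hf.pderiv (i := j)).pderiv (i := i))
  rwa [zero_add] at this

/-- A crude bound (`d < 2k` would do), sufficient to truncate the exponential series. -/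
theorem laplacian_iterate_eq_zero (A : Matrix (Fin n) (Fin n) ℤ) {f : MvPolynomial (Fin n) ℂ}
    {d k : ℕ} (hf : f.IsHomogeneous d) (hk : d < k) : (laplacian A)^[k] f = 0 := by
  induction k generalizing d f with
  | zero => omega
  | succ k ih =>
    have hz : (laplacian A)^[k] 0 = 0 := by rw [laplacian_iterate, map_zero]
    rw [Function.iterate_succ_apply]
    rcases d with _ | d
    · have : f = C (coeff 0 f) := totalDegree_eq_zero_iff_eq_C.mp
        (Nat.le_zero.mp hf.totalDegree_le)
      have h0 : laplacian A f = 0 := by rw [this]; simp [laplacian]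
      rw [h0, hz]
    · exact ih (laplacian_isHomogeneous A hf) (by omega)

/-- The partial sums of the exponential series `e^{-Δ/8π}`. -/
def hatSum (A : Matrix (Fin n) (Fin n) ℤ) (N : ℕ) (f : MvPolynomial (Fin n) ℂ) :
    MvPolynomial (Fin n) ℂ :=
  ∑ k ∈ Finset.range N,
    ((-1) ^ k / ((8 * (Real.pi : ℂ)) ^ k * (k.factorial : ℂ))) • (laplacian A)^[k] f

/-- Frees the length of the sum from `totalDegree`, so that series of polynomials of different
degrees can be compared and added. -/
theorem hat_eq_hatSum (A : Matrix (Fin n) (Fin n) ℤ) {f : MvPolynomial (Fin n) ℂ} {d N : ℕ}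
    (hf : f.IsHomogeneous d) (hN : d < N) : hat A f = hatSum A N f := by
  have h : ∀ M : ℕ, (∀ k, M ≤ k → (laplacian A)^[k] f = 0) → ∀ M', M ≤ M' →
      hatSum A M f = hatSum A M' f := by
    intro M hM M' hMM
    refine Finset.sum_subset (Finset.range_mono hMM) fun k _ hk => ?_
    rw [hM k (by simpa using hk), smul_zero]
  have hhat : hat A f = hatSum A (f.totalDegree + 1) f := by
    simp only [hat, hatSum, smul_eq_C_mul]
  rw [hhat]
  by_cases hf0 : f = 0
  · subst hf0
    have hz : ∀ k, (laplacian A)^[k] (0 : MvPolynomial (Fin n) ℂ) = 0 := fun k => by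
      rw [laplacian_iterate, map_zero]
    simp [hatSum, hz]
  · rw [hf.totalDegree hf0]
    exact h _ (fun k hk => laplacian_iterate_eq_zero A hf (by omega)) _ (by omega)

theorem hatSum_add (A : Matrix (Fin n) (Fin n) ℤ) (N : ℕ) (f g : MvPolynomial (Fin n) ℂ) :
    hatSum A N (f + g) = hatSum A N f + hatSum A N g := by
  simp only [hatSum, laplacian_iterate, map_add, smul_add, Finset.sum_add_distrib]

/-- The creation operator `B(w,·) - ∂_w / 4π`. -/
def create (A : Matrix (Fin n) (Fin n) ℤ) (w : Fin n → ℝ) (g : MvPolynomial (Fin n) ℂ) :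
    MvPolynomial (Fin n) ℂ :=
  linPoly A w * g - (1 / (4 * (Real.pi : ℂ))) • dirDer w g

/-- Conjugation by an exponential: `[Δ, B(w,·)] = 2∂_w` commutes with `Δ`, so moving `e^{-Δ/8π}`
past `B(w,·)` costs exactly `-∂_w/4π`. -/
theorem hatSum_linPoly_mul {A : Matrix (Fin n) (Fin n) ℤ} (hA : A.IsSymm)
    (hdet : IsUnit (realMat A).det) (w : Fin n → ℝ) {f : MvPolynomial (Fin n) ℂ} {d N : ℕ}
    (hf : f.IsHomogeneous d) (hN : d < N) :
    hatSum A (N + 1) (linPoly A w * f) = create A w (hatSum A N f) := by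
  have hpi : (Real.pi : ℂ) ≠ 0 := by exact_mod_cast Real.pi_ne_zero
  simp only [hatSum, laplacian_iterate_linPoly_mul hA hdet, smul_add, Finset.sum_add_distrib]
  rw [create, Finset.mul_sum, Finset.sum_range_succ, laplacian_iterate_eq_zero A hf hN, mul_zero,
    smul_zero, add_zero, sub_eq_add_neg]
  congr 1
  · exact Finset.sum_congr rfl fun k _ => (mul_smul_comm _ _ _).symm
  · rw [Finset.sum_range_succ', map_sum, Finset.smul_sum, ← Finset.sum_neg_distrib]
    simp only [Nat.cast_zero, mul_zero, zero_smul, smul_zero, add_zero, Nat.add_sub_cancel,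
      Derivation.map_smul, smul_smul]
    refine Finset.sum_congr rfl fun k _ => ?_
    rw [← neg_smul]
    congr 1
    have hk : ((k : ℂ) + 1) ≠ 0 := by exact_mod_cast Nat.succ_ne_zero k
    have hk' : (k.factorial : ℂ) ≠ 0 := by exact_mod_cast k.factorial_ne_zero
    rw [Nat.factorial_succ]
    push_cast
    field_simp
    ring

theorem linPoly_isHomogeneous (A : Matrix (Fin n) (Fin n) ℤ) (w : Fin n → ℝ) :
    (linPoly A w).IsHomogeneous 1 := by
  refine IsHomogeneous.sum _ _ _ fun i _ => ?_
  have := (isHomogeneous_C (Fin n) (((realMat A *ᵥ w) i : ℝ) : ℂ)).mul (isHomogeneous_X ℂ i)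
  rwa [zero_add] at this

/-- By nondegeneracy every variable is some `B(w,·)`, so multiplication by variables is covered by
the creation operators. -/
theorem linPoly_inv_single {A : Matrix (Fin n) (Fin n) ℤ} (hdet : IsUnit (realMat A).det)
    (i : Fin n) : linPoly A ((realMat A)⁻¹ *ᵥ Pi.single i 1) = X i := by
  unfold linPoly
  rw [mulVec_mulVec, Matrix.mul_nonsing_inv _ hdet, one_mulVec]
  simp [Pi.single_apply, apply_ite]

/-- Induction for the polynomials `e^{-Δ/8π} f` with `f` homogeneous: they are generated from `1` by
the creation operators. -/
theorem hat_induction {A : Matrix (Fin n) (Fin n) ℤ} (hA : A.IsSymm)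
    (hdet : IsUnit (realMat A).det) {T : ℕ → MvPolynomial (Fin n) ℂ → Prop}
    (zero : ∀ d, T d 0) (add : ∀ d f g, T d f → T d g → T d (f + g))
    (smul : ∀ d (a : ℂ) f, T d f → T d (a • f)) (one : T 0 1)
    (step : ∀ d g w, T d g → T (d + 1) (create A w g))
    {f : MvPolynomial (Fin n) ℂ} {d : ℕ} (hf : f.IsHomogeneous d) : T d (hat A f) := by
  have hmon : ∀ (s : Fin n →₀ ℕ) (a : ℂ), ∃ m, (monomial s a).IsHomogeneous m ∧
      T m (hat A (monomial s a)) := by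
    intro s a
    refine MvPolynomial.induction_on_monomial
      (motive := fun p => ∃ m, p.IsHomogeneous m ∧ T m (hat A p)) (fun b => ?_) (fun p i hp => ?_) s a
    · refine ⟨0, isHomogeneous_C _ _, ?_⟩
      rw [hat_eq_hatSum A (isHomogeneous_C _ _) zero_lt_one]
      have : hatSum A 1 (C b) = b • 1 := by
        simp [hatSum, smul_eq_C_mul]
      rw [this]
      exact smul 0 b 1 one
    · obtain ⟨m, hm, hT⟩ := hp
      refine ⟨m + 1, hm.mul (isHomogeneous_X ℂ i), ?_⟩
      rw [mul_comm, ← linPoly_inv_single hdet i, hat_eq_hatSum A (d := m + 1) (N := m + 1 + 1)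
        (by rw [add_comm]; exact (linPoly_isHomogeneous A _).mul hm) (by omega),
        hatSum_linPoly_mul hA hdet _ hm (by omega), ← hat_eq_hatSum A hm (by omega)]
      exact step m _ _ hT
  have hsum : ∀ (S : Finset (Fin n →₀ ℕ)), T d (∑ s ∈ S, hatSum A (d + 1) (monomial s (coeff s f))) := by
    intro S
    induction S using Finset.induction_on with
    | empty => simpa using zero d
    | insert s S hs ih =>
      rw [Finset.sum_insert hs]
      refine add _ _ _ ?_ ih
      -- The zero monomial is homogeneous of every degree; only for a nonzero coefficient can the
      -- degree supplied by `hmon` be identified with `d`.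
      by_cases hc : coeff s f = 0
      · rw [hc]
        have : hatSum A (d + 1) (monomial s (0 : ℂ)) = 0 := by
          simp [hatSum, laplacian_iterate]
        rw [this]
        exact zero d
      · obtain ⟨m, hm, hT⟩ := hmon s (coeff s f)
        have hsd : s.degree = d := by
          have := hf hc
          rwa [Finsupp.degree_eq_weight_one]
        have hmd : (monomial s (coeff s f)).IsHomogeneous d := isHomogeneous_monomial _ hsd
        have hmeq : m = d := hm.inj_right hmd (by simpa using hc)
        subst hmeq
        rwa [← hat_eq_hatSum A hmd (by omega)]
  rw [hat_eq_hatSum A hf (Nat.lt_succ_self d)]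
  have := hsum f.support
  have hlin : ∀ (S : Finset (Fin n →₀ ℕ)), hatSum A (d + 1) (∑ s ∈ S, monomial s (coeff s f)) =
      ∑ s ∈ S, hatSum A (d + 1) (monomial s (coeff s f)) := by
    intro S
    induction S using Finset.induction_on with
    | empty => simp [hatSum, laplacian_iterate]
    | insert s S hs ih => rw [Finset.sum_insert hs, hatSum_add, ih, Finset.sum_insert hs]
  rwa [← hlin, ← MvPolynomial.as_sum] at this

theorem create_iterate (A : Matrix (Fin n) (Fin n) ℤ) (u w : Fin n → ℝ)
    (g : MvPolynomial (Fin n) ℂ) (k : ℕ) :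
    (dirDer u)^[k] (create A w g) = create A w ((dirDer u)^[k] g) +
      ((k : ℂ) * ((B A u w : ℝ) : ℂ)) • (dirDer u)^[k - 1] g := by
  rw [create, dirDer_iterate_sub, dirDer_iterate_linPoly_mul, dirDer_iterate_smul,
    ← dirDer_iterate_comm, create]
  abel

/-- `∂_w^k` annihilates `g` for `k > m`. -/
def DegLE (m : ℕ) (g : MvPolynomial (Fin n) ℂ) : Prop :=
  ∀ (w : Fin n → ℝ) (k : ℕ), m < k → (dirDer w)^[k] g = 0

theorem dirDer_iterate_zero (w : Fin n → ℝ) (k : ℕ) :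
    (dirDer w)^[k] (0 : MvPolynomial (Fin n) ℂ) = 0 := iterate_map_zero (dirDer w) k

theorem DegLE.create {A : Matrix (Fin n) (Fin n) ℤ} {m : ℕ} {g : MvPolynomial (Fin n) ℂ}
    (hg : DegLE m g) (w : Fin n → ℝ) : DegLE (m + 1) (create A w g) := by
  intro u k hk
  rw [create_iterate, hg u k (by omega), hg u (k - 1) (by omega)]
  simp [IndefTheta.create]

/-- Allows the sums over `k` which define `p^c[f]` to be lengthened at will. -/
theorem degLE_hat {A : Matrix (Fin n) (Fin n) ℤ} (hA : A.IsSymm)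
    (hdet : IsUnit (realMat A).det) {f : MvPolynomial (Fin n) ℂ} {d : ℕ}
    (hf : f.IsHomogeneous d) : DegLE d (hat A f) := by
  refine hat_induction hA hdet (T := DegLE) (fun d w k _ => dirDer_iterate_zero w k)
    (fun d f g hf hg w k hk => ?_) (fun d a f hf w k hk => ?_) (fun w k hk => ?_)
    (fun d g w hg => hg.create w) hf
  · rw [iterate_map_add, hf w k hk, hg w k hk, add_zero]
  · rw [dirDer_iterate_smul, hf w k hk, smul_zero]
  · obtain ⟨k, rfl⟩ := Nat.exists_eq_succ_of_ne_zero hk.ne'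
    rw [Function.iterate_succ_apply, Derivation.map_one_eq_zero, dirDer_iterate_zero]

end Polynomials

/-! ### Evaluation at real vectors. -/

section Evaluation

theorem evalReal_add (f g : MvPolynomial (Fin n) ℂ) (v : Fin n → ℝ) :
    evalReal (f + g) v = evalReal f v + evalReal g v := map_add _ _ _

theorem evalReal_sub (f g : MvPolynomial (Fin n) ℂ) (v : Fin n → ℝ) :
    evalReal (f - g) v = evalReal f v - evalReal g v := map_sub _ _ _

theorem evalReal_mul (f g : MvPolynomial (Fin n) ℂ) (v : Fin n → ℝ) :
    evalReal (f * g) v = evalReal f v * evalReal g v := map_mul _ _ _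

theorem evalReal_smul (a : ℂ) (f : MvPolynomial (Fin n) ℂ) (v : Fin n → ℝ) :
    evalReal (a • f) v = a * evalReal f v := by
  simp [evalReal, smul_eval]

theorem evalReal_sum {ι : Type*} (s : Finset ι) (f : ι → MvPolynomial (Fin n) ℂ)
    (v : Fin n → ℝ) : evalReal (∑ i ∈ s, f i) v = ∑ i ∈ s, evalReal (f i) v := map_sum _ _ _

theorem evalReal_zero (v : Fin n → ℝ) : evalReal (0 : MvPolynomial (Fin n) ℂ) v = 0 :=
  map_zero _

theorem evalReal_one (v : Fin n → ℝ) : evalReal (1 : MvPolynomial (Fin n) ℂ) v = 1 :=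
  map_one _

theorem evalReal_linPoly {A : Matrix (Fin n) (Fin n) ℤ} (hA : A.IsSymm) (w v : Fin n → ℝ) :
    evalReal (linPoly A w) v = (B A w v : ℂ) := by
  rw [B_comm hA]
  simp [evalReal, linPoly, B, dotProduct, mul_comm]

theorem evalReal_create {A : Matrix (Fin n) (Fin n) ℤ} (hA : A.IsSymm) (w : Fin n → ℝ)
    (g : MvPolynomial (Fin n) ℂ) (v : Fin n → ℝ) :
    evalReal (create A w g) v =
      (B A w v : ℂ) * evalReal g v - 1 / (4 * (Real.pi : ℂ)) * evalReal (dirDer w g) v := by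
  rw [create, evalReal_sub, evalReal_mul, evalReal_smul, evalReal_linPoly hA]

@[fun_prop] theorem continuous_evalReal (f : MvPolynomial (Fin n) ℂ) : Continuous (evalReal f) := by
  unfold evalReal
  exact (MvPolynomial.continuous_eval f).comp (by fun_prop)

theorem hasDerivAt_evalReal (f : MvPolynomial (Fin n) ℂ) {γ : ℝ → Fin n → ℝ} {γ' : Fin n → ℝ}
    {t : ℝ} (hγ : HasDerivAt γ γ' t) :
    HasDerivAt (fun s => evalReal f (γ s)) (evalReal (dirDer γ' f) (γ t)) t := by
  induction f using MvPolynomial.induction_on with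
  | C a =>
    have h1 : ∀ v : Fin n → ℝ, evalReal (C a) v = a := fun v => by simp [evalReal]
    have h2 : dirDer γ' (C a : MvPolynomial (Fin n) ℂ) = 0 := by
      rw [← algebraMap_eq, Derivation.map_algebraMap]
    simp only [h1, h2, evalReal_zero]
    exact hasDerivAt_const t a
  | add f g hf hg =>
    simp only [evalReal_add, map_add]
    exact hf.add hg
  | mul_X f i hf =>
    have h1 : ∀ v : Fin n → ℝ, evalReal (X i) v = (v i : ℂ) := fun v => by simp [evalReal]
    have h2 : dirDer γ' (X i : MvPolynomial (Fin n) ℂ) = C ((γ' i : ℝ) : ℂ) := by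
      simp [dirDer_apply, pderiv_X, Pi.single_apply]
    have h3 : evalReal (C ((γ' i : ℝ) : ℂ)) (γ t) = (γ' i : ℂ) := by simp [evalReal]
    have hi : HasDerivAt (fun s => ((γ s i : ℝ) : ℂ)) (γ' i : ℂ) t :=
      ((hasDerivAt_pi.mp hγ) i).ofReal_comp
    simp only [Derivation.leibniz, evalReal_add, evalReal_mul, h1, h2, smul_eq_mul, h3]
    exact (hf.mul hi).congr_deriv (by ring)

end Evaluation

end

end IndefTheta

/-! ### Derivatives of `E`, and the sums which define `p^c[f]` as functions of `v` and of `c`. -/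

namespace IndefTheta

noncomputable section

open Matrix

variable {n : ℕ}

section ErrorFunction

/-- The polynomial factors in the derivatives of `E`. -/
def hermiteFactor : ℕ → Polynomial ℝ
  | 0 => Polynomial.C 2
  | k + 1 => Polynomial.derivative (hermiteFactor k) -
      Polynomial.C (2 * Real.pi) * Polynomial.X * hermiteFactor k

/-- The derivatives of `E`. -/
def derivE : ℕ → ℝ → ℝ
  | 0 => E
  | k + 1 => fun x => (hermiteFactor k).eval x * Real.exp (-Real.pi * x ^ 2)

theorem hasDerivAt_derivE (k : ℕ) (x : ℝ) : HasDerivAt (derivE k) (derivE (k + 1) x) x := by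
  have hexp : HasDerivAt (fun x : ℝ => Real.exp (-Real.pi * x ^ 2))
      (Real.exp (-Real.pi * x ^ 2) * (-Real.pi * (2 * x))) x := by
    have h1 : HasDerivAt (fun x : ℝ => -Real.pi * x ^ 2) (-Real.pi * (2 * x)) x := by
      simpa using (hasDerivAt_pow 2 x).const_mul (-Real.pi)
    exact h1.exp
  cases k with
  | zero =>
    have h : HasDerivAt (fun z : ℝ => ∫ u in (0 : ℝ)..z, Real.exp (-Real.pi * u ^ 2))
        (Real.exp (-Real.pi * x ^ 2)) x :=
      intervalIntegral.integral_hasDerivAt_right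
        ((by fun_prop : Continuous fun u : ℝ => Real.exp (-Real.pi * u ^ 2)).intervalIntegrable _ _)
        ((by fun_prop : Continuous fun u : ℝ =>
          Real.exp (-Real.pi * u ^ 2)).stronglyMeasurableAtFilter _ _)
        (by fun_prop)
    have h2 := h.const_mul 2
    have h3 : derivE 1 x = 2 * Real.exp (-Real.pi * x ^ 2) := by simp [derivE, hermiteFactor]
    rw [h3]
    exact h2
  | succ k =>
    have h := ((hermiteFactor k).hasDerivAt x).mul hexp
    refine h.congr_deriv ?_
    simp only [derivE, hermiteFactor, Polynomial.eval_sub, Polynomial.eval_mul, Polynomial.eval_C,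
      Polynomial.eval_X]
    ring

theorem iteratedDeriv_E (k : ℕ) : iteratedDeriv k E = derivE k := by
  induction k with
  | zero => simp [derivE]
  | succ k ih =>
    rw [iteratedDeriv_succ, ih]
    funext x
    exact (hasDerivAt_derivE k x).deriv

theorem continuous_derivE (k : ℕ) : Continuous (derivE k) :=
  continuous_iff_continuousAt.mpr fun x => (hasDerivAt_derivE k x).continuousAt

theorem E_neg (x : ℝ) : E (-x) = -E x := by
  unfold E
  have h := intervalIntegral.integral_comp_neg (a := 0) (b := x)
    (fun u : ℝ => Real.exp (-Real.pi * u ^ 2))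
  simp only [neg_zero, even_two, Even.neg_pow] at h
  rw [intervalIntegral.integral_symm, ← h]
  ring

theorem derivE_neg (k : ℕ) (x : ℝ) : derivE k (-x) = (-1) ^ (k + 1) * derivE k x := by
  induction k generalizing x with
  | zero => simp [derivE, E_neg]
  | succ k ih =>
    have h1 : HasDerivAt (fun y => derivE k (-y)) (-derivE (k + 1) (-x)) x := by
      exact ((hasDerivAt_derivE k (-x)).comp x (hasDerivAt_neg x)).congr_deriv (by ring)
    have h2 : HasDerivAt (fun y => derivE k (-y)) ((-1) ^ (k + 1) * derivE (k + 1) x) x := by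
      rw [funext ih]
      exact (hasDerivAt_derivE k x).const_mul _
    have h3 := h1.unique h2
    rw [pow_succ]
    linarith

end ErrorFunction

section Sums

variable (A : Matrix (Fin n) (Fin n) ℤ)

/-- The coefficient `(-1)^k / ((4π)^k k!)`. -/
def expCoeff (k : ℕ) : ℂ := (-1) ^ k / ((4 * (Real.pi : ℂ)) ^ k * (k.factorial : ℂ))

theorem expCoeff_succ (k : ℕ) :
    expCoeff (k + 1) * ((k + 1 : ℕ) : ℂ) = -(1 / (4 * (Real.pi : ℂ))) * expCoeff k := by
  have hpi : (Real.pi : ℂ) ≠ 0 := by exact_mod_cast Real.pi_ne_zero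
  have hk : ((k : ℂ) + 1) ≠ 0 := by exact_mod_cast Nat.succ_ne_zero k
  have hk' : (k.factorial : ℂ) ≠ 0 := by exact_mod_cast k.factorial_ne_zero
  unfold expCoeff
  rw [Nat.factorial_succ]
  push_cast
  field_simp
  ring

/-- The sum `∑ₖ (-1)^k / ((4π)^k k!) φ⁽ᵏ⁾(B(u,v)) ∂_u^k g(v)` with `φ k` in the role of `φ⁽ᵏ⁾`. -/
def pSum (u : Fin n → ℝ) (φ : ℕ → ℝ → ℝ) (N : ℕ) (g : MvPolynomial (Fin n) ℂ)
    (v : Fin n → ℝ) : ℂ :=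
  ∑ k ∈ Finset.range N,
    expCoeff k * ((φ k (B A u v) : ℝ) : ℂ) * evalReal ((dirDer u)^[k] g) v

/-- The multiple of `c` with `Q = -1`. -/
def unitVec (c : Fin n → ℝ) : Fin n → ℝ := (1 / Real.sqrt (-Q A c)) • c

theorem B_unitVec (c v : Fin n → ℝ) : B A (unitVec A c) v = height A c v := by
  rw [unitVec, B_smul_left, height]; ring

theorem p_eq_pSum {c : Fin n → ℝ} (hc : Q A c < 0) (d : ℕ) (f : MvPolynomial (Fin n) ℂ)
    (v : Fin n → ℝ) : p A d c f v = pSum A (unitVec A c) derivE (d + 1) (hat A f) v := by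
  rw [p, if_pos hc, pSum]
  refine Finset.sum_congr rfl fun k _ => ?_
  rw [dirDeriv_eq, iteratedDeriv_E, B_unitVec]
  rfl

variable {A}

theorem pSum_succ {u : Fin n → ℝ} {φ : ℕ → ℝ → ℝ} {N : ℕ} {g : MvPolynomial (Fin n) ℂ}
    (h : (dirDer u)^[N] g = 0) (v : Fin n → ℝ) :
    pSum A u φ (N + 1) g v = pSum A u φ N g v := by
  rw [pSum, Finset.sum_range_succ, h, evalReal_zero, mul_zero, add_zero, pSum]

theorem pSum_add (u : Fin n → ℝ) (φ : ℕ → ℝ → ℝ) (N : ℕ) (f g : MvPolynomial (Fin n) ℂ)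
    (v : Fin n → ℝ) : pSum A u φ N (f + g) v = pSum A u φ N f v + pSum A u φ N g v := by
  simp only [pSum, iterate_map_add, evalReal_add, mul_add, Finset.sum_add_distrib]

theorem pSum_smul (u : Fin n → ℝ) (φ : ℕ → ℝ → ℝ) (N : ℕ) (a : ℂ) (f : MvPolynomial (Fin n) ℂ)
    (v : Fin n → ℝ) : pSum A u φ N (a • f) v = a * pSum A u φ N f v := by
  simp only [pSum, dirDer_iterate_smul, evalReal_smul, Finset.mul_sum]
  exact Finset.sum_congr rfl fun k _ => by ring

/-- The derivative of `pSum` at `v` in the direction `w`. -/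
def pSumDeriv (A : Matrix (Fin n) (Fin n) ℤ) (u : Fin n → ℝ) (φ : ℕ → ℝ → ℝ) (N : ℕ)
    (g : MvPolynomial (Fin n) ℂ) (w v : Fin n → ℝ) : ℂ :=
  ∑ k ∈ Finset.range N, expCoeff k *
    (((φ (k + 1) (B A u v) : ℝ) : ℂ) * ((B A u w : ℝ) : ℂ) * evalReal ((dirDer u)^[k] g) v +
      ((φ k (B A u v) : ℝ) : ℂ) * evalReal (dirDer w ((dirDer u)^[k] g)) v)

theorem hasDerivAt_B_right (A : Matrix (Fin n) (Fin n) ℤ) (u : Fin n → ℝ) {γ : ℝ → Fin n → ℝ}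
    {γ' : Fin n → ℝ} {t : ℝ} (hγ : HasDerivAt γ γ' t) :
    HasDerivAt (fun s => B A u (γ s)) (B A u γ') t :=
  ((BL A u).hasFDerivAt.comp_hasDerivAt t hγ)

theorem hasDerivAt_B_left (A : Matrix (Fin n) (Fin n) ℤ) (v : Fin n → ℝ) {γ : ℝ → Fin n → ℝ}
    {γ' : Fin n → ℝ} {t : ℝ} (hγ : HasDerivAt γ γ' t) :
    HasDerivAt (fun s => B A (γ s) v) (B A γ' v) t :=
  (((BL A).flip v).hasFDerivAt.comp_hasDerivAt t hγ)

theorem hasDerivAt_pSum {φ : ℕ → ℝ → ℝ} (hφ : ∀ k x, HasDerivAt (φ k) (φ (k + 1) x) x)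
    (u : Fin n → ℝ) (N : ℕ) (g : MvPolynomial (Fin n) ℂ) {γ : ℝ → Fin n → ℝ} {γ' : Fin n → ℝ}
    {t : ℝ} (hγ : HasDerivAt γ γ' t) :
    HasDerivAt (fun s => pSum A u φ N g (γ s)) (pSumDeriv A u φ N g γ' (γ t)) t := by
  unfold pSum pSumDeriv
  refine HasDerivAt.fun_sum fun k _ => ?_
  have h1 : HasDerivAt (fun s => ((φ k (B A u (γ s)) : ℝ) : ℂ))
      ((φ (k + 1) (B A u (γ t)) * B A u γ' : ℝ) : ℂ) t :=
    ((hφ k _).comp t (hasDerivAt_B_right A u hγ)).ofReal_comp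
  have h2 := ((h1.const_mul (expCoeff k)).mul (hasDerivAt_evalReal ((dirDer u)^[k] g) hγ))
  refine h2.congr_deriv ?_
  push_cast
  ring

/-- The sum `∑ₖ (-1)^k / ((4π)^k k!) k x_k y_{k-1}` rewritten by the recursion of the
coefficients. -/
theorem sum_expCoeff_shift (N : ℕ) (x y : ℕ → ℂ) (hy : y N = 0) :
    ∑ k ∈ Finset.range (N + 1), expCoeff k * x k * ((k : ℂ) * y (k - 1)) =
      -(1 / (4 * (Real.pi : ℂ))) * ∑ k ∈ Finset.range (N + 1), expCoeff k * x (k + 1) * y k := by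
  rw [Finset.sum_range_succ', Finset.sum_range_succ, hy, mul_zero,
    add_zero, Finset.mul_sum]
  simp only [Nat.cast_zero, zero_mul, mul_zero, add_zero, Nat.add_sub_cancel]
  refine Finset.sum_congr rfl fun k _ => ?_
  linear_combination x (k + 1) * y k * expCoeff_succ k

/-- The creation operator on `g` acts on the whole sum as `B(w,v) - ∂_w/4π`. The Leibniz terms `k
B(u,w) ∂_u^{k-1} g` become, by the recursion of the coefficients, the terms in which `∂_w` falls on
`φ⁽ᵏ⁾(B(u,v))`. -/
theorem pSum_create (hA : A.IsSymm) (φ : ℕ → ℝ → ℝ) {u : Fin n → ℝ} {N : ℕ}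
    {g : MvPolynomial (Fin n) ℂ} (h : (dirDer u)^[N] g = 0) (w v : Fin n → ℝ) :
    pSum A u φ (N + 1) (create A w g) v =
      (B A w v : ℂ) * pSum A u φ (N + 1) g v -
        1 / (4 * (Real.pi : ℂ)) * pSumDeriv A u φ (N + 1) g w v := by
  have hs := sum_expCoeff_shift N (fun k => ((φ k (B A u v) : ℝ) : ℂ))
    (fun k => (B A u w : ℂ) * evalReal ((dirDer u)^[k] g) v) (by rw [h, evalReal_zero, mul_zero])
  have h1 : pSum A u φ (N + 1) (create A w g) v =
      (∑ k ∈ Finset.range (N + 1), expCoeff k * ((φ k (B A u v) : ℝ) : ℂ) *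
        ((B A w v : ℂ) * evalReal ((dirDer u)^[k] g) v -
          1 / (4 * (Real.pi : ℂ)) * evalReal (dirDer w ((dirDer u)^[k] g)) v)) +
      ∑ k ∈ Finset.range (N + 1), expCoeff k * ((φ k (B A u v) : ℝ) : ℂ) *
        ((k : ℂ) * ((B A u w : ℂ) * evalReal ((dirDer u)^[k - 1] g) v)) := by
    rw [pSum, ← Finset.sum_add_distrib]
    refine Finset.sum_congr rfl fun k _ => ?_
    rw [create_iterate, evalReal_add, evalReal_create hA, evalReal_smul]
    ring
  rw [h1, hs, pSum, pSumDeriv, Finset.mul_sum, Finset.mul_sum, Finset.mul_sum,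
    ← Finset.sum_add_distrib, ← Finset.sum_sub_distrib]
  exact Finset.sum_congr rfl fun k _ => by ring

/-- Exhibits the polynomial dependence on the direction `w`; continuity, derivatives and bounds in
`w` follow by induction on `k`. -/
theorem evalReal_dirDer_iterate_succ (w : Fin n → ℝ) (g : MvPolynomial (Fin n) ℂ) (k : ℕ)
    (v : Fin n → ℝ) :
    evalReal ((dirDer w)^[k + 1] g) v =
      ∑ i, (w i : ℂ) * evalReal ((dirDer w)^[k] (MvPolynomial.pderiv i g)) v := by
  have h : ∀ s : Finset (Fin n), (dirDer w)^[k] (∑ i ∈ s, ((w i : ℝ) : ℂ) • MvPolynomial.pderiv i g) =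
      ∑ i ∈ s, ((w i : ℝ) : ℂ) • (dirDer w)^[k] (MvPolynomial.pderiv i g) := by
    intro s
    induction s using Finset.induction_on with
    | empty => simp
    | insert i s hi ih =>
      rw [Finset.sum_insert hi, iterate_map_add, ih, dirDer_iterate_smul, Finset.sum_insert hi]
  rw [Function.iterate_succ_apply, dirDer_apply]
  simp only [← MvPolynomial.smul_eq_C_mul]
  rw [h, evalReal_sum]
  simp only [evalReal_smul]

theorem evalReal_iterate_dirDer (u w : Fin n → ℝ) (g : MvPolynomial (Fin n) ℂ) (k : ℕ)
    (v : Fin n → ℝ) :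
    evalReal ((dirDer u)^[k] (dirDer w g)) v =
      ∑ i, (w i : ℂ) * evalReal ((dirDer u)^[k] (MvPolynomial.pderiv i g)) v := by
  have h : ∀ s : Finset (Fin n), (dirDer u)^[k] (∑ i ∈ s, ((w i : ℝ) : ℂ) • MvPolynomial.pderiv i g) =
      ∑ i ∈ s, ((w i : ℝ) : ℂ) • (dirDer u)^[k] (MvPolynomial.pderiv i g) := by
    intro s
    induction s using Finset.induction_on with
    | empty => simp
    | insert i s hi ih =>
      rw [Finset.sum_insert hi, iterate_map_add, ih, dirDer_iterate_smul, Finset.sum_insert hi]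
  rw [dirDer_apply]
  simp only [← MvPolynomial.smul_eq_C_mul]
  rw [h, evalReal_sum]
  simp only [evalReal_smul]

/-- Directional derivatives commute, so the power `∂_γ^k` differentiates in `γ` like a commutative
`k`-th power. -/
theorem hasDerivAt_evalReal_dirDer_iterate {γ : ℝ → Fin n → ℝ} {γ' : Fin n → ℝ} {t : ℝ}
    (hγ : HasDerivAt γ γ' t) (v : Fin n → ℝ) (k : ℕ) (g : MvPolynomial (Fin n) ℂ) :
    HasDerivAt (fun s => evalReal ((dirDer (γ s))^[k] g) v)
      ((k : ℂ) * evalReal (dirDer γ' ((dirDer (γ t))^[k - 1] g)) v) t := by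
  induction k generalizing g with
  | zero => simpa using hasDerivAt_const t (evalReal g v)
  | succ k ih =>
    simp only [evalReal_dirDer_iterate_succ]
    have h1 : HasDerivAt (fun s => ∑ i, (γ s i : ℂ) *
        evalReal ((dirDer (γ s))^[k] (MvPolynomial.pderiv i g)) v)
        (∑ i, ((γ' i : ℂ) * evalReal ((dirDer (γ t))^[k] (MvPolynomial.pderiv i g)) v +
          (γ t i : ℂ) * ((k : ℂ) * evalReal (dirDer γ' ((dirDer (γ t))^[k - 1]
            (MvPolynomial.pderiv i g))) v))) t :=
      HasDerivAt.fun_sum fun i _ => ((hasDerivAt_pi.mp hγ) i).ofReal_comp.mul (ih _)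
    refine h1.congr_deriv ?_
    rw [Finset.sum_add_distrib, ← evalReal_iterate_dirDer, ← dirDer_iterate_comm]
    have h2 : ∑ i, (γ t i : ℂ) * ((k : ℂ) * evalReal (dirDer γ' ((dirDer (γ t))^[k - 1]
        (MvPolynomial.pderiv i g))) v) = k * evalReal (dirDer γ' ((dirDer (γ t))^[k] g)) v := by
      rcases k with _ | k
      · simp
      · simp only [Nat.add_sub_cancel, dirDer_iterate_comm, ← pderiv_dirDer_comm]
        rw [evalReal_dirDer_iterate_succ, Finset.mul_sum]
        exact Finset.sum_congr rfl fun i _ => by ring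
    rw [h2, Nat.add_sub_cancel]
    push_cast
    ring

/-- The derivative of `pSum` along a path of vectors of constant norm. -/
theorem hasDerivAt_pSum_left (hA : A.IsSymm) {φ : ℕ → ℝ → ℝ}
    (hφ : ∀ k x, HasDerivAt (φ k) (φ (k + 1) x) x) {N : ℕ} {g : MvPolynomial (Fin n) ℂ}
    {γ : ℝ → Fin n → ℝ} {γ' : Fin n → ℝ} {t : ℝ} (hγ : HasDerivAt γ γ' t)
    (horth : B A (γ t) γ' = 0) (h : (dirDer (γ t))^[N] g = 0) (v : Fin n → ℝ) :
    HasDerivAt (fun s => pSum A (γ s) φ (N + 1) g v)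
      (pSum A (γ t) (fun k => φ (k + 1)) (N + 1) (create A γ' g) v) t := by
  have h1 : HasDerivAt (fun s => pSum A (γ s) φ (N + 1) g v)
      (∑ k ∈ Finset.range (N + 1), expCoeff k *
        (((φ (k + 1) (B A (γ t) v) : ℝ) : ℂ) * (B A γ' v : ℂ) *
            evalReal ((dirDer (γ t))^[k] g) v +
          ((φ k (B A (γ t) v) : ℝ) : ℂ) *
            ((k : ℂ) * evalReal (dirDer γ' ((dirDer (γ t))^[k - 1] g)) v))) t := by
    unfold pSum
    refine HasDerivAt.fun_sum fun k _ => ?_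
    have h1 : HasDerivAt (fun s => ((φ k (B A (γ s) v) : ℝ) : ℂ))
        ((φ (k + 1) (B A (γ t) v) * B A γ' v : ℝ) : ℂ) t :=
      ((hφ k _).comp t (hasDerivAt_B_left A v hγ)).ofReal_comp
    have h2 := (h1.const_mul (expCoeff k)).mul (hasDerivAt_evalReal_dirDer_iterate hγ v k g)
    refine h2.congr_deriv ?_
    push_cast
    ring
  refine h1.congr_deriv ?_
  -- Differentiating `∂_γ^k` produces a factor `k`; the recursion converts these terms into the
  -- `-∂_{γ'}/4π` part of the creation operator, with `φ⁽ᵏ⁺¹⁾` in place of `φ⁽ᵏ⁾`.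
  have hs := sum_expCoeff_shift N (fun k => ((φ k (B A (γ t) v) : ℝ) : ℂ))
    (fun k => evalReal (dirDer γ' ((dirDer (γ t))^[k] g)) v) (by rw [h, map_zero, evalReal_zero])
  have h2 : pSum A (γ t) (fun k => φ (k + 1)) (N + 1) (create A γ' g) v =
      ∑ k ∈ Finset.range (N + 1), expCoeff k * ((φ (k + 1) (B A (γ t) v) : ℝ) : ℂ) *
        ((B A γ' v : ℂ) * evalReal ((dirDer (γ t))^[k] g) v -
          1 / (4 * (Real.pi : ℂ)) * evalReal (dirDer γ' ((dirDer (γ t))^[k] g)) v) := by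
    rw [pSum]
    refine Finset.sum_congr rfl fun k _ => ?_
    -- Orthogonality of `γ` and `γ'` removes the commutator of `∂_γ^k` with the creation operator.
    rw [create_iterate, evalReal_add, evalReal_create hA, evalReal_smul, horth]
    simp
  rw [h2]
  simp only [mul_add, Finset.sum_add_distrib, ← mul_assoc] at hs ⊢
  rw [hs, Finset.mul_sum, ← Finset.sum_add_distrib]
  exact Finset.sum_congr rfl fun k _ => by ring

end Sums

/-! ### Polynomial bounds uniform in a parameter. -/

section Bounds

/-- `F` is bounded by a polynomial in the weight `W`. -/
def PolyBdd {X : Type*} (W : X → ℝ) (F : X → ℂ) : Prop :=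
  ∃ C : ℝ, ∃ M : ℕ, 0 ≤ C ∧ ∀ x, ‖F x‖ ≤ C * W x ^ M

variable {X : Type*} {W : X → ℝ} {F G : X → ℂ}

theorem PolyBdd.add (hW : ∀ x, 1 ≤ W x) (hF : PolyBdd W F) (hG : PolyBdd W G) : PolyBdd W (fun x => F x + G x) := by
  obtain ⟨C, M, hC, hF⟩ := hF
  obtain ⟨D, N, hD, hG⟩ := hG
  refine ⟨C + D, max M N, by positivity, fun x => ?_⟩
  calc ‖F x + G x‖ ≤ C * W x ^ M + D * W x ^ N := (norm_add_le _ _).trans (add_le_add (hF x) (hG x))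
    _ ≤ C * W x ^ max M N + D * W x ^ max M N := by
        gcongr
        · exact hW x
        · exact le_max_left _ _
        · exact hW x
        · exact le_max_right _ _
    _ = _ := by ring

theorem PolyBdd.mul (hF : PolyBdd W F) (hG : PolyBdd W G) : PolyBdd W (fun x => F x * G x) := by
  obtain ⟨C, M, hC, hF⟩ := hF
  obtain ⟨D, N, hD, hG⟩ := hG
  refine ⟨C * D, M + N, by positivity, fun x => ?_⟩
  calc ‖F x * G x‖ ≤ (C * W x ^ M) * (D * W x ^ N) := by
        rw [norm_mul]
        exact mul_le_mul (hF x) (hG x) (norm_nonneg _) ((norm_nonneg _).trans (hF x))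
    _ = _ := by ring

theorem PolyBdd.const (a : ℂ) : PolyBdd W (fun _ => a) :=
  ⟨‖a‖, 0, norm_nonneg _, fun x => by simp⟩

theorem PolyBdd.of_le {C : ℝ} (hC : 0 ≤ C) (h : ∀ x, ‖F x‖ ≤ C * W x) : PolyBdd W F :=
  ⟨C, 1, hC, fun x => by simpa using h x⟩

theorem PolyBdd.const_mul (a : ℂ) (hF : PolyBdd W F) : PolyBdd W (fun x => a * F x) :=
  (PolyBdd.const a).mul hF

theorem PolyBdd.sum (hW : ∀ x, 1 ≤ W x) {ι : Type*} {s : Finset ι} {F : ι → X → ℂ} (hF : ∀ i ∈ s, PolyBdd W (F i)) :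
    PolyBdd W (fun x => ∑ i ∈ s, F i x) := by
  classical
  induction s using Finset.induction_on with
  | empty => simpa using PolyBdd.const 0
  | insert i s hi ih =>
    simp only [Finset.sum_insert hi]
    exact (hF i (Finset.mem_insert_self i s)).add hW
      (ih fun j hj => hF j (Finset.mem_insert_of_mem hj))

theorem PolyBdd.pow (hF : PolyBdd W F) (k : ℕ) : PolyBdd W (fun x => F x ^ k) := by
  induction k with
  | zero => simpa using PolyBdd.const 1
  | succ k ih => simp only [pow_succ]; exact ih.mul hF

theorem polyBdd_evalReal (hW : ∀ x, 1 ≤ W x) {v : X → Fin n → ℝ} (hv : ∀ i, PolyBdd W (fun x => (v x i : ℂ)))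
    (g : MvPolynomial (Fin n) ℂ) : PolyBdd W (fun x => evalReal g (v x)) := by
  induction g using MvPolynomial.induction_on with
  | C a => simpa [evalReal] using PolyBdd.const a
  | add f g hf hg => simp only [evalReal_add]; exact hf.add hW hg
  | mul_X f i hf =>
    simp only [evalReal_mul]
    exact hf.mul (by simpa [evalReal] using hv i)

theorem polyBdd_dirDer_iterate (hW : ∀ x, 1 ≤ W x) {u v : X → Fin n → ℝ} (hu : ∀ i, PolyBdd W (fun x => (u x i : ℂ)))
    (hv : ∀ i, PolyBdd W (fun x => (v x i : ℂ))) (k : ℕ) (g : MvPolynomial (Fin n) ℂ) :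
    PolyBdd W (fun x => evalReal ((dirDer (u x))^[k] g) (v x)) := by
  induction k generalizing g with
  | zero => exact polyBdd_evalReal hW hv g
  | succ k ih =>
    simp only [evalReal_dirDer_iterate_succ]
    exact PolyBdd.sum hW fun i _ => (hu i).mul (ih _)

theorem polyBdd_B (hW : ∀ x, 1 ≤ W x) {A : Matrix (Fin n) (Fin n) ℤ} {u v : X → Fin n → ℝ}
    (hu : ∀ i, PolyBdd W (fun x => (u x i : ℂ))) (hv : ∀ i, PolyBdd W (fun x => (v x i : ℂ))) :
    PolyBdd W (fun x => ((B A (u x) (v x) : ℝ) : ℂ)) := by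
  simp only [B, dotProduct, mulVec]
  push_cast
  exact PolyBdd.sum hW fun i _ => (hu i).mul (PolyBdd.sum hW fun j _ => (PolyBdd.const _).mul (hv j))

theorem polyBdd_dirDer_iterate_create (hW : ∀ x, 1 ≤ W x) {A : Matrix (Fin n) (Fin n) ℤ} (hA : A.IsSymm)
    {u v w : X → Fin n → ℝ} (hu : ∀ i, PolyBdd W (fun x => (u x i : ℂ)))
    (hv : ∀ i, PolyBdd W (fun x => (v x i : ℂ))) (hw : ∀ i, PolyBdd W (fun x => (w x i : ℂ)))
    (k : ℕ) (g : MvPolynomial (Fin n) ℂ) :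
    PolyBdd W (fun x => evalReal ((dirDer (u x))^[k] (create A (w x) g)) (v x)) := by
  simp only [create_iterate, evalReal_add, evalReal_create hA, evalReal_smul, dirDer_iterate_comm,
    evalReal_iterate_dirDer, sub_eq_add_neg, ← neg_mul]
  refine PolyBdd.add hW (PolyBdd.add hW ((polyBdd_B hW hw hv).mul
    (polyBdd_dirDer_iterate hW hu hv k g)) ((PolyBdd.const _).mul
      (PolyBdd.sum hW fun i _ => (hw i).mul (polyBdd_dirDer_iterate hW hu hv k _)))) ?_
  exact ((PolyBdd.const _).mul (polyBdd_B hW hu hw)).mul (polyBdd_dirDer_iterate hW hu hv (k - 1) g)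

/-- The sums formed with the derivatives of the Gaussian `E'` are bounded by a polynomial multiple of
the Gaussian. -/
theorem exists_norm_pSum_le (hW : ∀ x, 1 ≤ W x) {A : Matrix (Fin n) (Fin n) ℤ} {u v : X → Fin n → ℝ}
    {g : X → MvPolynomial (Fin n) ℂ} (N : ℕ)
    (hB : PolyBdd W (fun x => ((B A (u x) (v x) : ℝ) : ℂ)))
    (hg : ∀ k, PolyBdd W (fun x => evalReal ((dirDer (u x))^[k] (g x)) (v x))) :
    ∃ C : ℝ, ∃ M : ℕ, 0 ≤ C ∧ ∀ x, ‖pSum A (u x) (fun k => derivE (k + 1)) N (g x) (v x)‖ ≤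
      C * W x ^ M * Real.exp (-Real.pi * B A (u x) (v x) ^ 2) := by
  have hpoly : PolyBdd W (fun x => ∑ k ∈ Finset.range N, expCoeff k *
      (((hermiteFactor k).eval (B A (u x) (v x)) : ℝ) : ℂ) *
        evalReal ((dirDer (u x))^[k] (g x)) (v x)) := by
    refine PolyBdd.sum hW fun k _ => ((PolyBdd.const _).mul ?_).mul (hg k)
    simp only [Polynomial.eval_eq_sum_range]
    push_cast
    exact PolyBdd.sum hW fun i _ => (PolyBdd.const _).mul (hB.pow i)
  obtain ⟨C, M, hC, h⟩ := hpoly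
  refine ⟨C, M, hC, fun x => ?_⟩
  have heq : pSum A (u x) (fun k => derivE (k + 1)) N (g x) (v x) =
      (∑ k ∈ Finset.range N, expCoeff k *
        (((hermiteFactor k).eval (B A (u x) (v x)) : ℝ) : ℂ) *
          evalReal ((dirDer (u x))^[k] (g x)) (v x)) *
        ((Real.exp (-Real.pi * B A (u x) (v x) ^ 2) : ℝ) : ℂ) := by
    rw [pSum, Finset.sum_mul]
    refine Finset.sum_congr rfl fun k _ => ?_
    simp only [derivE]
    push_cast
    ring
  rw [heq, norm_mul, Complex.norm_real, Real.norm_of_nonneg (Real.exp_pos _).le]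
  gcongr
  exact h x

end Bounds

end

end IndefTheta

/-! ### The rapidly decreasing functions `psi` and their Fourier transforms. -/

namespace IndefTheta

noncomputable section

open Matrix MeasureTheory

variable {n : ℕ}

section Decay

theorem exists_pow_le_exp (M : ℕ) {δ : ℝ} (hδ : 0 < δ) :
    ∃ C : ℝ, 0 ≤ C ∧ ∀ t : ℝ, 0 ≤ t → (1 + t) ^ M ≤ C * Real.exp (δ * t) := by
  refine ⟨M.factorial / δ ^ M * Real.exp δ, by positivity, fun t ht => ?_⟩
  have h := Real.pow_div_factorial_le_exp (δ * (1 + t)) (by positivity) M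
  rw [div_le_iff₀ (by positivity), mul_pow, mul_add, mul_one, Real.exp_add] at h
  rw [div_mul_eq_mul_div, div_mul_eq_mul_div, le_div_iff₀ (by positivity)]
  linarith

/-- Continuity and exponential decay. -/
def ExpDecay (F : (Fin n → ℝ) → ℂ) : Prop :=
  Continuous F ∧ ∃ C ε : ℝ, 0 < ε ∧ ∀ v, ‖F v‖ ≤ C * Real.exp (-ε * ‖v‖)

theorem ExpDecay.integrable {F : (Fin n → ℝ) → ℂ} (hF : ExpDecay F) : Integrable F := by
  obtain ⟨hc, C, ε, hε, h⟩ := hF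
  exact ((integrable_exp_neg_norm hε).const_mul C).mono' hc.aestronglyMeasurable
    (Filter.Eventually.of_forall h)

theorem ExpDecay.of_norm_le {F G : (Fin n → ℝ) → ℂ} (hF : ExpDecay F) (hG : Continuous G)
    (h : ∀ v, ‖G v‖ ≤ ‖F v‖) : ExpDecay G := by
  obtain ⟨_, C, ε, hε, hb⟩ := hF
  exact ⟨hG, C, ε, hε, fun v => (h v).trans (hb v)⟩

theorem ExpDecay.const_mul {F : (Fin n → ℝ) → ℂ} (hF : ExpDecay F) (a : ℂ) :
    ExpDecay fun v => a * F v := by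
  obtain ⟨hc, C, ε, hε, h⟩ := hF
  refine ⟨hc.const_mul a, ‖a‖ * C, ε, hε, fun v => ?_⟩
  rw [norm_mul, mul_assoc]
  gcongr
  exact h v

/-- Half of the decay rate is spent on the linear factor. -/
theorem ExpDecay.B_mul {F : (Fin n → ℝ) → ℂ} (hF : ExpDecay F) (A : Matrix (Fin n) (Fin n) ℤ)
    (w : Fin n → ℝ) : ExpDecay fun v => (B A w v : ℂ) * F v := by
  obtain ⟨hc, C, ε, hε, h⟩ := hF
  obtain ⟨D, hD, hB⟩ := exists_abs_B_le A
  obtain ⟨K, hK, hp⟩ := exists_pow_le_exp 1 (half_pos hε)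
  have hC : 0 ≤ C := by
    have := (norm_nonneg _).trans (h 0)
    simpa using this
  refine ⟨(Complex.continuous_ofReal.comp (by fun_prop)).mul hc, D * ‖w‖ * K * C, ε / 2,
    by positivity, fun v => ?_⟩
  have h1 : ‖v‖ ≤ K * Real.exp (ε / 2 * ‖v‖) := by
    have := hp ‖v‖ (norm_nonneg v)
    rw [pow_one] at this
    linarith
  rw [norm_mul, Complex.norm_real, Real.norm_eq_abs]
  calc |B A w v| * ‖F v‖ ≤ (D * ‖w‖ * (K * Real.exp (ε / 2 * ‖v‖))) *
        (C * Real.exp (-ε * ‖v‖)) := by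
        gcongr
        · exact (hB w v).trans (by gcongr)
        · exact h v
    _ = D * ‖w‖ * K * C * (Real.exp (ε / 2 * ‖v‖) * Real.exp (-ε * ‖v‖)) := by ring
    _ = _ := by rw [← Real.exp_add]; congr 2; ring

end Decay

section Parity

/-- `g(-v) = (-1)^m g(v)`. -/
def HasParity (m : ℕ) (g : MvPolynomial (Fin n) ℂ) : Prop :=
  ∀ v : Fin n → ℝ, evalReal g (-v) = (-1) ^ m * evalReal g v

theorem HasParity.dirDer {m : ℕ} {g : MvPolynomial (Fin n) ℂ} (hg : HasParity m g)
    (w : Fin n → ℝ) : HasParity (m + 1) (dirDer w g) := by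
  intro v
  have hγ : HasDerivAt (fun t : ℝ => v + t • w) w 0 := by
    simpa using ((hasDerivAt_id (0 : ℝ)).smul_const w).const_add v
  have hγ' : HasDerivAt (fun t : ℝ => -(v + t • w)) (-w) 0 := hγ.neg
  have h1 := hasDerivAt_evalReal g hγ'
  have h2 := (hasDerivAt_evalReal g hγ).const_mul ((-1 : ℂ) ^ m)
  have h3 := h1.unique (by simpa only [← hg _] using h2)
  have h4 : IndefTheta.dirDer (-w) g = -IndefTheta.dirDer w g := by
    have := dirDer_smul_left (-1) w g
    simpa using this
  have h5 : evalReal (-IndefTheta.dirDer w g) (-v) = -evalReal (IndefTheta.dirDer w g) (-v) :=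
    map_neg _ _
  simp only [zero_smul, add_zero, h4, h5] at h3
  rw [pow_succ]
  linear_combination -h3

theorem HasParity.iterate {m : ℕ} {g : MvPolynomial (Fin n) ℂ} (hg : HasParity m g)
    (w : Fin n → ℝ) (k : ℕ) : HasParity (m + k) ((IndefTheta.dirDer w)^[k] g) := by
  induction k with
  | zero => exact hg
  | succ k ih =>
    rw [Function.iterate_succ_apply']
    exact ih.dirDer w

theorem HasParity.create {A : Matrix (Fin n) (Fin n) ℤ} (hA : A.IsSymm) {m : ℕ}
    {g : MvPolynomial (Fin n) ℂ} (hg : HasParity m g) (w : Fin n → ℝ) :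
    HasParity (m + 1) (create A w g) := by
  intro v
  rw [evalReal_create hA, evalReal_create hA, hg.dirDer w v, hg v, B_neg_right]
  push_cast
  ring

theorem hasParity_hat {A : Matrix (Fin n) (Fin n) ℤ} (hA : A.IsSymm)
    (hdet : IsUnit (realMat A).det) {f : MvPolynomial (Fin n) ℂ} {d : ℕ}
    (hf : f.IsHomogeneous d) : HasParity d (hat A f) := by
  refine hat_induction hA hdet (T := HasParity) (fun d v => by simp [evalReal_zero])
    (fun d f g hf hg v => ?_) (fun d a f hf v => ?_) (fun v => by simp [evalReal_one])
    (fun d g w hg => hg.create hA w) hf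
  · rw [evalReal_add, evalReal_add, hf v, hg v]; ring
  · rw [evalReal_smul, evalReal_smul, hf v]; ring

/-- The signs `(-1)^k` of `φ⁽ᵏ⁾` and of `∂_u^k` cancel. The offset is `j = 1` for `E` and `j = 0`
for `E'`. -/
theorem pSum_neg {A : Matrix (Fin n) (Fin n) ℤ} {φ : ℕ → ℝ → ℝ} {j m : ℕ}
    (hφ : ∀ k x, φ k (-x) = (-1) ^ (k + j) * φ k x) {g : MvPolynomial (Fin n) ℂ}
    (hg : HasParity m g) (u : Fin n → ℝ) (N : ℕ) (v : Fin n → ℝ) :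
    pSum A u φ N g (-v) = (-1) ^ (m + j) * pSum A u φ N g v := by
  rw [pSum, pSum, Finset.mul_sum]
  refine Finset.sum_congr rfl fun k _ => ?_
  rw [hg.iterate u k v, B_neg_right, hφ]
  have h : ((-1 : ℂ) ^ k) * (-1) ^ k = 1 := by rw [← mul_pow]; simp
  push_cast
  rw [pow_add, pow_add, pow_add]
  linear_combination ((-1) ^ m * (-1) ^ j * expCoeff k * (φ k (B A u v) : ℂ) *
    evalReal ((IndefTheta.dirDer u)^[k] g) v) * h

end Parity

section Psi

/-- `y^{-m/2} P(√y v) exp(2πiτ Q(v))`, where `P` is the sum `pSum` formed with the derivatives of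
`E'`. -/
def psi (A : Matrix (Fin n) (Fin n) ℤ) (u : Fin n → ℝ) (τ : ℂ) (m : ℕ)
    (g : MvPolynomial (Fin n) ℂ) (v : Fin n → ℝ) : ℂ :=
  (((Real.sqrt τ.im : ℝ) : ℂ)⁻¹) ^ m *
    pSum A u (fun k => derivE (k + 1)) (m + 2) g (Real.sqrt τ.im • v) *
      Complex.exp (2 * Real.pi * Complex.I * τ * (Q A v : ℂ))

variable {A : Matrix (Fin n) (Fin n) ℤ}

theorem psi_add (u : Fin n → ℝ) (τ : ℂ) (m : ℕ) (f g : MvPolynomial (Fin n) ℂ) (v : Fin n → ℝ) :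
    psi A u τ m (f + g) v = psi A u τ m f v + psi A u τ m g v := by
  simp only [psi, pSum_add]; ring

theorem psi_smul (u : Fin n → ℝ) (τ : ℂ) (m : ℕ) (a : ℂ) (g : MvPolynomial (Fin n) ℂ)
    (v : Fin n → ℝ) : psi A u τ m (a • g) v = a * psi A u τ m g v := by
  simp only [psi, pSum_smul]; ring

theorem psi_neg {m : ℕ} {g : MvPolynomial (Fin n) ℂ} (hg : HasParity m g) (u : Fin n → ℝ)
    (τ : ℂ) (v : Fin n → ℝ) : psi A u τ m g (-v) = (-1) ^ m * psi A u τ m g v := by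
  have h := pSum_neg (A := A) (φ := fun k => derivE (k + 1)) (j := 0)
    (fun k x => by rw [derivE_neg]; ring) hg u (m + 2) (Real.sqrt τ.im • v)
  simp only [psi, smul_neg, Q_neg, h, add_zero]
  ring

@[fun_prop] theorem continuous_pSum (u : Fin n → ℝ) {φ : ℕ → ℝ → ℝ} (hφ : ∀ k, Continuous (φ k))
    (N : ℕ) (g : MvPolynomial (Fin n) ℂ) : Continuous (pSum A u φ N g) := by
  unfold pSum
  refine continuous_finsetSum _ fun k _ => ?_
  have := hφ k
  fun_prop

theorem continuous_psi (u : Fin n → ℝ) (τ : ℂ) (m : ℕ) (g : MvPolynomial (Fin n) ℂ) :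
    Continuous (psi A u τ m g) := by
  unfold psi
  have h := continuous_pSum (A := A) u (φ := fun k => derivE (k + 1))
    (fun k => continuous_derivE (k + 1)) (m + 2) g
  have h1 : Continuous fun v : Fin n → ℝ =>
      pSum A u (fun k => derivE (k + 1)) (m + 2) g (Real.sqrt τ.im • v) :=
    h.comp (by fun_prop)
  fun_prop

theorem norm_cexp_Q (τ : ℂ) (v : Fin n → ℝ) :
    ‖Complex.exp (2 * Real.pi * Complex.I * τ * (Q A v : ℂ))‖ =
      Real.exp (-(2 * Real.pi * τ.im * Q A v)) := by
  rw [Complex.norm_exp]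
  congr 1
  simp

/-- The Gaussian in `E'` compensates the growth of `q^Q` in the negative direction: the exponents
add up to the positive definite majorant. -/
theorem exp_mul_exp_eq_stress {c : Fin n → ℝ} (hc : Q A c < 0) {y : ℝ} (hy : 0 < y)
    (v : Fin n → ℝ) :
    Real.exp (-Real.pi * B A (unitVec A c) (Real.sqrt y • v) ^ 2) *
      Real.exp (-(2 * Real.pi * y * Q A v)) =
      Real.exp (-(Real.pi * y * (stress A c c v / (-Q A c)))) := by
  rw [← Real.exp_add]
  congr 1
  have hq : 0 < -Q A c := by linarith
  rw [B_unitVec, height, B_smul_right, stress_self, div_pow, Real.sq_sqrt hq.le, mul_pow,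
    Real.sq_sqrt hy.le]
  have := hc.ne
  field_simp
  ring

/-- A polynomial times the Gaussian of the majorant, which is bounded below by a multiple of `‖v‖²`;
only a linear exponent is kept, half of it to absorb the polynomial. -/
theorem expDecay_psi (hA : A.IsSymm) (hsig : HasSignature A) {c : Fin n → ℝ} (hc : Q A c < 0)
    {τ : ℂ} (hτ : 0 < τ.im) (m : ℕ) (g : MvPolynomial (Fin n) ℂ) :
    ExpDecay (psi A (unitVec A c) τ m g) := by
  refine ⟨continuous_psi _ _ _ _, ?_⟩
  have hv : ∀ i, PolyBdd (fun v : Fin n → ℝ => 1 + ‖v‖)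
      (fun v => (((Real.sqrt τ.im • v) i : ℝ) : ℂ)) := fun i =>
    PolyBdd.of_le (C := Real.sqrt τ.im) (by positivity) fun v => by
      rw [Complex.norm_real]
      calc ‖(Real.sqrt τ.im • v) i‖ ≤ ‖Real.sqrt τ.im • v‖ := norm_le_pi_norm _ i
        _ = Real.sqrt τ.im * ‖v‖ := by rw [norm_smul, Real.norm_of_nonneg (Real.sqrt_nonneg _)]
        _ ≤ _ := by gcongr; linarith
  have hu : ∀ i, PolyBdd (fun v : Fin n → ℝ => 1 + ‖v‖) (fun _ => (unitVec A c i : ℂ)) :=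
    fun i => PolyBdd.const _
  have hW : ∀ v : Fin n → ℝ, 1 ≤ 1 + ‖v‖ := fun v => by linarith [norm_nonneg v]
  obtain ⟨C, M, hC, hb⟩ := exists_norm_pSum_le hW (A := A) (g := fun _ => g) (m + 2)
    (polyBdd_B hW hu hv) (fun k => polyBdd_dirDer_iterate hW hu hv k g)
  obtain ⟨ε, hε, hst⟩ := exists_stress_self_ge hA hsig hc
  have hq : 0 < -Q A c := by linarith
  set δ := Real.pi * τ.im * (ε / (-Q A c)) with hδ
  have hδ0 : 0 < δ := by positivity
  obtain ⟨K, hK, hp⟩ := exists_pow_le_exp M (half_pos hδ0)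
  set S := ‖(((Real.sqrt τ.im : ℝ) : ℂ)⁻¹) ^ m‖
  refine ⟨S * (C * K * Real.exp δ), δ / 2, by positivity, fun v => ?_⟩
  rw [psi, norm_mul, norm_mul, norm_cexp_Q, mul_assoc, mul_assoc S]
  refine mul_le_mul_of_nonneg_left ?_ (norm_nonneg _)
  calc _ ≤ C * (1 + ‖v‖) ^ M * Real.exp (-Real.pi * B A (unitVec A c) (Real.sqrt τ.im • v) ^ 2) *
        Real.exp (-(2 * Real.pi * τ.im * Q A v)) :=
        mul_le_mul_of_nonneg_right (hb v) (Real.exp_pos _).le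
    _ = C * (1 + ‖v‖) ^ M * Real.exp (-(Real.pi * τ.im * (stress A c c v / (-Q A c)))) := by
        rw [mul_assoc, exp_mul_exp_eq_stress hc hτ]
    _ ≤ C * (K * Real.exp (δ / 2 * ‖v‖)) * Real.exp (δ - δ * ‖v‖) := by
        gcongr
        · exact hp _ (norm_nonneg v)
        · have h1 : ε / (-Q A c) * ‖v‖ ^ 2 ≤ stress A c c v / (-Q A c) := by
            rw [div_mul_eq_mul_div]; gcongr; exact hst v
          have h2 : δ * ‖v‖ ^ 2 ≤ Real.pi * τ.im * (stress A c c v / (-Q A c)) := by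
            rw [hδ, mul_assoc]; gcongr
          nlinarith [mul_nonneg hδ0.le (sq_nonneg (‖v‖ - 1)), mul_nonneg hδ0.le (norm_nonneg v)]
    _ = C * K * Real.exp δ * Real.exp (-(δ / 2) * ‖v‖) := by
        have h3 : Real.exp (δ / 2 * ‖v‖) * Real.exp (δ - δ * ‖v‖) =
            Real.exp δ * Real.exp (-(δ / 2) * ‖v‖) := by
          rw [← Real.exp_add, ← Real.exp_add]; congr 1; ring
        linear_combination C * K * h3

theorem pSumDeriv_smul (u : Fin n → ℝ) (φ : ℕ → ℝ → ℝ) (N : ℕ) (g : MvPolynomial (Fin n) ℂ)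
    (r : ℝ) (w v : Fin n → ℝ) :
    pSumDeriv A u φ N g (r • w) v = (r : ℂ) * pSumDeriv A u φ N g w v := by
  rw [pSumDeriv, pSumDeriv, Finset.mul_sum]
  refine Finset.sum_congr rfl fun k _ => ?_
  rw [B_smul_right, dirDer_smul_left, evalReal_smul]
  push_cast
  ring

/-- The directional derivatives of `psi`, expressed by the creation operator. -/
theorem hasDerivAt_psi (hA : A.IsSymm) {u : Fin n → ℝ} {τ : ℂ} (hτ : 0 < τ.im) {m : ℕ}
    {g : MvPolynomial (Fin n) ℂ} (hg : DegLE m g) (w v : Fin n → ℝ) :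
    HasDerivAt (fun t : ℝ => psi A u τ m g (v + t • w))
      (2 * Real.pi * Complex.I * (starRingEnd ℂ) τ * ((B A w v : ℂ) * psi A u τ m g v) -
        4 * Real.pi * (τ.im : ℂ) * psi A u τ (m + 1) (create A w g) v) 0 := by
  set s := Real.sqrt τ.im with hs
  have hs0 : (s : ℂ) ≠ 0 := by exact_mod_cast (Real.sqrt_pos.mpr hτ).ne'
  have hs2 : (s : ℂ) ^ 2 = (τ.im : ℂ) := by exact_mod_cast Real.sq_sqrt hτ.le
  have hpi : (Real.pi : ℂ) ≠ 0 := by exact_mod_cast Real.pi_ne_zero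
  have hγ : HasDerivAt (fun t : ℝ => v + t • w) w 0 := by
    simpa using ((hasDerivAt_id (0 : ℝ)).smul_const w).const_add v
  have h1 := hasDerivAt_pSum (A := A) (φ := fun k => derivE (k + 1))
    (fun k x => hasDerivAt_derivE (k + 1) x) u (m + 2) g (hγ.const_smul s)
  have hQ : HasDerivAt (fun t : ℝ => (Q A (v + t • w) : ℂ)) (B A w v : ℂ) 0 := by
    have h2 : HasDerivAt (fun t : ℝ => Q A v + t ^ 2 * Q A w + t * B A v w) (B A w v) 0 := by
      have := (((hasDerivAt_pow 2 (0 : ℝ)).mul_const (Q A w)).const_add (Q A v)).add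
        ((hasDerivAt_id (0 : ℝ)).mul_const (B A v w))
      refine this.congr_deriv ?_
      rw [B_comm hA w v]; simp
    refine HasDerivAt.ofReal_comp ?_
    refine h2.congr_of_eventuallyEq (Filter.Eventually.of_forall fun t => ?_)
    simp only [Q_add hA, Q_smul, B_smul_right]
  have h3 := (hQ.const_mul (2 * Real.pi * Complex.I * τ)).cexp
  have h4 := (h1.const_mul (((s : ℂ)⁻¹) ^ m)).mul h3
  refine h4.congr_deriv ?_
  have him : (starRingEnd ℂ) τ = τ - 2 * Complex.I * (τ.im : ℂ) := by
    apply Complex.ext <;> simp; ring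
  simp only [zero_smul, add_zero, Pi.smul_apply]
  -- `pSum_create` needs one vanishing top term, which is why `psi` sums over `k < m + 2`. The sum
  -- for degree `m + 1` has one more term, zero again.
  have hcr := pSum_create hA (fun k => derivE (k + 1)) (hg u (m + 1) (Nat.lt_succ_self m)) w (s • v)
  have hlast : pSum A u (fun k => derivE (k + 1)) (m + 1 + 2) (create A w g) (s • v) =
      pSum A u (fun k => derivE (k + 1)) (m + 2) (create A w g) (s • v) :=
    pSum_succ ((hg.create w) u (m + 2) (by omega)) _
  rw [psi, psi, ← hs, hlast, hcr, pSumDeriv_smul, him, ← hs2, B_smul_right]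
  push_cast
  rw [pow_succ ((s : ℂ)⁻¹) m]
  generalize ((s : ℂ)⁻¹) ^ m = P
  field_simp
  ring_nf
  rw [Complex.I_sq]
  ring

end Psi

section Fourier

variable {A : Matrix (Fin n) (Fin n) ℤ}

/-- The kernel of the Fourier transform with respect to `B`. -/
def kern (A : Matrix (Fin n) (Fin n) ℤ) (x v : Fin n → ℝ) : ℂ :=
  Complex.exp (-2 * Real.pi * Complex.I * (B A v x : ℂ))

theorem norm_kern (x v : Fin n → ℝ) : ‖kern A x v‖ = 1 := by
  have : -2 * Real.pi * Complex.I * (B A v x : ℂ) =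
      ((-(2 * Real.pi * B A v x) : ℝ) : ℂ) * Complex.I := by push_cast; ring
  rw [kern, this, Complex.norm_exp_ofReal_mul_I]

theorem continuous_kern (x : Fin n → ℝ) : Continuous (kern A x) := by
  unfold kern; fun_prop

theorem ExpDecay.kern_mul {F : (Fin n → ℝ) → ℂ} (hF : ExpDecay F) (x : Fin n → ℝ) :
    ExpDecay fun v => kern A x v * F v :=
  hF.of_norm_le ((continuous_kern x).mul hF.1) fun v => by rw [norm_mul, norm_kern, one_mul]

/-- The Fourier transform turns directional derivatives into multiplication by linear forms. -/
theorem integral_kern_mul_deriv {F F' : (Fin n → ℝ) → ℂ} (hF : ExpDecay F) (hF' : ExpDecay F')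
    (w x : Fin n → ℝ) (hd : ∀ v, HasDerivAt (fun t : ℝ => F (v + t • w)) (F' v) 0) :
    ∫ v, kern A x v * F' v =
      2 * Real.pi * Complex.I * (B A w x : ℂ) * ∫ v, kern A x v * F v := by
  have hk : ∀ v, HasLineDerivAt ℝ (kern A x)
      ((-2 * Real.pi * Complex.I * (B A w x : ℂ)) * kern A x v) v w := by
    intro v
    have hγ : HasDerivAt (fun t : ℝ => v + t • w) w 0 := by
      simpa using ((hasDerivAt_id (0 : ℝ)).smul_const w).const_add v
    have h := (((hasDerivAt_B_left A x hγ).ofReal_comp).const_mul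
      (-2 * Real.pi * Complex.I)).cexp
    refine h.congr_deriv ?_
    simp only [kern, zero_smul, add_zero]
    ring
  have key := integral_bilinear_hasLineDerivAt_right_eq_neg_left_of_integrable (μ := volume)
    (f := kern A x) (g := F) (f' := fun v => (-2 * Real.pi * Complex.I * (B A w x : ℂ)) * kern A x v)
    (g' := F') (v := w) (B := ContinuousLinearMap.mul ℝ ℂ)
    (by
      refine ((hF.kern_mul (A := A) x).integrable.const_mul
        (-2 * Real.pi * Complex.I * (B A w x : ℂ))).congr (Filter.Eventually.of_forall fun v => ?_)
      simp only [ContinuousLinearMap.mul_apply']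
      ring)
    (hF'.kern_mul (A := A) x).integrable (hF.kern_mul (A := A) x).integrable
    (fun v _ => hk v) (fun v _ => hd v)
  simp only [ContinuousLinearMap.mul_apply', mul_assoc] at key
  rw [key]
  simp only [integral_const_mul]
  ring

/-- The Fourier transform turns multiplication by linear forms into directional derivatives. -/
theorem hasDerivAt_integral_kern {F : (Fin n → ℝ) → ℂ} (hA : A.IsSymm) (hF : ExpDecay F)
    (w x : Fin n → ℝ) :
    HasDerivAt (fun t : ℝ => ∫ v, kern A (x + t • w) v * F v)
      (-2 * Real.pi * Complex.I * ∫ v, kern A x v * ((B A w v : ℂ) * F v)) 0 := by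
  have hb := hF.B_mul A w
  have h := hasDerivAt_integral_of_dominated_loc_of_deriv_le (μ := (volume : Measure (Fin n → ℝ)))
    (F := fun (t : ℝ) v => kern A (x + t • w) v * F v)
    (F' := fun (t : ℝ) v => -2 * Real.pi * Complex.I *
      (kern A (x + t • w) v * ((B A w v : ℂ) * F v)))
    (bound := fun v => 2 * Real.pi * ‖(B A w v : ℂ) * F v‖) (x₀ := 0) (s := Set.univ)
    Filter.univ_mem
    (Filter.Eventually.of_forall fun t => (hF.kern_mul _).1.aestronglyMeasurable)
    (hF.kern_mul _).integrable
    ((hb.kern_mul _).const_mul _).1.aestronglyMeasurable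
    (Filter.Eventually.of_forall fun v t _ => by
      rw [norm_mul, norm_mul (kern A _ v), norm_kern, one_mul]
      simp [abs_of_pos Real.pi_pos])
    (hb.integrable.norm.const_mul _)
    (Filter.Eventually.of_forall fun v t _ => by
      have hγ : HasDerivAt (fun t : ℝ => x + t • w) w t := by
        simpa using ((hasDerivAt_id t).smul_const w).const_add x
      have h1 := ((((hasDerivAt_B_right A v hγ).ofReal_comp).const_mul
        (-2 * Real.pi * Complex.I)).cexp).mul_const (F v)
      refine h1.congr_deriv ?_
      rw [B_comm hA v w, kern]
      ring)
  refine h.2.congr_deriv ?_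
  simp only [zero_smul, add_zero]
  rw [integral_const_mul]

/-- The Fourier transforms of the functions `psi`. -/
theorem fourier_psi (hA : A.IsSymm) (hsig : HasSignature A) {c : Fin n → ℝ} (hc : Q A c < 0)
    {τ : ℂ} (hτ : 0 < τ.im) {d : ℕ} {f : MvPolynomial (Fin n) ℂ} (hf : f.IsHomogeneous d)
    (w₀ x : Fin n → ℝ) :
    ∫ v, kern A x v * psi A (unitVec A c) (-1 / τ) (d + 1) (create A w₀ (hat A f)) v =
      gaussFactor A τ * (-τ) ^ (d + 1) *
        psi A (unitVec A c) τ (d + 1) (create A w₀ (hat A f)) x := by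
  have hdet := isUnit_det_realMat hA hsig hc
  have hτ0 : τ ≠ 0 := by rintro rfl; simp at hτ
  have hcτ0 : (starRingEnd ℂ) τ ≠ 0 := by simpa using hτ0
  set σ : ℂ := -1 / τ with hσ
  have hnsq : 0 < Complex.normSq τ := Complex.normSq_pos.mpr hτ0
  have hσim' : σ.im = τ.im / Complex.normSq τ := by
    rw [hσ, neg_div, one_div, Complex.neg_im, Complex.inv_im]
    ring
  have hσim : 0 < σ.im := by rw [hσim']; positivity
  set u := unitVec A c with hu
  have hdec : ∀ (ρ : ℂ), 0 < ρ.im → ∀ m g, ExpDecay (psi A u ρ m g) := fun ρ hρ m g =>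
    expDecay_psi hA hsig hc hρ m g
  -- The degree bound travels along with the transformation law because the derivative formula for
  -- `psi` requires it at every stage.
  set T : ℕ → MvPolynomial (Fin n) ℂ → Prop := fun m g => DegLE m g ∧
    ∀ x, ∫ v, kern A x v * psi A u σ m g v = gaussFactor A τ * (-τ) ^ m * psi A u τ m g x with hT
  have hstep : ∀ m g w, T m g → T (m + 1) (create A w g) := by
    rintro m g w ⟨hdeg, hg⟩
    refine ⟨hdeg.create w, fun x => ?_⟩
    have hpi : (Real.pi : ℂ) ≠ 0 := by exact_mod_cast Real.pi_ne_zero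
    have hy : (τ.im : ℂ) ≠ 0 := by exact_mod_cast hτ.ne'
    have hF := hdec σ hσim m g
    have hF1 := hdec σ hσim (m + 1) (create A w g)
    have hFB := hF.B_mul A w
    have hcont : Continuous (fun v => 2 * Real.pi * Complex.I * (starRingEnd ℂ) σ *
        ((B A w v : ℂ) * psi A u σ m g v) -
        4 * Real.pi * (σ.im : ℂ) * psi A u σ (m + 1) (create A w g) v) :=
      (hFB.const_mul _).1.sub (hF1.const_mul _).1
    have hF' : ExpDecay (fun v => 2 * Real.pi * Complex.I * (starRingEnd ℂ) σ *
        ((B A w v : ℂ) * psi A u σ m g v) -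
        4 * Real.pi * (σ.im : ℂ) * psi A u σ (m + 1) (create A w g) v) := by
      obtain ⟨_, C₁, ε₁, hε₁, h₁⟩ := hFB.const_mul
        (2 * Real.pi * Complex.I * (starRingEnd ℂ) σ)
      obtain ⟨_, C₂, ε₂, hε₂, h₂⟩ := hF1.const_mul (4 * Real.pi * (σ.im : ℂ))
      have hC₁ : 0 ≤ C₁ := by simpa using (norm_nonneg _).trans (h₁ 0)
      have hC₂ : 0 ≤ C₂ := by simpa using (norm_nonneg _).trans (h₂ 0)
      refine ⟨hcont, C₁ + C₂, min ε₁ ε₂, lt_min hε₁ hε₂, fun v => ?_⟩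
      refine (norm_sub_le _ _).trans ((add_le_add (h₁ v) (h₂ v)).trans ?_)
      rw [add_mul]
      gcongr
      · exact min_le_left _ _
      · exact min_le_right _ _
    have h1 := integral_kern_mul_deriv (A := A) hF hF' w x
      (fun v => hasDerivAt_psi hA hσim hdeg w v)
    have h2 := hasDerivAt_integral_kern hA hF w x
    have h3 := ((hasDerivAt_psi (u := u) hA hτ hdeg w x).const_mul
      (gaussFactor A τ * (-τ) ^ m))
    have h4 := h2.unique (h3.congr_of_eventuallyEq
      (Filter.Eventually.of_forall fun t => hg (x + t • w)))
    have h5 : ∫ v, kern A x v * (2 * Real.pi * Complex.I * (starRingEnd ℂ) σ *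
        ((B A w v : ℂ) * psi A u σ m g v) -
        4 * Real.pi * (σ.im : ℂ) * psi A u σ (m + 1) (create A w g) v) =
        2 * Real.pi * Complex.I * (starRingEnd ℂ) σ *
          (∫ v, kern A x v * ((B A w v : ℂ) * psi A u σ m g v)) -
        4 * Real.pi * (σ.im : ℂ) * ∫ v, kern A x v * psi A u σ (m + 1) (create A w g) v := by
      rw [← integral_const_mul, ← integral_const_mul, ← integral_sub
        ((hFB.kern_mul (A := A) x).const_mul _).integrable
        ((hF1.kern_mul (A := A) x).const_mul _).integrable]
      congr 1
      funext v
      ring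
    rw [h5, hg x] at h1
    set J := ∫ v, kern A x v * psi A u σ (m + 1) (create A w g) v
    set L := ∫ v, kern A x v * ((B A w v : ℂ) * psi A u σ m g v)
    set K := gaussFactor A τ * (-τ) ^ m with hK
    have hnorm : ((Complex.normSq τ : ℝ) : ℂ) = τ * (starRingEnd ℂ) τ :=
      (Complex.mul_conj τ).symm
    have hσc : (starRingEnd ℂ) σ = -1 / (starRingEnd ℂ) τ := by
      rw [hσ, map_div₀, map_neg, map_one]
    rw [hσim', hσc, Complex.ofReal_div, hnorm] at h1
    rw [pow_succ, ← mul_assoc, ← hK]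
    -- Two relations come from the derivative formula: its transform at `σ`, and the derivative of
    -- the known transform at `τ`. Eliminating `L` between them, the terms with `B(w,x)` cancel
    -- because `conj σ = -1/conj τ`, and `Im σ = y/(τ conj τ)` leaves the new factor `-τ`.
    have h6 : 4 * Real.pi * ((τ.im : ℂ) / (τ * (starRingEnd ℂ) τ)) * J =
        4 * Real.pi * ((τ.im : ℂ) / (τ * (starRingEnd ℂ) τ)) *
          (K * -τ * psi A u τ (m + 1) (create A w g) x) := by
      have e1 : 4 * Real.pi * ((τ.im : ℂ) / (τ * (starRingEnd ℂ) τ)) * J =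
          (-2 * Real.pi * Complex.I * L) / (starRingEnd ℂ) τ -
            2 * Real.pi * Complex.I * (B A w x : ℂ) * (K * psi A u τ m g x) := by
        rw [← h1]
        field_simp
        ring
      rw [e1, h4]
      field_simp
      ring
    exact mul_left_cancel₀ (by
      refine mul_ne_zero (mul_ne_zero (by norm_num) hpi) (div_ne_zero hy (mul_ne_zero hτ0 hcτ0))) h6
  have hone : T 0 1 := by
    refine ⟨fun w k hk => ?_, fun x => ?_⟩
    · obtain ⟨k, rfl⟩ := Nat.exists_eq_succ_of_ne_zero hk.ne'
      rw [Function.iterate_succ_apply, Derivation.map_one_eq_zero, dirDer_iterate_zero]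
    -- The factor 2 is the one in `E'(z) = 2e^{-πz²}`.
    · have hpsi : ∀ ρ : ℂ, 0 < ρ.im → ∀ v, psi A u ρ 0 1 v = 2 * gaussian A c ρ v := by
        intro ρ hρ v
        have h1 : (dirDer u)^[1] (1 : MvPolynomial (Fin n) ℂ) = 0 := by simp
        have hs2 : ((Real.sqrt ρ.im : ℝ) : ℂ) ^ 2 = (ρ.im : ℂ) := by
          exact_mod_cast Real.sq_sqrt hρ.le
        rw [psi, zero_add, pSum_succ h1, pSum, Finset.sum_range_one, B_smul_right, hu, B_unitVec,
          gaussian, Complex.exp_sub]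
        simp only [expCoeff, derivE, hermiteFactor, Polynomial.eval_C, Function.iterate_zero, id,
          evalReal_one, pow_zero, Nat.factorial_zero, Nat.cast_one, mul_one, div_one, one_mul]
        push_cast
        rw [mul_pow, hs2, div_eq_mul_inv, ← Complex.exp_neg]
        rw [show -(Real.pi : ℂ) * ((ρ.im : ℂ) * (height A c v : ℂ) ^ 2) =
          -(Real.pi * (ρ.im : ℂ) * (height A c v : ℂ) ^ 2) by ring]
        ring
      simp only [hpsi σ hσim, hpsi τ hτ]
      have := fourier_gaussian hA hsig hc hτ x
      simp only [kern, mul_left_comm _ (2 : ℂ)]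
      rw [integral_const_mul, this]
      ring
  have hhat : T d (hat A f) := by
    refine hat_induction hA hdet (T := T) (fun d => ⟨fun w k _ => dirDer_iterate_zero w k, ?_⟩)
      (fun d f g hf hg => ⟨fun w k hk => ?_, fun x => ?_⟩)
      (fun d a f hf => ⟨fun w k hk => ?_, fun x => ?_⟩) hone hstep hf
    · intro x
      have hz : ∀ ρ v, psi A u ρ d 0 v = 0 := fun ρ v => by
        have := psi_smul (A := A) u ρ d 0 0 v
        simpa using this
      simp [hz]
    · rw [iterate_map_add, hf.1 w k hk, hg.1 w k hk, add_zero]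
    · simp only [psi_add, mul_add]
      rw [integral_add ((hdec σ hσim d f).kern_mul x).integrable
        ((hdec σ hσim d g).kern_mul x).integrable, hf.2, hg.2]
    · rw [dirDer_iterate_smul, hf.1 w k hk, smul_zero]
    · simp only [psi_smul, mul_left_comm _ a]
      rw [integral_const_mul, hf.2]
  exact (hstep d _ w₀ hhat).2 x

end Fourier

end

end IndefTheta

/-! ### The dual lattice and the inversion formula for a single fiber. -/

namespace IndefTheta

noncomputable section

open Matrix MeasureTheory

variable {n : ℕ} {A : Matrix (Fin n) (Fin n) ℤ}

section Lattices

theorem mulVec_mem_intLattice (A : Matrix (Fin n) (Fin n) ℤ) {l : Fin n → ℝ}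
    (hl : l ∈ intLattice n) : realMat A *ᵥ l ∈ intLattice n := by
  obtain ⟨k, rfl⟩ := hl
  refine ⟨A *ᵥ k, ?_⟩
  ext i
  simp [mulVec, dotProduct, realMat]

theorem mem_dualLattice_iff (hdet : IsUnit (realMat A).det) {x : Fin n → ℝ} :
    x ∈ dualLattice A ↔ realMat A *ᵥ x ∈ intLattice n := by
  constructor
  · rintro ⟨l, hl, rfl⟩
    have : realMat A *ᵥ ((realMat A)⁻¹ *ᵥ l) = l := by
      rw [mulVec_mulVec, Matrix.mul_nonsing_inv _ hdet, one_mulVec]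
    change realMat A *ᵥ ((realMat A)⁻¹ *ᵥ l) ∈ _
    rwa [this]
  · intro h
    refine ⟨_, h, ?_⟩
    change (realMat A)⁻¹ *ᵥ (realMat A *ᵥ x) = x
    rw [mulVec_mulVec, Matrix.nonsing_inv_mul _ hdet, one_mulVec]

theorem intLattice_le_dualLattice (hdet : IsUnit (realMat A).det) :
    intLattice n ≤ dualLattice A := fun _ hl =>
  (mem_dualLattice_iff hdet).mpr (mulVec_mem_intLattice A hl)

/-- The dual lattice is a copy of `ℤⁿ`. -/
def dualEquiv (hdet : IsUnit (realMat A).det) : (Fin n → ℤ) ≃+ dualLattice A :=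
  (latticeEquiv n).trans ((intLattice n).equivMapOfInjective _ (by
    intro x y hxy
    have h : (realMat A)⁻¹ *ᵥ x = (realMat A)⁻¹ *ᵥ y := hxy
    have h2 := congrArg (fun v => realMat A *ᵥ v) h
    simpa only [mulVec_mulVec, Matrix.mul_nonsing_inv _ hdet, one_mulVec] using h2))

theorem dualEquiv_apply (hdet : IsUnit (realMat A).det) (k : Fin n → ℤ) :
    (dualEquiv hdet k : Fin n → ℝ) = (realMat A)⁻¹ *ᵥ (latticeEquiv n k : Fin n → ℝ) := rfl

/-- `det(A) x = adj(A)(Ax)`, with `adj(A)` and `Ax` integral. Hence the discriminant group is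
torsion, and being finitely generated it is finite. -/
theorem det_smul_mem_intLattice (hdet : IsUnit (realMat A).det) {x : Fin n → ℝ}
    (hx : x ∈ dualLattice A) : A.det • x ∈ intLattice n := by
  obtain ⟨k, hk⟩ := (mem_dualLattice_iff hdet).mp hx
  refine ⟨A.adjugate *ᵥ k, ?_⟩
  have h1 : ((Int.castAddHom ℝ).compLeft (Fin n)) (A.adjugate *ᵥ k) =
      (realMat A).adjugate *ᵥ (realMat A *ᵥ x) := by
    rw [← hk]
    have h2 : (realMat A).adjugate = (A.adjugate).map (fun z : ℤ => (z : ℝ)) :=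
      ((Int.castRingHom ℝ).map_adjugate A).symm
    rw [h2]
    ext i
    simp [mulVec, dotProduct]
  rw [h1, mulVec_mulVec, Matrix.adjugate_mul, det_realMat, smul_mulVec, one_mulVec]
  simp [← Int.cast_smul_eq_zsmul ℝ]

theorem finite_discGroup (hdet : IsUnit (realMat A).det) : Finite (DiscGroup A) := by
  have hA0 : A.det ≠ 0 := by
    intro h
    rw [det_realMat, h] at hdet
    simp at hdet
  have : AddGroup.FG (dualLattice A) :=
    AddGroup.fg_of_surjective (f := (dualEquiv hdet).toAddMonoidHom) (dualEquiv hdet).surjective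
  have : AddGroup.FG (DiscGroup A) :=
    AddGroup.fg_of_surjective (f := QuotientAddGroup.mk' _) (QuotientAddGroup.mk'_surjective _)
  refine AddCommGroup.finite_of_fg_isAddTorsion _ ?_
  intro q
  obtain ⟨x, rfl⟩ := QuotientAddGroup.mk_surjective q
  rw [isOfFinAddOrder_iff_zsmul_eq_zero]
  refine ⟨A.det, hA0, ?_⟩
  rw [← QuotientAddGroup.mk_zsmul, QuotientAddGroup.eq_zero_iff, AddSubgroup.mem_addSubgroupOf]
  exact det_smul_mem_intLattice hdet x.2

/-- Decomposition of the dual lattice into cosets of `ℤⁿ`. -/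
def cosetEquiv (hdet : IsUnit (realMat A).det) : DiscGroup A × intLattice n ≃ dualLattice A :=
  Equiv.ofBijective
    (fun q => Quotient.out q.1 + ⟨q.2, intLattice_le_dualLattice hdet q.2.2⟩) (by
      have hmk : ∀ q : DiscGroup A × intLattice n, (QuotientAddGroup.mk (Quotient.out q.1 +
          ⟨q.2, intLattice_le_dualLattice hdet q.2.2⟩ : dualLattice A) : DiscGroup A) = q.1 := by
        intro q
        rw [QuotientAddGroup.mk_add_of_mem _ (by
          rw [AddSubgroup.mem_addSubgroupOf]; exact q.2.2)]
        exact Quotient.out_eq q.1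
      constructor
      · rintro q r h
        have h1 : q.1 = r.1 := by rw [← hmk q, ← hmk r]; exact congrArg _ h
        have h2 : q.2 = r.2 := by
          simp only [h1] at h
          have := congrArg Subtype.val (add_left_cancel h)
          exact Subtype.ext this
        exact Prod.ext h1 h2
      · intro x
        have h1 : -(Quotient.out (QuotientAddGroup.mk x : DiscGroup A)) + x ∈
            (intLattice n).addSubgroupOf (dualLattice A) :=
          QuotientAddGroup.eq.mp (Quotient.out_eq (QuotientAddGroup.mk x : DiscGroup A))
        refine ⟨(QuotientAddGroup.mk x, ⟨_, AddSubgroup.mem_addSubgroupOf.mp h1⟩), ?_⟩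
        apply Subtype.ext
        simp)

theorem tsum_dualLattice (hdet : IsUnit (realMat A).det) {F : (Fin n → ℝ) → ℂ}
    (hF : Summable fun x : dualLattice A => F x) :
    ∑' x : dualLattice A, F x =
      ∑ᶠ q : DiscGroup A, ∑' l : intLattice n,
        F ((Quotient.out q : dualLattice A) + (l : Fin n → ℝ)) := by
  have := finite_discGroup hdet
  have := Fintype.ofFinite (DiscGroup A)
  have h := (cosetEquiv hdet).summable_iff.mpr hF
  rw [← (cosetEquiv hdet).tsum_eq, finsum_eq_sum_of_fintype]
  exact h.tsum_prod.trans (tsum_fintype _)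

/-- Applying `A` carries the dual lattice to `ℤⁿ` and enlarges norms by at most the factor `D`. -/
theorem summable_exp_neg_norm_dual (hdet : IsUnit (realMat A).det) {ε : ℝ} (hε : 0 < ε)
    (b : Fin n → ℝ) :
    Summable fun x : dualLattice A => Real.exp (-ε * ‖b + (x : Fin n → ℝ)‖) := by
  rw [← (dualEquiv hdet).toEquiv.summable_iff]
  set L := LinearMap.toContinuousLinearMap (Matrix.mulVecLin (realMat A))
  set D := ‖L‖ + 1
  have hD : 0 < D := by positivity
  have hL : ∀ v, ‖realMat A *ᵥ v‖ ≤ D * ‖v‖ := fun v =>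
    (L.le_opNorm v).trans (by gcongr; simp [D])
  have h := summable_exp_neg_norm_add (ε := ε / D) (by positivity) (realMat A *ᵥ b)
  rw [← (latticeEquiv n).toEquiv.summable_iff] at h
  refine Summable.of_nonneg_of_le (fun _ => (Real.exp_pos _).le) (fun k => ?_) h
  refine Real.exp_le_exp.mpr ?_
  change -ε * ‖b + (dualEquiv hdet k : Fin n → ℝ)‖ ≤
    -(ε / D) * ‖realMat A *ᵥ b + (latticeEquiv n k : Fin n → ℝ)‖
  have h1 := hL (b + (dualEquiv hdet k : Fin n → ℝ))
  rw [mulVec_add, dualEquiv_apply, mulVec_mulVec, Matrix.mul_nonsing_inv _ hdet, one_mulVec] at h1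
  rw [dualEquiv_apply]
  have h2 := mul_le_mul_of_nonneg_left h1 (div_pos hε hD).le
  have h3 : ε / D * (D * ‖b + (realMat A)⁻¹ *ᵥ (latticeEquiv n k : Fin n → ℝ)‖) =
      ε * ‖b + (realMat A)⁻¹ *ᵥ (latticeEquiv n k : Fin n → ℝ)‖ := by
    field_simp
  linarith

theorem ExpDecay.summable_dual (hdet : IsUnit (realMat A).det) {F : (Fin n → ℝ) → ℂ}
    (hF : ExpDecay F) (b : Fin n → ℝ) : Summable fun x : dualLattice A => F (b + x) := by
  obtain ⟨_, C, ε, hε, h⟩ := hF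
  exact Summable.of_norm_bounded ((summable_exp_neg_norm_dual hdet hε b).mul_left C) fun x => h _

end Lattices

section Transformation

/-- The phase `exp(2πi B(l,b))`. -/
def phase (A : Matrix (Fin n) (Fin n) ℤ) (b l : Fin n → ℝ) : ℂ :=
  Complex.exp (2 * Real.pi * Complex.I * (B A l b : ℂ))

theorem norm_phase (b l : Fin n → ℝ) : ‖phase A b l‖ = 1 := by
  have : 2 * Real.pi * Complex.I * (B A l b : ℂ) =
      ((2 * Real.pi * B A l b : ℝ) : ℂ) * Complex.I := by push_cast; ring
  rw [phase, this, Complex.norm_exp_ofReal_mul_I]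

theorem continuous_phase (b : Fin n → ℝ) : Continuous (phase A b) := by
  unfold phase; fun_prop

theorem ExpDecay.mul_phase {F : (Fin n → ℝ) → ℂ} (hF : ExpDecay F) (b : Fin n → ℝ) :
    ExpDecay fun v => F v * phase A b v :=
  hF.of_norm_le (hF.1.mul (continuous_phase b)) fun v => by rw [norm_mul, norm_phase, mul_one]

/-- Poisson summation: the frequency `k` pairs as `B(v,x)` with `x = A⁻¹k`, so the dual sum runs
over the dual lattice, shifted by the phase to `x - b`. The substitution `x ↦ -x` and the parity of
`psi` give arguments `b + x` and change `(-τ)^{d+1}` into `τ^{d+1}`. -/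
theorem tsum_psi_neg_inv (hA : A.IsSymm) (hsig : HasSignature A) {c : Fin n → ℝ} (hc : Q A c < 0)
    {τ : ℂ} (hτ : 0 < τ.im) {d : ℕ} {f : MvPolynomial (Fin n) ℂ} (hf : f.IsHomogeneous d)
    (w₀ a b : Fin n → ℝ) :
    ∑' l : intLattice n, psi A (unitVec A c) (-1 / τ) (d + 1) (create A w₀ (hat A f)) (a + l) *
        phase A b (a + l) =
      gaussFactor A τ * τ ^ (d + 1) * phase A b a *
        ∑ᶠ q : DiscGroup A, ∑' l : intLattice n,
          psi A (unitVec A c) τ (d + 1) (create A w₀ (hat A f))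
            (b + (Quotient.out q : dualLattice A) + l) *
          phase A (-a) (b + (Quotient.out q : dualLattice A) + l) := by
  have hdet := isUnit_det_realMat hA hsig hc
  have hτ0 : τ ≠ 0 := by rintro rfl; simp at hτ
  set σ : ℂ := -1 / τ with hσ
  have hσim : 0 < σ.im := by
    rw [hσ, neg_div, one_div, Complex.neg_im, Complex.inv_im]
    have : 0 < Complex.normSq τ := Complex.normSq_pos.mpr hτ0
    rw [neg_div, neg_neg]; positivity
  set G := create A w₀ (hat A f) with hG
  have hpar : HasParity (d + 1) G := (hasParity_hat hA hdet hf).create hA w₀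
  have hdecσ : ExpDecay (psi A (unitVec A c) σ (d + 1) G) := expDecay_psi hA hsig hc hσim _ _
  have hdec : ExpDecay (psi A (unitVec A c) τ (d + 1) G) := expDecay_psi hA hsig hc hτ _ _
  set F : (Fin n → ℝ) → ℂ := fun v => psi A (unitVec A c) σ (d + 1) G v * phase A b v with hF
  have hFdec : ExpDecay F := hdecσ.mul_phase b
  have hkv : ∀ (k : Fin n → ℤ) (v : Fin n → ℝ),
      ∑ i, (k i : ℝ) * v i = B A v (dualEquiv hdet k : Fin n → ℝ) := by
    intro k v
    rw [B, dualEquiv_apply, mulVec_mulVec, Matrix.mul_nonsing_inv _ hdet, one_mulVec, dotProduct]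
    exact Finset.sum_congr rfl fun i _ => by rw [latticeEquiv_apply, mul_comm]
  have hint : ∀ k : Fin n → ℤ,
      ∫ v, Complex.exp (-(2 * Real.pi * Complex.I * ((∑ i, k i * v i : ℝ) : ℂ))) * F v =
        gaussFactor A τ * (-τ) ^ (d + 1) *
          psi A (unitVec A c) τ (d + 1) G ((dualEquiv hdet k : Fin n → ℝ) - b) := by
    intro k
    rw [hG, ← fourier_psi hA hsig hc hτ hf]
    congr 1
    funext v
    simp only [hF]
    rw [hkv, kern, B_sub_right, phase]
    rw [mul_left_comm, ← Complex.exp_add, mul_comm]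
    congr 2
    push_cast
    ring
  have hsum : Summable fun k : Fin n → ℤ =>
      psi A (unitVec A c) τ (d + 1) G ((dualEquiv hdet k : Fin n → ℝ) - b) := by
    have := hdec.summable_dual hdet (-b)
    rw [← (dualEquiv hdet).toEquiv.summable_iff] at this
    refine this.congr fun k => ?_
    change psi A (unitVec A c) τ (d + 1) G (-b + (dualEquiv hdet k : Fin n → ℝ)) = _
    rw [sub_eq_add_neg, add_comm (-b)]
  obtain ⟨_, C, ε, hε, hbd⟩ := id hFdec
  have hP := poisson_summation F hFdec.1 hε hbd (by
    simp_rw [hint]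
    exact hsum.mul_left _) a
  rw [hP]
  simp_rw [hint, hkv]
  have hdual := tsum_dualLattice hdet
    (F := fun x => psi A (unitVec A c) τ (d + 1) G (b + x) * phase A (-a) (b + x))
    ((hdec.mul_phase (A := A) (-a)).summable_dual hdet b)
  simp only [← add_assoc] at hdual
  rw [← hdual, ← tsum_mul_left, ← (dualEquiv hdet).toEquiv.tsum_eq, ← (Equiv.neg _).tsum_eq]
  refine tsum_congr fun k => ?_
  have h1 : ((dualEquiv hdet (-k) : Fin n → ℝ)) = -(dualEquiv hdet k : Fin n → ℝ) := by
    rw [map_neg]; rfl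
  simp only [Equiv.neg_apply, h1]
  change _ = gaussFactor A τ * τ ^ (d + 1) * phase A b a *
    (psi A (unitVec A c) τ (d + 1) G (b + (dualEquiv hdet k : Fin n → ℝ)) *
      phase A (-a) (b + (dualEquiv hdet k : Fin n → ℝ)))
  set x := (dualEquiv hdet k : Fin n → ℝ)
  rw [show -x - b = -(b + x) by abel, psi_neg hpar]
  have h2 : phase A b a * phase A (-a) (b + x) =
      Complex.exp (2 * Real.pi * Complex.I * ((B A a (-x) : ℝ) : ℂ)) := by
    rw [phase, phase, ← Complex.exp_add]
    congr 1
    rw [B_neg_right, B_neg_right, B_add_left, B_comm hA b a, B_comm hA x a]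
    push_cast
    ring
  rw [← h2, neg_pow τ]
  have h3 : ((-1 : ℂ) ^ (d + 1)) * (-1) ^ (d + 1) = 1 := by rw [← mul_pow]; simp
  linear_combination (gaussFactor A τ * τ ^ (d + 1) * psi A (unitVec A c) τ (d + 1) G (b + x) *
    phase A b a * phase A (-a) (b + x)) * h3

end Transformation

end

end IndefTheta

/-! ### Derivative of `p^c[f]` along a segment, and its limit at a cusp. -/

namespace IndefTheta

noncomputable section

open Matrix MeasureTheory Filter Topology

variable {n : ℕ} {A : Matrix (Fin n) (Fin n) ℤ}

section Path

/-- The segment from `c` to `e`. -/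
def segPath (c e : Fin n → ℝ) (t : ℝ) : Fin n → ℝ := (1 - t) • c + t • e

/-- `(-Q)^{-1/2}` along the segment from `c` to `e`. -/
def segScale (A : Matrix (Fin n) (Fin n) ℤ) (c e : Fin n → ℝ) (t : ℝ) : ℝ :=
  1 / Real.sqrt (-Q A (segPath c e t))

/-- The velocity of the normalized segment. -/
def segVel (A : Matrix (Fin n) (Fin n) ℤ) (c e : Fin n → ℝ) (t : ℝ) : Fin n → ℝ :=
  segScale A c e t • (e - c) +
    (segScale A c e t ^ 3 * B A (segPath c e t) (e - c) / 2) • segPath c e t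

theorem segPath_zero (c e : Fin n → ℝ) : segPath c e 0 = c := by simp [segPath]

theorem segPath_one (c e : Fin n → ℝ) : segPath c e 1 = e := by simp [segPath]

theorem Q_segPath (hA : A.IsSymm) (c e : Fin n → ℝ) (t : ℝ) :
    Q A (segPath c e t) = (1 - t) ^ 2 * Q A c + t * (1 - t) * B A c e + t ^ 2 * Q A e := by
  rw [segPath, Q_add hA, Q_smul, Q_smul, B_smul_left, B_smul_right]; ring

theorem hasDerivAt_segPath (c e : Fin n → ℝ) (t : ℝ) :
    HasDerivAt (segPath c e) (e - c) t := by
  have h1 : HasDerivAt (fun s : ℝ => (1 - s) • c) ((-1 : ℝ) • c) t :=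
    ((hasDerivAt_id t).const_sub 1).smul_const c
  have h2 : HasDerivAt (fun s : ℝ => s • e) ((1 : ℝ) • e) t := (hasDerivAt_id t).smul_const e
  exact (h1.add h2).congr_deriv (by simp; abel)

theorem segScale_sq {c e : Fin n → ℝ} {t : ℝ} (ht : Q A (segPath c e t) < 0) :
    segScale A c e t ^ 2 * (-Q A (segPath c e t)) = 1 := by
  have : 0 < -Q A (segPath c e t) := by linarith
  rw [segScale, div_pow, Real.sq_sqrt this.le, one_pow, one_div, inv_mul_cancel₀ this.ne']

theorem segScale_nonneg (c e : Fin n → ℝ) (t : ℝ) : 0 ≤ segScale A c e t := by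
  unfold segScale; positivity

/-- The normalized path stays on `Q = -1`, so its velocity is orthogonal to it; this is the
orthogonality hypothesis of `hasDerivAt_pSum_left`. -/
theorem B_unitVec_segVel {c e : Fin n → ℝ} {t : ℝ} (ht : Q A (segPath c e t) < 0) :
    B A (unitVec A (segPath c e t)) (segVel A c e t) = 0 := by
  have h := segScale_sq ht
  have hu : unitVec A (segPath c e t) = segScale A c e t • segPath c e t := rfl
  rw [hu, segVel, B_smul_left, B_add_right, B_smul_right, B_smul_right, B_self]
  linear_combination (-segScale A c e t ^ 2 * B A (segPath c e t) (e - c)) * h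

theorem hasDerivAt_unitVec_segPath (hA : A.IsSymm) {c e : Fin n → ℝ} {t : ℝ}
    (ht : Q A (segPath c e t) < 0) :
    HasDerivAt (fun s => unitVec A (segPath c e s)) (segVel A c e t) t := by
  have hp := hasDerivAt_segPath c e t
  have hq : 0 < -Q A (segPath c e t) := by linarith
  have hQ : HasDerivAt (fun s => -Q A (segPath c e s)) (-B A (segPath c e t) (e - c)) t := by
    have h1 : HasDerivAt (fun s => (1 - s) ^ 2 * Q A c + s * (1 - s) * B A c e + s ^ 2 * Q A e)
        (-(2 * (1 - t)) * Q A c + (1 - 2 * t) * B A c e + 2 * t * Q A e) t := by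
      have e1 : HasDerivAt (fun s : ℝ => 1 - s) (-1) t := (hasDerivAt_id t).const_sub 1
      have e2 := ((e1.pow 2).mul_const (Q A c)).add
        ((((hasDerivAt_id t).mul e1).mul_const (B A c e)).add
          (((hasDerivAt_id t).pow 2).mul_const (Q A e)))
      refine (e2.congr_deriv ?_).congr_of_eventuallyEq (Eventually.of_forall fun s => ?_)
      · simp; ring
      · simp; ring
    have h2 : (fun s => -Q A (segPath c e s)) = fun s =>
        -((1 - s) ^ 2 * Q A c + s * (1 - s) * B A c e + s ^ 2 * Q A e) := by
      funext s; rw [Q_segPath hA]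
    rw [h2]
    refine h1.neg.congr_deriv ?_
    rw [segPath, B_sub_right, B_add_left, B_add_left, B_smul_left, B_smul_left, B_smul_left,
      B_smul_left, B_self, B_self, B_comm hA e c]
    ring
  have hr : HasDerivAt (fun s => segScale A c e s)
      (segScale A c e t ^ 3 * B A (segPath c e t) (e - c) / 2) t := by
    have h1 := (hQ.sqrt hq.ne').inv (Real.sqrt_pos.mpr hq).ne'
    have h2 : (fun s => segScale A c e s) = (fun s => Real.sqrt (-Q A (segPath c e s)))⁻¹ := by
      funext s; simp [segScale]
    rw [h2]
    refine h1.congr_deriv ?_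
    have h3 := Real.sq_sqrt hq.le
    have h4 := (Real.sqrt_pos.mpr hq).ne'
    rw [segScale]
    field_simp
  exact (hr.smul hp).congr_deriv (by rw [segVel])

/-- The derivative of `p^c[f](v)` along the segment. -/
def segDeriv (A : Matrix (Fin n) (Fin n) ℤ) (d : ℕ) (c e : Fin n → ℝ)
    (f : MvPolynomial (Fin n) ℂ) (v : Fin n → ℝ) (t : ℝ) : ℂ :=
  pSum A (unitVec A (segPath c e t)) (fun k => derivE (k + 1)) (d + 3)
    (create A (segVel A c e t) (hat A f)) v

theorem hasDerivAt_p_segPath (hA : A.IsSymm) (hdet : IsUnit (realMat A).det)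
    {f : MvPolynomial (Fin n) ℂ} {d : ℕ} (hf : f.IsHomogeneous d) {c e : Fin n → ℝ} {t : ℝ}
    (ht : Q A (segPath c e t) < 0) (v : Fin n → ℝ) :
    HasDerivAt (fun s => p A d (segPath c e s) f v) (segDeriv A d c e f v t) t := by
  have hdeg := degLE_hat hA hdet hf
  have h := hasDerivAt_pSum_left hA hasDerivAt_derivE (hasDerivAt_unitVec_segPath hA ht)
    (B_unitVec_segVel ht) (hdeg _ (d + 2) (by omega)) v
  refine h.congr_of_eventuallyEq ?_
  have hcont : ContinuousAt (fun s => Q A (segPath c e s)) t :=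
    (continuous_Q A continuous_id).continuousAt.comp (hasDerivAt_segPath c e t).continuousAt
  filter_upwards [hcont.eventually_lt_const ht] with s hs
  -- Two vanishing terms are appended, so that the length `d + 3` is the one in `psi` for degree `d
  -- + 1`.
  rw [p_eq_pSum A hs, pSum_succ (N := d + 2) (hdeg _ _ (by omega)),
    pSum_succ (N := d + 1) (hdeg _ _ (by omega))]

/-- All three coefficients of the quadratic expansion in `1 - t` and `t` are nonpositive. The point
`t = 0` is left out because `c` may be a cusp. -/
theorem Q_segPath_neg (hA : A.IsSymm) {c e : Fin n → ℝ} (hc : Q A c ≤ 0) (he : Q A e < 0)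
    (hce : B A c e < 0) {t : ℝ} (ht0 : 0 < t) (ht1 : t ≤ 1) : Q A (segPath c e t) < 0 := by
  rw [Q_segPath hA]
  have h1 : 0 ≤ 1 - t := by linarith
  have h2 : t ^ 2 * Q A e < 0 := mul_neg_of_pos_of_neg (by positivity) he
  have h3 : t * (1 - t) * B A c e ≤ 0 := mul_nonpos_of_nonneg_of_nonpos (by positivity) hce.le
  have h4 : (1 - t) ^ 2 * Q A c ≤ 0 := mul_nonpos_of_nonneg_of_nonpos (by positivity) hc
  linarith

end Path

section CuspLimit

theorem tendsto_E_atTop : Tendsto E atTop (𝓝 1) := by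
  have h1 : IntegrableOn (fun u : ℝ => Real.exp (-Real.pi * u ^ 2)) (Set.Ioi 0) :=
    (integrable_exp_neg_mul_sq Real.pi_pos).integrableOn
  have h2 := intervalIntegral_tendsto_integral_Ioi 0 h1 tendsto_id
  rw [integral_gaussian_Ioi, div_self Real.pi_ne_zero, Real.sqrt_one] at h2
  have h3 := h2.const_mul 2
  rw [mul_one_div_cancel two_ne_zero] at h3
  exact h3

theorem tendsto_E_atBot : Tendsto E atBot (𝓝 (-1)) := by
  have h := (tendsto_E_atTop.comp tendsto_neg_atBot_atTop).neg
  refine h.congr fun x => ?_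
  simp [E_neg]

theorem tendsto_pow_mul_derivE_atTop (j k : ℕ) :
    Tendsto (fun x : ℝ => x ^ j * derivE (k + 1) x) atTop (𝓝 0) := by
  have h : (fun x : ℝ => x ^ j * derivE (k + 1) x) = fun x =>
      (Polynomial.X ^ j * hermiteFactor k).eval x * Real.exp (-Real.pi * x ^ 2) := by
    funext x; simp [derivE, mul_assoc]
  rw [h]
  have h2 := (Polynomial.X ^ j * hermiteFactor k).tendsto_div_exp_atTop
  refine squeeze_zero_norm' ?_ (tendsto_norm_zero.comp h2)
  filter_upwards [eventually_ge_atTop (1 : ℝ)] with x hx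
  simp only [Function.comp, norm_mul, norm_div, Real.norm_eq_abs, Real.abs_exp]
  rw [div_eq_mul_inv, ← Real.exp_neg]
  gcongr
  nlinarith [Real.pi_gt_three, mul_le_mul_of_nonneg_right Real.pi_gt_three.le (sq_nonneg x)]

theorem tendsto_pow_mul_derivE_atBot (j k : ℕ) :
    Tendsto (fun x : ℝ => x ^ j * derivE (k + 1) x) atBot (𝓝 0) := by
  have h := ((tendsto_pow_mul_derivE_atTop j k).comp tendsto_neg_atBot_atTop).const_mul
    ((-1 : ℝ) ^ (j + k))
  rw [mul_zero] at h
  refine h.congr fun x => ?_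
  simp only [Function.comp, derivE_neg, neg_pow x j]
  have h3 : ((-1 : ℝ) ^ (j + k)) * ((-1) ^ j * (-1) ^ (k + 1 + 1)) = 1 := by
    rw [← pow_add, ← pow_add]
    exact Even.neg_one_pow ⟨j + k + 1, by ring⟩
  linear_combination (x ^ j * derivE (k + 1) x) * h3

theorem continuous_evalReal_dirDer (k : ℕ) (g : MvPolynomial (Fin n) ℂ) (v : Fin n → ℝ) :
    Continuous fun u : Fin n → ℝ => evalReal ((dirDer u)^[k] g) v := by
  induction k generalizing g with
  | zero =>
    simp only [Function.iterate_zero, id_eq]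
    fun_prop
  | succ k ih =>
    simp only [evalReal_dirDer_iterate_succ]
    refine continuous_finsetSum _ fun i _ => ?_
    have := ih (MvPolynomial.pderiv i g)
    fun_prop

/-- The scale `r = (-Q)^{-1/2}` tends to infinity. As `B(c,v) ≠ 0`, the argument `rB` of `E` tends
to `±∞`, so the term `k = 0` gives the sign. For `k ≥ 1` the normalized derivative contributes
`r^k`, which the Gaussian decay of `E⁽ᵏ⁾(rB)` beats. -/
theorem tendsto_p_segPath_zero (hA : A.IsSymm) {c e : Fin n → ℝ} (hc : Q A c = 0) (he : Q A e < 0)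
    (hce : B A c e < 0) (d : ℕ) (f : MvPolynomial (Fin n) ℂ) {v : Fin n → ℝ} (hv : B A c v ≠ 0) :
    Tendsto (fun t => p A d (segPath c e t) f v) (𝓝[>] 0) (𝓝 (p A d c f v)) := by
  have hneg : ∀ᶠ t in 𝓝[>] (0 : ℝ), Q A (segPath c e t) < 0 := by
    filter_upwards [Ioc_mem_nhdsGT (show (0 : ℝ) < 1 by norm_num)] with t ht
    exact Q_segPath_neg hA hc.le he hce ht.1 ht.2
  have hpath : Tendsto (segPath c e) (𝓝[>] 0) (𝓝 c) := by
    have h := (hasDerivAt_segPath c e 0).continuousAt.tendsto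
    rw [segPath_zero] at h
    exact h.mono_left nhdsWithin_le_nhds
  have hQ : Tendsto (fun t => -Q A (segPath c e t)) (𝓝[>] 0) (𝓝[>] 0) := by
    refine tendsto_nhdsWithin_iff.mpr ⟨?_, ?_⟩
    · have h := (((continuous_Q A continuous_id).tendsto c).comp hpath).neg
      simp only [id, hc, neg_zero] at h
      exact h
    · filter_upwards [hneg] with t ht
      simpa using ht
  have hr : Tendsto (segScale A c e) (𝓝[>] 0) atTop := by
    have h1 : Tendsto (fun t => Real.sqrt (-Q A (segPath c e t))) (𝓝[>] 0) (𝓝[>] 0) := by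
      refine tendsto_nhdsWithin_iff.mpr ⟨?_, ?_⟩
      · have h := (Real.continuous_sqrt.tendsto 0).comp (hQ.mono_right nhdsWithin_le_nhds)
        rw [Real.sqrt_zero] at h
        exact h
      · filter_upwards [hneg] with t ht
        exact Real.sqrt_pos.mpr (by linarith)
    refine (tendsto_inv_nhdsGT_zero.comp h1).congr fun t => ?_
    simp [segScale]
  have hB : Tendsto (fun t => B A (segPath c e t) v) (𝓝[>] 0) (𝓝 (B A c v)) := by
    have h := (hasDerivAt_B_left A v (hasDerivAt_segPath c e 0)).continuousAt.tendsto
    rw [segPath_zero] at h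
    exact h.mono_left nhdsWithin_le_nhds
  have hx : ∀ t, B A (unitVec A (segPath c e t)) v = segScale A c e t * B A (segPath c e t) v :=
    fun t => B_smul_left _ _ _ _
  have hlim0 : Tendsto (fun t => derivE 0 (segScale A c e t * B A (segPath c e t) v))
      (𝓝[>] 0) (𝓝 (Real.sign (B A c v))) := by
    rcases lt_or_gt_of_ne hv with h | h
    · rw [Real.sign_of_neg h]
      exact tendsto_E_atBot.comp (hr.atTop_mul_neg h hB)
    · rw [Real.sign_of_pos h]
      exact tendsto_E_atTop.comp (hr.atTop_mul_pos h hB)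
  have hlimk : ∀ k, Tendsto (fun t => segScale A c e t ^ (k + 1) *
      derivE (k + 1) (segScale A c e t * B A (segPath c e t) v)) (𝓝[>] 0) (𝓝 0) := by
    intro k
    have h1 : Tendsto (fun t => (segScale A c e t * B A (segPath c e t) v) ^ (k + 1) *
        derivE (k + 1) (segScale A c e t * B A (segPath c e t) v)) (𝓝[>] 0) (𝓝 0) := by
      rcases lt_or_gt_of_ne hv with h | h
      · exact (tendsto_pow_mul_derivE_atBot (k + 1) k).comp (hr.atTop_mul_neg h hB)
      · exact (tendsto_pow_mul_derivE_atTop (k + 1) k).comp (hr.atTop_mul_pos h hB)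
    -- Dividing `(rB)^{k+1}` by `B^{k+1}`, whose limit is nonzero, leaves `r^{k+1}`.
    have h2 := h1.mul ((hB.pow (k + 1)).inv₀ (pow_ne_zero _ hv))
    rw [zero_mul] at h2
    refine h2.congr' ?_
    filter_upwards [hB.eventually_ne hv] with t ht
    field_simp
    ring
  have hterm : ∀ k ∈ Finset.range (d + 1), Tendsto (fun t => expCoeff k *
      ((derivE k (B A (unitVec A (segPath c e t)) v) : ℝ) : ℂ) *
        evalReal ((dirDer (unitVec A (segPath c e t)))^[k] (hat A f)) v) (𝓝[>] 0)
      (𝓝 (if k = 0 then ((Real.sign (B A c v) : ℝ) : ℂ) * evalReal (hat A f) v else 0)) := by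
    intro k _
    simp only [hx]
    cases k with
    | zero =>
      have h := (Complex.continuous_ofReal.tendsto _).comp hlim0
      have h2 := h.mul_const (evalReal (hat A f) v)
      simpa [expCoeff] using h2
    | succ k =>
      have h := (Complex.continuous_ofReal.tendsto _).comp (hlimk k)
      have h2 := ((continuous_evalReal_dirDer (k + 1) (hat A f) v).tendsto c).comp hpath
      have h3 := (h.const_mul (expCoeff (k + 1))).mul h2
      simp only [Complex.ofReal_zero, mul_zero, zero_mul] at h3
      simp only [Nat.add_eq_zero_iff, one_ne_zero, and_false, if_false]
      refine h3.congr fun t => ?_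
      have hu : unitVec A (segPath c e t) = segScale A c e t • segPath c e t := rfl
      rw [hu, dirDer_iterate_smul_left, evalReal_smul]
      simp only [Function.comp]
      push_cast
      ring
  have hsum := tendsto_finsetSum _ hterm
  rw [Finset.sum_ite_eq' (Finset.range (d + 1)) 0] at hsum
  simp only [Finset.mem_range, Nat.succ_pos, if_true] at hsum
  rw [p, if_neg (by rw [hc]; exact lt_irrefl _)]
  refine hsum.congr' ?_
  filter_upwards [hneg] with t ht
  rw [p_eq_pSum A ht]
  rfl

end CuspLimit

end

end IndefTheta

/-! ### Uniform lower bound for the majorant along a segment. -/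

namespace IndefTheta

noncomputable section

open Matrix MeasureTheory Filter Topology

variable {n : ℕ} {A : Matrix (Fin n) (Fin n) ℤ}

section LowerBound

/-- The values of a cusp on a lattice translate stay away from zero. -/
theorem exists_le_abs_B {c : Fin n → ℝ} (hc : ∃ r : Fin n → ℚ, c = fun i => (r i : ℝ))
    {a : Fin n → ℝ} (ha : ∀ l ∈ intLattice n, B A c (a + l) ≠ 0) :
    ∃ δ > 0, ∀ l ∈ intLattice n, δ ≤ |B A c (a + l)| := by
  obtain ⟨r, rfl⟩ := hc
  set c : Fin n → ℝ := fun i => (r i : ℝ) with hc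
  -- A common denominator of the coordinates of `c`: `N B(c,ℓ)` is an integer for integral `ℓ`, so
  -- the values on the translate by `a` lie in `(y + ℤ)/N`.
  set N : ℕ := ∏ i, (r i).den with hN
  have hN0 : 0 < (N : ℝ) := by
    exact_mod_cast Finset.prod_pos fun i _ => (r i).den_pos
  have hint : ∀ l ∈ intLattice n, ∃ k : ℤ, (N : ℝ) * B A c l = k := by
    intro l hl
    obtain ⟨m, hm⟩ := mulVec_mem_intLattice A hl
    have h1 : ∀ i, ∃ z : ℤ, (N : ℝ) * c i = z := by
      intro i
      obtain ⟨q, hq⟩ := Finset.dvd_prod_of_mem (fun i => (r i).den) (Finset.mem_univ i)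
      refine ⟨q * (r i).num, ?_⟩
      have h2 : ((r i).den : ℝ) * c i = (r i).num := by
        change ((r i).den : ℝ) * (r i : ℝ) = _
        exact_mod_cast (r i).den_mul_eq_num
      rw [hN, hq]
      push_cast
      rw [mul_right_comm, h2, mul_comm]
    choose z hz using h1
    refine ⟨∑ i, z i * m i, ?_⟩
    rw [B, ← hm, dotProduct, Finset.mul_sum]
    push_cast
    refine Finset.sum_congr rfl fun i _ => ?_
    rw [← hz, mul_assoc]
    rfl
  set y := (N : ℝ) * B A c a with hy
  have hval : ∀ l ∈ intLattice n, ∃ k : ℤ, (N : ℝ) * B A c (a + l) = y + k := by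
    intro l hl
    obtain ⟨k, hk⟩ := hint l hl
    exact ⟨k, by rw [B_add_right, mul_add, hk]⟩
  -- The gap is 1 if `y` is an integer, and the distance of `y` to the nearest integer otherwise.
  have key : ∃ δ > 0, ∀ k : ℤ, y + k ≠ 0 → δ ≤ |y + k| := by
    by_cases h : y = round y
    · refine ⟨1, one_pos, fun k hk => ?_⟩
      rw [h] at hk ⊢
      have h2 : round y + k ≠ 0 := by exact_mod_cast hk
      exact_mod_cast Int.one_le_abs h2
    · refine ⟨|y - round y|, abs_pos.mpr (sub_ne_zero.mpr h), fun k _ => ?_⟩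
      have := round_le y (-k)
      push_cast at this
      rwa [sub_neg_eq_add] at this
  obtain ⟨δ, hδ, hk⟩ := key
  refine ⟨δ / N, by positivity, fun l hl => ?_⟩
  obtain ⟨k, hkl⟩ := hval l hl
  have h3 := hk k (by rw [← hkl]; exact mul_ne_zero hN0.ne' (ha l hl))
  rw [← hkl, abs_mul, abs_of_pos hN0] at h3
  rw [div_le_iff₀ hN0]
  linarith

/-- The mixed term of the quadratic expansion is nonnegative by `stress_nonneg` and can be dropped.
-/
theorem stress_segPath_ge (hA : A.IsSymm) (hsig : HasSignature A) {c e : Fin n → ℝ}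
    (hc : Q A c ≤ 0) (he : Q A e < 0) (hce : B A c e < 0) {t : ℝ} (ht0 : 0 ≤ t) (ht1 : t ≤ 1)
    (v : Fin n → ℝ) :
    (1 - t) ^ 2 * stress A c c v + t ^ 2 * stress A e e v ≤
      stress A (segPath c e t) (segPath c e t) v := by
  rw [segPath, stress_segment hA]
  have h1 := stress_nonneg hA hsig hc he hce.le v
  have h2 : 0 ≤ 2 * t * (1 - t) * stress A c e v :=
    mul_nonneg (mul_nonneg (by linarith) (by linarith)) h1
  linarith

theorem segScale_le {c e : Fin n → ℝ} {t κ : ℝ} (hκ : 0 < κ)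
    (h : κ ≤ -Q A (segPath c e t)) : segScale A c e t ≤ 1 + 1 / κ := by
  have hq : Q A (segPath c e t) < 0 := by linarith
  have h1 := segScale_sq hq
  have h2 : segScale A c e t ^ 2 ≤ 1 / κ := by
    rw [le_div_iff₀ hκ]
    nlinarith [sq_nonneg (segScale A c e t)]
  nlinarith [sq_nonneg (segScale A c e t - 1)]

/-- The uniform lower bound for the majorants along a segment which ends in the interior of the
cone. -/
theorem exists_stress_segPath_ge (hA : A.IsSymm) (hsig : HasSignature A) {c₀ c e : Fin n → ℝ}
    (hc : c ∈ coneBar A c₀) (he : Q A e < 0) (hce : B A c e < 0) {a : Fin n → ℝ}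
    (ha : a ∈ admissible A (intLattice n) c) :
    ∃ η > 0, ∃ K, ∀ t ∈ Set.Ioo (0 : ℝ) 1, ∀ l ∈ intLattice n,
      η * (segScale A c e t + ‖a + l‖) - K ≤
        stress A (segPath c e t) (segPath c e t) (a + l) / (-Q A (segPath c e t)) := by
  obtain ⟨ε, hε, hstr⟩ := exists_stress_self_ge hA hsig he
  have hce' : 0 < -B A c e := by linarith
  have he' : 0 < -Q A e := by linarith
  rcases hc with ⟨hc, _⟩ | ⟨hrat, hc, _⟩
  · obtain ⟨ε', hε', hstr'⟩ := exists_stress_self_ge hA hsig hc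
    have hc' : 0 < -Q A c := by linarith
    set K₀ := -Q A c + -B A c e + -Q A e with hK₀
    have hK₀pos : 0 < K₀ := by positivity
    set m := min (-Q A c) (-Q A e) with hm
    have hmpos : 0 < m := lt_min hc' he'
    -- Both endpoints are interior. The factor `1/2` is the minimum of `(1 - t)² + t²`, and `K₀`
    -- bounds `-Q` on the segment.
    set g := min ε ε' / 2 / K₀ with hg
    have hgpos : 0 < g := by positivity
    refine ⟨g, hgpos, g * (1 + 1 / (m / 2)) + g, fun t ht l hl => ?_⟩
    obtain ⟨ht0, ht1⟩ := ht
    have hts : 1 / 2 ≤ (1 - t) ^ 2 + t ^ 2 := by nlinarith [sq_nonneg (1 - 2 * t)]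
    have hq1 : m / 2 ≤ -Q A (segPath c e t) := by
      rw [Q_segPath hA]
      have h1 : (1 - t) ^ 2 * m ≤ (1 - t) ^ 2 * (-Q A c) := by gcongr; exact min_le_left _ _
      have h2 : t ^ 2 * m ≤ t ^ 2 * (-Q A e) := by gcongr; exact min_le_right _ _
      have h3 : 0 ≤ t * (1 - t) * (-B A c e) := by
        have : 0 ≤ 1 - t := by linarith
        positivity
      nlinarith
    have hq2 : -Q A (segPath c e t) ≤ K₀ := by
      rw [Q_segPath hA]
      have h1 : (1 - t) ^ 2 * (-Q A c) ≤ 1 * (-Q A c) := by gcongr; nlinarith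
      have h2 : t ^ 2 * (-Q A e) ≤ 1 * (-Q A e) := by gcongr; nlinarith
      have h3 : t * (1 - t) * (-B A c e) ≤ 1 * (-B A c e) := by gcongr; nlinarith
      linarith
    have hr := segScale_le (by positivity) hq1
    have hs := stress_segPath_ge hA hsig hc.le he hce ht0.le ht1.le (a + l)
    have hN := norm_nonneg (a + l)
    set N := ‖a + l‖
    have h4 : min ε ε' / 2 * N ^ 2 ≤ stress A (segPath c e t) (segPath c e t) (a + l) := by
      refine le_trans ?_ hs
      have h1 : min ε ε' * N ^ 2 ≤ stress A c c (a + l) :=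
        le_trans (by gcongr; exact min_le_right _ _) (hstr' _)
      have h2 : min ε ε' * N ^ 2 ≤ stress A e e (a + l) :=
        le_trans (by gcongr; exact min_le_left _ _) (hstr _)
      have h0 : 0 ≤ min ε ε' * N ^ 2 := by positivity
      nlinarith [mul_le_mul_of_nonneg_left h1 (sq_nonneg (1 - t)),
        mul_le_mul_of_nonneg_left h2 (sq_nonneg t), mul_le_mul_of_nonneg_right hts h0]
    have h5 : g * N ^ 2 ≤ stress A (segPath c e t) (segPath c e t) (a + l) /
        (-Q A (segPath c e t)) := by
      rw [le_div_iff₀ (by linarith)]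
      calc g * N ^ 2 * -Q A (segPath c e t) ≤ g * N ^ 2 * K₀ := by gcongr
        _ = min ε ε' / 2 * N ^ 2 := by rw [hg]; field_simp
        _ ≤ _ := h4
    have h6 := mul_le_mul_of_nonneg_left hr hgpos.le
    nlinarith [mul_nonneg hgpos.le (sq_nonneg (N - 1)), mul_nonneg hgpos.le hN]
  · obtain ⟨δ, hδ, hlow⟩ := exists_le_abs_B (A := A) hrat (a := a) (ha hc)
    set K₁ := -B A c e + -Q A e with hK₁
    have hK₁pos : 0 < K₁ := by positivity
    set κ := min (-B A c e) (-Q A e) with hκ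
    have hκpos : 0 < κ := lt_min hce' he'
    set g := min (δ ^ 2) ε / K₁ with hg
    have hgpos : 0 < g := by positivity
    set η := min g (g * κ / 2) with hη
    have hηpos : 0 < η := by positivity
    refine ⟨η, hηpos, η + 2 * (δ ^ 2 / K₁), fun t ht l hl => ?_⟩
    obtain ⟨ht0, ht1⟩ := ht
    -- Near a cusp `-Q` vanishes exactly to first order: it lies between `κt` and `K₁t`.
    have hq1 : κ * t ≤ -Q A (segPath c e t) := by
      rw [Q_segPath hA, hc]
      have h1 : t * (1 - t) * κ ≤ t * (1 - t) * (-B A c e) := by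
        have : 0 ≤ 1 - t := by linarith
        gcongr
        exact min_le_left _ _
      have h2 : t ^ 2 * κ ≤ t ^ 2 * (-Q A e) := by gcongr; exact min_le_right _ _
      nlinarith
    have hq2 : -Q A (segPath c e t) ≤ K₁ * t := by
      rw [Q_segPath hA, hc]
      have h2 : t * t * (-Q A e) ≤ t * 1 * (-Q A e) := by gcongr
      have h3 : t * (1 - t) * (-B A c e) ≤ t * 1 * (-B A c e) := by gcongr; linarith
      rw [hK₁]
      nlinarith
    have hκt : 0 < κ * t := by positivity
    have hr := segScale_le hκt hq1
    have hs := stress_segPath_ge hA hsig hc.le he hce ht0.le ht1.le (a + l)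
    have hN := norm_nonneg (a + l)
    have hB : δ ^ 2 ≤ stress A c c (a + l) := by
      rw [stress_self, hc, mul_zero, zero_mul, sub_zero, ← sq_abs (B A c (a + l))]
      have := hlow l hl
      gcongr
    have hst := hstr (a + l)
    set N := ‖a + l‖
    have h1 : (1 - t) ^ 2 * δ ^ 2 + t ^ 2 * (ε * N ^ 2) ≤
        stress A (segPath c e t) (segPath c e t) (a + l) := by
      refine le_trans ?_ hs
      gcongr
    have h2 : ((1 - t) ^ 2 * δ ^ 2 + t ^ 2 * (ε * N ^ 2)) / (K₁ * t) ≤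
        stress A (segPath c e t) (segPath c e t) (a + l) / (-Q A (segPath c e t)) := by
      have h0 : 0 ≤ (1 - t) ^ 2 * δ ^ 2 + t ^ 2 * (ε * N ^ 2) := by positivity
      have : 0 < -Q A (segPath c e t) := by linarith
      gcongr
      exact h0.trans h1
    refine le_trans ?_ h2
    -- From `(1 - t)²/t = 1/t - 2 + t`; the constant `-2` is absorbed in `K`. Half of the term `1/t`
    -- controls the scale, and the other half with `tN²` gives `N` by the arithmetic-geometric mean.
    have h3 : ((1 - t) ^ 2 * δ ^ 2 + t ^ 2 * (ε * N ^ 2)) / (K₁ * t) =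
        δ ^ 2 / K₁ * (1 / t) + ε / K₁ * (t * N ^ 2) + δ ^ 2 / K₁ * t - 2 * (δ ^ 2 / K₁) := by
      field_simp
      ring
    have h4 : g * (1 / t) ≤ δ ^ 2 / K₁ * (1 / t) := by
      rw [hg]; gcongr; exact min_le_left _ _
    have h5 : g * (t * N ^ 2) ≤ ε / K₁ * (t * N ^ 2) := by
      rw [hg]; gcongr; exact min_le_right _ _
    have h6 : 2 * N ≤ 1 / t + t * N ^ 2 := by
      have h7 : 1 / t + t * N ^ 2 - 2 * N = (t * N - 1) ^ 2 / t := by field_simp; ring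
      have h8 : 0 ≤ (t * N - 1) ^ 2 / t := by positivity
      linarith
    have h9 : 0 ≤ δ ^ 2 / K₁ * t := by positivity
    have h10 : η * N ≤ g * N := by gcongr; exact min_le_left _ _
    have h11 : η * (1 / (κ * t)) ≤ g / 2 * (1 / t) := by
      calc η * (1 / (κ * t)) ≤ g * κ / 2 * (1 / (κ * t)) := by gcongr; exact min_le_right _ _
        _ = g / 2 * (1 / t) := by field_simp
    have h12 := mul_le_mul_of_nonneg_left hr hηpos.le
    have h13 := mul_le_mul_of_nonneg_left h6 (half_pos hgpos).le
    have h14 : 0 ≤ g / 2 * (t * N ^ 2) := by positivity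
    rw [h3]
    linarith

end LowerBound

end

end IndefTheta

/-! ### Uniform majorants for the summands and their integrals along a segment. -/

namespace IndefTheta

noncomputable section

open Matrix MeasureTheory Filter Topology

variable {n : ℕ} {A : Matrix (Fin n) (Fin n) ℤ}

section SegmentTerms

/-- The derivative along the segment of a summand of the theta series, without the phase. -/
def segTerm (A : Matrix (Fin n) (Fin n) ℤ) (d : ℕ) (c e : Fin n → ℝ)
    (f : MvPolynomial (Fin n) ℂ) (τ : ℂ) (l : Fin n → ℝ) (t : ℝ) : ℂ :=
  segDeriv A d c e f (Real.sqrt τ.im • l) t *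
    Complex.exp (2 * Real.pi * Complex.I * τ * (Q A l : ℂ))

theorem abs_segPath_le (c e : Fin n → ℝ) {t : ℝ} (ht : t ∈ Set.Ioo (0 : ℝ) 1) (i : Fin n) :
    ‖segPath c e t i‖ ≤ ‖c‖ + ‖e‖ := by
  have h1 : ‖(1 - t) * c i‖ ≤ 1 * ‖c‖ := by
    rw [norm_mul]
    gcongr
    · rw [Real.norm_of_nonneg (by linarith [ht.2])]; linarith [ht.1]
    · exact norm_le_pi_norm c i
  have h2 : ‖t * e i‖ ≤ 1 * ‖e‖ := by
    rw [norm_mul]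
    gcongr
    · rw [Real.norm_of_nonneg ht.1.le]; exact ht.2.le
    · exact norm_le_pi_norm e i
  calc ‖segPath c e t i‖ = ‖(1 - t) * c i + t * e i‖ := by simp [segPath]
    _ ≤ _ := (norm_add_le _ _).trans (by linarith)

/-- The unit vector and its velocity are polynomials in the scale with coefficients bounded on the
segment. So the only unbounded parameters are the scale and `‖v‖`, even at a cusp. -/
theorem exists_norm_segDeriv_le (hA : A.IsSymm) (d : ℕ) (c e : Fin n → ℝ)
    (f : MvPolynomial (Fin n) ℂ) (s : ℝ) :
    ∃ C : ℝ, ∃ M : ℕ, 0 ≤ C ∧ ∀ t ∈ Set.Ioo (0 : ℝ) 1, ∀ v : Fin n → ℝ,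
      ‖segDeriv A d c e f (s • v) t‖ ≤ C * (1 + (segScale A c e t + ‖v‖)) ^ M *
        Real.exp (-Real.pi * B A (unitVec A (segPath c e t)) (s • v) ^ 2) := by
  let W : Set.Ioo (0 : ℝ) 1 × (Fin n → ℝ) → ℝ := fun x => 1 + (segScale A c e x.1 + ‖x.2‖)
  have hW : ∀ x, 1 ≤ W x := fun x => by
    have := segScale_nonneg (A := A) c e x.1
    have := norm_nonneg x.2
    simp only [W]
    linarith
  have hr : PolyBdd W (fun x => (segScale A c e x.1 : ℂ)) :=
    PolyBdd.of_le (C := 1) zero_le_one fun x => by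
      rw [Complex.norm_real, Real.norm_of_nonneg (segScale_nonneg _ _ _), one_mul]
      have := norm_nonneg x.2
      simp only [W]
      linarith
  have hp : ∀ i, PolyBdd W (fun x => (segPath c e x.1 i : ℂ)) := fun i =>
    PolyBdd.of_le (C := ‖c‖ + ‖e‖) (by positivity) fun x => by
      rw [Complex.norm_real]
      exact (abs_segPath_le c e x.1.2 i).trans (le_mul_of_one_le_right (by positivity) (hW x))
  have hv : ∀ i, PolyBdd W (fun x => ((s • x.2) i : ℂ)) := fun i =>
    PolyBdd.of_le (C := |s|) (abs_nonneg s) fun x => by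
      rw [Complex.norm_real, Pi.smul_apply, norm_smul, Real.norm_eq_abs]
      gcongr
      have := segScale_nonneg (A := A) c e x.1
      have := norm_le_pi_norm x.2 i
      simp only [W]
      linarith
  have hu : ∀ i, PolyBdd W (fun x => (unitVec A (segPath c e x.1) i : ℂ)) := fun i => by
    have h : (fun x : Set.Ioo (0 : ℝ) 1 × (Fin n → ℝ) => (unitVec A (segPath c e x.1) i : ℂ)) =
        fun x => (segScale A c e x.1 : ℂ) * (segPath c e x.1 i : ℂ) := by
      funext x; simp [unitVec, segScale]
    rw [h]
    exact hr.mul (hp i)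
  have hBp : PolyBdd W (fun x => ((B A (segPath c e x.1) (e - c) : ℝ) : ℂ)) :=
    polyBdd_B hW (u := fun x => segPath c e x.1) (v := fun _ => e - c) hp fun i => PolyBdd.const _
  have hw : ∀ i, PolyBdd W (fun x => (segVel A c e x.1 i : ℂ)) := fun i => by
    have h : (fun x : Set.Ioo (0 : ℝ) 1 × (Fin n → ℝ) => (segVel A c e x.1 i : ℂ)) =
        fun x => (segScale A c e x.1 : ℂ) * ((e - c) i : ℂ) +
          (1 / 2 : ℂ) * ((segScale A c e x.1 : ℂ) ^ 3 * (B A (segPath c e x.1) (e - c) : ℂ)) *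
            (segPath c e x.1 i : ℂ) := by
      funext x
      simp only [segVel, Pi.add_apply, Pi.smul_apply, smul_eq_mul]
      push_cast
      ring
    rw [h]
    have h1 : PolyBdd W (fun x => (segScale A c e x.1 : ℂ) * ((e - c) i : ℂ)) :=
      hr.mul (PolyBdd.const _)
    have h2 : PolyBdd W (fun x => (1 / 2 : ℂ) *
        ((segScale A c e x.1 : ℂ) ^ 3 * (B A (segPath c e x.1) (e - c) : ℂ))) :=
      ((hr.pow 3).mul hBp).const_mul _
    exact h1.add hW (h2.mul (hp i))
  obtain ⟨C, M, hC, h⟩ := exists_norm_pSum_le hW (A := A)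
    (g := fun x => create A (segVel A c e x.1) (hat A f)) (d + 3) (polyBdd_B hW hu hv)
    (fun k => polyBdd_dirDer_iterate_create hW hA hu hv hw k _)
  exact ⟨C, M, hC, fun t ht v => h (⟨t, ht⟩, v)⟩

/-- The exponent dominates scale plus norm linearly. Half of it absorbs the polynomial in these two
quantities, and the rest is a summable bound independent of `t`. -/
theorem exists_norm_segTerm_le (hA : A.IsSymm) (hsig : HasSignature A) {c₀ c e : Fin n → ℝ}
    (hc : c ∈ coneBar A c₀) (he : Q A e < 0) (hce : B A c e < 0) {a : Fin n → ℝ}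
    (ha : a ∈ admissible A (intLattice n) c) (d : ℕ) (f : MvPolynomial (Fin n) ℂ) {τ : ℂ}
    (hτ : 0 < τ.im) :
    ∃ C : ℝ, ∃ ε > 0, ∀ t ∈ Set.Ioo (0 : ℝ) 1, ∀ l : intLattice n,
      ‖segTerm A d c e f τ (a + l) t‖ ≤ C * Real.exp (-ε * ‖a + (l : Fin n → ℝ)‖) := by
  have hc0 : Q A c ≤ 0 := by
    rcases hc with hc | hc
    · exact hc.1.le
    · exact hc.2.1.le
  obtain ⟨η, hη, K, hlow⟩ := exists_stress_segPath_ge hA hsig hc he hce ha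
  obtain ⟨C, M, hC, hb⟩ := exists_norm_segDeriv_le hA d c e f (Real.sqrt τ.im)
  set δ := Real.pi * τ.im * η / 2 with hδ
  have hδ0 : 0 < δ := by positivity
  obtain ⟨D, hD, hp⟩ := exists_pow_le_exp M hδ0
  refine ⟨C * D * Real.exp (Real.pi * τ.im * K), δ, hδ0, fun t ht l => ?_⟩
  have hq := Q_segPath_neg hA hc0 he hce ht.1 ht.2.le
  have hr := segScale_nonneg (A := A) c e t
  set v := a + (l : Fin n → ℝ) with hv
  have hlow' := hlow t ht l l.2
  rw [← hv] at hlow'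
  rw [segTerm, norm_mul, norm_cexp_Q]
  set r := segScale A c e t
  set S := stress A (segPath c e t) (segPath c e t) v / (-Q A (segPath c e t)) with hS
  calc _ ≤ C * (1 + (r + ‖v‖)) ^ M *
        Real.exp (-Real.pi * B A (unitVec A (segPath c e t)) (Real.sqrt τ.im • v) ^ 2) *
        Real.exp (-(2 * Real.pi * τ.im * Q A v)) :=
        mul_le_mul_of_nonneg_right (hb t ht v) (Real.exp_pos _).le
    _ = C * (1 + (r + ‖v‖)) ^ M * Real.exp (-(Real.pi * τ.im * S)) := by
        rw [mul_assoc, exp_mul_exp_eq_stress hq hτ]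
    _ ≤ C * (D * Real.exp (δ * (r + ‖v‖))) *
        Real.exp (Real.pi * τ.im * K - 2 * δ * (r + ‖v‖)) := by
        gcongr
        · exact hp _ (by positivity)
        · have h1 := mul_le_mul_of_nonneg_left hlow' (mul_pos Real.pi_pos hτ).le
          rw [hδ]
          linarith
    _ = C * D * Real.exp (Real.pi * τ.im * K) * Real.exp (-δ * (r + ‖v‖)) := by
        have h3 : Real.exp (δ * (r + ‖v‖)) * Real.exp (Real.pi * τ.im * K - 2 * δ * (r + ‖v‖)) =
            Real.exp (Real.pi * τ.im * K) * Real.exp (-δ * (r + ‖v‖)) := by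
          rw [← Real.exp_add, ← Real.exp_add]; congr 1; ring
        linear_combination C * D * h3
    _ ≤ _ := by
        refine mul_le_mul_of_nonneg_left (Real.exp_le_exp.mpr ?_) (by positivity)
        rw [neg_mul, neg_mul, neg_le_neg_iff]
        gcongr
        linarith

theorem segTerm_eq_psi (d : ℕ) (c e : Fin n → ℝ) (f : MvPolynomial (Fin n) ℂ) {τ : ℂ}
    (hτ : 0 < τ.im) (l : Fin n → ℝ) (t : ℝ) :
    segTerm A d c e f τ l t = ((Real.sqrt τ.im : ℝ) : ℂ) ^ (d + 1) *
      psi A (unitVec A (segPath c e t)) τ (d + 1) (create A (segVel A c e t) (hat A f)) l := by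
  have h : ((Real.sqrt τ.im : ℝ) : ℂ) ≠ 0 := by exact_mod_cast (Real.sqrt_pos.mpr hτ).ne'
  rw [segTerm, psi, segDeriv, inv_pow, ← mul_assoc, mul_inv_cancel_left₀ (pow_ne_zero _ h)]

/-- Inside the interval the function is a derivative in `t`, hence measurable. -/
theorem aestronglyMeasurable_segTerm (hA : A.IsSymm) (hsig : HasSignature A) {c e : Fin n → ℝ}
    (hc : Q A c ≤ 0) (he : Q A e < 0) (hce : B A c e < 0) {d : ℕ} {f : MvPolynomial (Fin n) ℂ}
    (hf : f.IsHomogeneous d) (τ : ℂ) (l : Fin n → ℝ) :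
    AEStronglyMeasurable (segTerm A d c e f τ l) (volume.restrict (Set.Ioo 0 1)) := by
  have hdet := isUnit_det_realMat hA hsig he
  have h1 : AEStronglyMeasurable (segDeriv A d c e f (Real.sqrt τ.im • l))
      (volume.restrict (Set.Ioo 0 1)) := by
    refine (measurable_deriv fun t =>
      p A d (segPath c e t) f (Real.sqrt τ.im • l)).aestronglyMeasurable.congr ?_
    filter_upwards [ae_restrict_mem measurableSet_Ioo] with t ht
    exact (hasDerivAt_p_segPath hA hdet hf (Q_segPath_neg hA hc he hce ht.1 ht.2.le) _).deriv
  exact h1.mul_const _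

/-- Fundamental theorem of calculus with one-sided limits; the condition on `l` is what the limit at
a cusp needs. -/
theorem integral_segTerm (hA : A.IsSymm) (hsig : HasSignature A) {c₀ c e : Fin n → ℝ}
    (hc : c ∈ coneBar A c₀) (he : Q A e < 0) (hce : B A c e < 0) {d : ℕ}
    {f : MvPolynomial (Fin n) ℂ} (hf : f.IsHomogeneous d) {τ : ℂ} (hτ : 0 < τ.im) {l : Fin n → ℝ}
    (hl : Q A c = 0 → B A c l ≠ 0) (hint : IntegrableOn (segTerm A d c e f τ l) (Set.Ioo 0 1)) :
    ∫ t in Set.Ioo (0 : ℝ) 1, segTerm A d c e f τ l t =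
      (p A d e f (Real.sqrt τ.im • l) - p A d c f (Real.sqrt τ.im • l)) *
        Complex.exp (2 * Real.pi * Complex.I * τ * (Q A l : ℂ)) := by
  have hdet := isUnit_det_realMat hA hsig he
  have hy := Real.sqrt_pos.mpr hτ
  have hc0 : Q A c ≤ 0 := by
    rcases hc with hc | hc
    · exact hc.1.le
    · exact hc.2.1.le
  set v := Real.sqrt τ.im • l with hv
  have hderiv : ∀ t, Q A (segPath c e t) < 0 →
      HasDerivAt (fun s => p A d (segPath c e s) f v *
        Complex.exp (2 * Real.pi * Complex.I * τ * (Q A l : ℂ))) (segTerm A d c e f τ l t) t :=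
    fun t ht => (hasDerivAt_p_segPath hA hdet hf ht v).mul_const _
  rw [← integral_Ioc_eq_integral_Ioo, ← intervalIntegral.integral_of_le zero_le_one, sub_mul]
  refine intervalIntegral.integral_eq_sub_of_hasDerivAt_of_tendsto zero_lt_one
    (fun t ht => hderiv t (Q_segPath_neg hA hc0 he hce ht.1 ht.2.le)) ?_ ?_ ?_
  · rw [intervalIntegrable_iff_integrableOn_Ioo_of_le zero_le_one]
    exact hint
  · refine Tendsto.mul_const _ ?_
    rcases lt_or_eq_of_le hc0 with h | h
    · have h1 := (hasDerivAt_p_segPath hA hdet hf (c := c) (e := e) (t := 0)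
        (by rwa [segPath_zero]) v).continuousAt.tendsto
      rw [segPath_zero] at h1
      exact h1.mono_left nhdsWithin_le_nhds
    · refine tendsto_p_segPath_zero hA h he hce d f ?_
      rw [hv, B_smul_right]
      exact mul_ne_zero hy.ne' (hl h)
  · have h1 := (hderiv 1 (by rwa [segPath_one])).continuousAt.tendsto
    rw [segPath_one] at h1
    exact h1.mono_left nhdsWithin_le_nhds

end SegmentTerms

section Summation

theorem integrable_tsum_of_norm_le {α ι : Type*} [MeasurableSpace α] {μ : Measure α}
    [IsFiniteMeasure μ] [Countable ι] {F : ι → α → ℂ} {b : ι → ℝ}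
    (hF : ∀ i, AEStronglyMeasurable (F i) μ) (hb : Summable b)
    (h : ∀ᵐ x ∂μ, ∀ i, ‖F i x‖ ≤ b i) : Integrable (fun x => ∑' i, F i x) μ := by
  have hmeas : AEStronglyMeasurable (fun x => ∑' i, F i x) μ := by
    refine aestronglyMeasurable_of_tendsto_ae (atTop : Filter (Finset ι))
      (f := fun s x => ∑ i ∈ s, F i x)
      (fun s => Finset.aestronglyMeasurable_fun_sum s fun i _ => hF i) ?_
    filter_upwards [h] with x hx
    exact (Summable.of_norm_bounded hb hx).hasSum
  refine (integrable_const (∑' i, b i)).mono' hmeas ?_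
  filter_upwards [h] with x hx
  exact tsum_of_norm_bounded hb.hasSum hx

theorem hasSum_integral_of_norm_le {α ι : Type*} [MeasurableSpace α] {μ : Measure α}
    [IsFiniteMeasure μ] [Countable ι] {F : ι → α → ℂ} {b : ι → ℝ}
    (hF : ∀ i, AEStronglyMeasurable (F i) μ) (hb : Summable b)
    (h : ∀ᵐ x ∂μ, ∀ i, ‖F i x‖ ≤ b i) :
    HasSum (fun i => ∫ x, F i x ∂μ) (∫ x, ∑' i, F i x ∂μ) := by
  refine hasSum_integral_of_summable_integral_norm (fun i => ?_) ?_
  · refine (integrable_const (b i)).mono' (hF i) ?_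
    filter_upwards [h] with x hx using hx i
  · refine Summable.of_nonneg_of_le (fun i => integral_nonneg fun x => norm_nonneg _) (fun i => ?_)
      (hb.mul_right (μ.real Set.univ))
    have h1 : ∫ x, ‖F i x‖ ∂μ ≤ ∫ _, b i ∂μ := by
      refine integral_mono_of_nonneg (Eventually.of_forall fun x => norm_nonneg _)
        (integrable_const _) ?_
      filter_upwards [h] with x hx using hx i
    rw [integral_const, smul_eq_mul, mul_comm] at h1
    exact h1

end Summation

end

end IndefTheta

/-! ### The theta series as an integral of fibers, and inversion. -/

namespace IndefTheta

noncomputable section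

open Matrix MeasureTheory Filter Topology

variable {n : ℕ} {A : Matrix (Fin n) (Fin n) ℤ}

section Inversion

/-- The fiber over `t` of the theta integral along the segment from `c` to `e`. -/
def thetaFiber (A : Matrix (Fin n) (Fin n) ℤ) (d : ℕ) (c e : Fin n → ℝ)
    (f : MvPolynomial (Fin n) ℂ) (a b : Fin n → ℝ) (τ : ℂ) (t : ℝ) : ℂ :=
  ∑' l : intLattice n, psi A (unitVec A (segPath c e t)) τ (d + 1)
    (create A (segVel A c e t) (hat A f)) (a + l) * phase A b (a + l)

theorem Q_nonpos_of_mem_coneBar {c₀ c : Fin n → ℝ} (hc : c ∈ coneBar A c₀) : Q A c ≤ 0 := by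
  rcases hc with hc | hc
  · exact hc.1.le
  · exact hc.2.1.le

theorem B_neg_of_mem_coneBar {c₀ c : Fin n → ℝ} (hc : c ∈ coneBar A c₀) : B A c c₀ < 0 := by
  rcases hc with hc | hc
  · exact hc.2
  · exact hc.2.2

/-- All three claims follow from the majorant uniform in `t`, which allows the sum and the integral
to be exchanged. The segment runs from `c` to `c₀`, whence the order of the two vectors in the
summand. -/
theorem hasSum_thetaTerm (hA : A.IsSymm) (hsig : HasSignature A) {c₀ c : Fin n → ℝ}
    (hc₀ : Q A c₀ < 0) (hc : c ∈ coneBar A c₀) {d : ℕ} {f : MvPolynomial (Fin n) ℂ}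
    (hf : f.IsHomogeneous d) {τ : ℂ} (hτ : 0 < τ.im) {a : Fin n → ℝ}
    (ha : a ∈ admissible A (intLattice n) c) (b : Fin n → ℝ) :
    (Summable fun l : intLattice n => ‖thetaTerm A d c₀ c f b τ (a + l)‖) ∧
      IntegrableOn (thetaFiber A d c c₀ f a b τ) (Set.Ioo 0 1) ∧
      ∑' l : intLattice n, thetaTerm A d c₀ c f b τ (a + l) =
        ((Real.sqrt τ.im : ℝ) : ℂ) ^ (d + 1) *
          ∫ t in Set.Ioo (0 : ℝ) 1, thetaFiber A d c c₀ f a b τ t := by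
  have hc0 := Q_nonpos_of_mem_coneBar hc
  have hce := B_neg_of_mem_coneBar hc
  obtain ⟨C, ε, hε, hb⟩ := exists_norm_segTerm_le hA hsig hc hc₀ hce ha d f hτ
  have hsumm := (summable_exp_neg_norm_add hε a).mul_left C
  have hmeas := fun l => aestronglyMeasurable_segTerm hA hsig hc0 hc₀ hce hf τ l
  have hint : ∀ l : intLattice n, IntegrableOn (segTerm A d c c₀ f τ (a + l)) (Set.Ioo 0 1) :=
    fun l => (integrable_const (C * Real.exp (-ε * ‖a + (l : Fin n → ℝ)‖))).mono' (hmeas _) (by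
      filter_upwards [ae_restrict_mem measurableSet_Ioo] with t ht using hb t ht l)
  set F : intLattice n → ℝ → ℂ := fun l t => segTerm A d c c₀ f τ (a + l) t * phase A b (a + l)
    with hF
  have hFmeas : ∀ l, AEStronglyMeasurable (F l) (volume.restrict (Set.Ioo 0 1)) :=
    fun l => (hmeas _).mul_const _
  have hFb : ∀ᵐ t ∂(volume.restrict (Set.Ioo (0 : ℝ) 1)), ∀ l : intLattice n,
      ‖F l t‖ ≤ C * Real.exp (-ε * ‖a + (l : Fin n → ℝ)‖) := by
    filter_upwards [ae_restrict_mem measurableSet_Ioo] with t ht l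
    rw [hF, norm_mul, norm_phase, mul_one]
    exact hb t ht l
  have hterm : ∀ l : intLattice n, ∫ t in Set.Ioo (0 : ℝ) 1, F l t =
      thetaTerm A d c₀ c f b τ (a + l) := by
    intro l
    simp only [hF]
    rw [integral_mul_const, integral_segTerm hA hsig hc hc₀ hce hf hτ
      (fun h => ha h l l.2) (hint l)]
    rfl
  have hpsi : ∀ t, ∑' l, F l t =
      ((Real.sqrt τ.im : ℝ) : ℂ) ^ (d + 1) * thetaFiber A d c c₀ f a b τ t := by
    intro t
    rw [thetaFiber, ← tsum_mul_left]
    refine tsum_congr fun l => ?_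
    simp only [hF]
    rw [segTerm_eq_psi _ _ _ _ hτ, mul_assoc]
  have hne : ((Real.sqrt τ.im : ℝ) : ℂ) ^ (d + 1) ≠ 0 :=
    pow_ne_zero _ (by exact_mod_cast (Real.sqrt_pos.mpr hτ).ne')
  refine ⟨?_, ?_, ?_⟩
  · refine Summable.of_nonneg_of_le (fun _ => norm_nonneg _) (fun l => ?_) hsumm
    rw [← hterm]
    have h := norm_setIntegral_le_of_norm_le_const_ae (μ := volume) (s := Set.Ioo (0 : ℝ) 1)
      (f := F l) (C := C * Real.exp (-ε * ‖a + (l : Fin n → ℝ)‖)) (by simp)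
      (hFb.mono fun t ht => ht l)
    simpa using h
  · have h := integrable_tsum_of_norm_le hFmeas hsumm hFb
    simp only [hpsi] at h
    have h2 := h.const_mul (((Real.sqrt τ.im : ℝ) : ℂ) ^ (d + 1))⁻¹
    simp only [inv_mul_cancel_left₀ hne] at h2
    exact h2
  · have h := hasSum_integral_of_norm_le hFmeas hsumm hFb
    simp only [hterm, hpsi] at h
    rw [h.tsum_eq, integral_const_mul]

theorem theta_eq_integral (hA : A.IsSymm) (hsig : HasSignature A) {c₀ c : Fin n → ℝ}
    (hc₀ : Q A c₀ < 0) (hc : c ∈ coneBar A c₀) {d : ℕ} {f : MvPolynomial (Fin n) ℂ}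
    (hf : f.IsHomogeneous d) {τ : ℂ} (hτ : 0 < τ.im) {a : Fin n → ℝ}
    (ha : a ∈ admissible A (intLattice n) c) (b : Fin n → ℝ) :
    theta A d c₀ c f a b τ = ((Real.sqrt τ.im : ℝ) : ℂ) *
      ∫ t in Set.Ioo (0 : ℝ) 1, thetaFiber A d c c₀ f a b τ t := by
  rw [theta, (hasSum_thetaTerm hA hsig hc₀ hc hf hτ ha b).2.2, ← mul_assoc]
  congr 1
  rw [← Complex.ofReal_pow, ← Complex.ofReal_mul]
  congr 1
  rw [Real.sqrt_eq_rpow, ← Real.rpow_natCast, ← Real.rpow_mul hτ.le, ← Real.rpow_add hτ]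
  congr 1
  push_cast
  ring

theorem im_neg_inv (τ : ℂ) : (-1 / τ).im = τ.im / ‖τ‖ ^ 2 := by
  rw [neg_div, one_div, Complex.neg_im, Complex.inv_im, Complex.normSq_eq_norm_sq]
  ring

/-- With `z = -iτ` and `w = √z`, the single conjugate root satisfies `conj(w) z = w|τ|`. The `z`
comes from the extra power of `τ` due to the derivative in `t`, and `|τ|` cancels against
`√(Im(-1/τ)) = √y/|τ|`. What remains is `w^n`. -/
theorem gaussFactor_mul_pow (hn : 1 ≤ n) (A : Matrix (Fin n) (Fin n) ℤ) {τ : ℂ} (hτ : 0 < τ.im)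
    (d : ℕ) :
    ((Real.sqrt (-1 / τ).im : ℝ) : ℂ) * (gaussFactor A τ * τ ^ (d + 1)) =
      ((Real.sqrt τ.im : ℝ) : ℂ) * ((-Complex.I * τ) ^ ((n : ℂ) / 2 + (d : ℂ)) *
        (Complex.I ^ (d + 1) / (Real.sqrt |(A.det : ℝ)| : ℂ))) := by
  have hτ0 : τ ≠ 0 := by rintro rfl; simp at hτ
  have hnorm : (‖τ‖ : ℂ) ≠ 0 := by exact_mod_cast norm_ne_zero_iff.mpr hτ0
  rw [im_neg_inv τ, Real.sqrt_div hτ.le, Real.sqrt_sq (norm_nonneg τ), gaussFactor]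
  set z := -Complex.I * τ with hz
  have hτz : τ = Complex.I * z := by rw [hz, ← mul_assoc]; simp
  have hz0 : z ≠ 0 := mul_ne_zero (neg_ne_zero.mpr Complex.I_ne_zero) hτ0
  have hzre : 0 < z.re := by simpa [hz] using hτ
  have hconj : Complex.I * (starRingEnd ℂ) τ = (starRingEnd ℂ) z := by simp [hz]
  have harg : z.arg ≠ Real.pi := by
    intro h
    have := Complex.arg_eq_pi_iff.mp h
    linarith [this.1]
  set w := z ^ (1 / 2 : ℂ) with hw
  have hwc : (Complex.I * (starRingEnd ℂ) τ) ^ (1 / 2 : ℂ) = (starRingEnd ℂ) w := by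
    have h12 : (starRingEnd ℂ) (1 / 2 : ℂ) = 1 / 2 := by rw [map_div₀, map_one, map_ofNat]
    rw [hconj, Complex.conj_cpow _ _ harg, h12]
  have hw2 : w ^ 2 = z := by
    rw [hw, ← Complex.cpow_nat_mul]
    norm_num
  have hww : (starRingEnd ℂ) w * w = (‖τ‖ : ℂ) := by
    rw [mul_comm, Complex.mul_conj, Complex.normSq_eq_norm_sq, ← norm_pow, hw2, hz, norm_mul]
    simp
  have hzpow : z ^ ((n : ℂ) / 2 + (d : ℂ)) = w ^ n * z ^ d := by
    rw [Complex.cpow_add _ _ hz0, Complex.cpow_natCast, hw, ← Complex.cpow_nat_mul]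
    congr 2
    ring
  obtain ⟨m, rfl⟩ : ∃ m, n = m + 1 := ⟨n - 1, by omega⟩
  have hpow : τ ^ (d + 1) = Complex.I ^ (d + 1) * (z ^ d * z) := by
    conv_lhs => rw [hτz]
    rw [mul_pow, pow_succ z]
  rw [hwc, hzpow, Nat.add_sub_cancel, hpow]
  generalize Real.sqrt |(A.det : ℝ)| = D
  push_cast
  have hmain : (starRingEnd ℂ) w * z = w * (‖τ‖ : ℂ) := by
    rw [← hww, ← hw2]; ring
  rw [div_mul_eq_mul_div, div_eq_iff hnorm]
  linear_combination ((Real.sqrt τ.im : ℝ) : ℂ) *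
    (1 / (D : ℂ) * w ^ m * (Complex.I ^ (d + 1) * z ^ d)) * hmain

/-- Admissibility of `b` for the dual lattice makes every series on the right of the inversion law
converge. -/
theorem add_mem_admissible (hdet : IsUnit (realMat A).det) {c b : Fin n → ℝ}
    (hb : b ∈ admissible A (dualLattice A) c) {x : Fin n → ℝ} (hx : x ∈ dualLattice A) :
    b + x ∈ admissible A (intLattice n) c := fun h l hl => by
  rw [add_assoc]
  exact hb h _ (add_mem hx (intLattice_le_dualLattice hdet hl))

/-- The fiberwise inversion formula integrated over the segment; its constant depends neither on `t`
nor on the vectors of the path. -/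
theorem theta_neg_inv_of_interior (hA : A.IsSymm) (hsig : HasSignature A) {c₀ c : Fin n → ℝ}
    (hc₀ : Q A c₀ < 0) (hc : c ∈ coneBar A c₀) {d : ℕ} {f : MvPolynomial (Fin n) ℂ}
    (hf : f.IsHomogeneous d) {τ : ℂ} (hτ : 0 < τ.im) {a b : Fin n → ℝ}
    (ha : a ∈ admissible A (intLattice n) c) (hb : b ∈ admissible A (dualLattice A) c) :
    theta A d c₀ c f a b (-1 / τ) =
      (-Complex.I * τ) ^ ((n : ℂ) / 2 + (d : ℂ)) *
        (Complex.I ^ (d + 1) / (Real.sqrt |(A.det : ℝ)| : ℂ)) *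
        Complex.exp (2 * Real.pi * Complex.I * (B A a b : ℂ)) *
        ∑ᶠ x : DiscGroup A, theta A d c₀ c f
          (b + ((Quotient.out x : dualLattice A) : Fin n → ℝ)) (-a) τ := by
  have hdet := isUnit_det_realMat hA hsig hc₀
  have hτ0 : τ ≠ 0 := by rintro rfl; simp at hτ
  have hσ : 0 < (-1 / τ).im := by
    rw [im_neg_inv τ]
    have : 0 < ‖τ‖ := norm_pos_iff.mpr hτ0
    positivity
  have hn : 1 ≤ n := by have := hsig.1; omega
  have := finite_discGroup hdet
  have := Fintype.ofFinite (DiscGroup A)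
  have hfib : ∀ t ∈ Set.Ioo (0 : ℝ) 1, thetaFiber A d c c₀ f a b (-1 / τ) t =
      gaussFactor A τ * τ ^ (d + 1) * phase A b a * ∑ x : DiscGroup A,
        thetaFiber A d c c₀ f (b + ((Quotient.out x : dualLattice A) : Fin n → ℝ)) (-a) τ t := by
    intro t ht
    rw [← finsum_eq_sum_of_fintype]
    exact tsum_psi_neg_inv hA hsig (Q_segPath_neg hA (Q_nonpos_of_mem_coneBar hc) hc₀
      (B_neg_of_mem_coneBar hc) ht.1 ht.2.le) hτ hf _ a b
  have hadm : ∀ x : DiscGroup A, b + ((Quotient.out x : dualLattice A) : Fin n → ℝ) ∈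
      admissible A (intLattice n) c := fun x => add_mem_admissible hdet hb (Quotient.out x).2
  rw [theta_eq_integral hA hsig hc₀ hc hf hσ ha, finsum_eq_sum_of_fintype,
    setIntegral_congr_fun measurableSet_Ioo hfib, integral_const_mul,
    integral_finsetSum _ fun x _ => (hasSum_thetaTerm hA hsig hc₀ hc hf hτ (hadm x) (-a)).2.1]
  simp only [fun x => theta_eq_integral hA hsig hc₀ hc hf hτ (hadm x) (-a)]
  rw [← Finset.mul_sum]
  have hG := gaussFactor_mul_pow hn A hτ d
  rw [phase, B_comm hA a b]
  linear_combination (Complex.exp (2 * Real.pi * Complex.I * (B A b a : ℂ)) *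
    ∑ x : DiscGroup A, ∫ t in Set.Ioo (0 : ℝ) 1, thetaFiber A d c c₀ f
      (b + ((Quotient.out x : dualLattice A) : Fin n → ℝ)) (-a) τ t) * hG

/-- Passing through the interior point `c₀` avoids segments with a cusp at both ends. -/
theorem thetaTerm_sub (d : ℕ) (c₀ c₁ c₂ : Fin n → ℝ) (f : MvPolynomial (Fin n) ℂ)
    (b : Fin n → ℝ) (τ : ℂ) (l : Fin n → ℝ) :
    thetaTerm A d c₁ c₂ f b τ l = thetaTerm A d c₀ c₂ f b τ l - thetaTerm A d c₀ c₁ f b τ l := by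
  simp only [thetaTerm]; ring

theorem summable_norm_thetaTerm (hA : A.IsSymm) (hsig : HasSignature A) {c₀ c₁ c₂ : Fin n → ℝ}
    (hc₀ : Q A c₀ < 0) (hc₁ : c₁ ∈ coneBar A c₀) (hc₂ : c₂ ∈ coneBar A c₀) {d : ℕ}
    {f : MvPolynomial (Fin n) ℂ} (hf : f.IsHomogeneous d) {τ : ℂ} (hτ : 0 < τ.im)
    {a : Fin n → ℝ} (ha₁ : a ∈ admissible A (intLattice n) c₁)
    (ha₂ : a ∈ admissible A (intLattice n) c₂) (b : Fin n → ℝ) :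
    Summable fun l : intLattice n => ‖thetaTerm A d c₁ c₂ f b τ (a + l)‖ := by
  refine Summable.of_nonneg_of_le (fun _ => norm_nonneg _) (fun l => ?_)
    ((hasSum_thetaTerm hA hsig hc₀ hc₂ hf hτ ha₂ b).1.add
      (hasSum_thetaTerm hA hsig hc₀ hc₁ hf hτ ha₁ b).1)
  rw [thetaTerm_sub d c₀]
  exact norm_sub_le _ _

theorem theta_sub (hA : A.IsSymm) (hsig : HasSignature A) {c₀ c₁ c₂ : Fin n → ℝ}
    (hc₀ : Q A c₀ < 0) (hc₁ : c₁ ∈ coneBar A c₀) (hc₂ : c₂ ∈ coneBar A c₀) {d : ℕ}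
    {f : MvPolynomial (Fin n) ℂ} (hf : f.IsHomogeneous d) {τ : ℂ} (hτ : 0 < τ.im)
    {a : Fin n → ℝ} (ha₁ : a ∈ admissible A (intLattice n) c₁)
    (ha₂ : a ∈ admissible A (intLattice n) c₂) (b : Fin n → ℝ) :
    theta A d c₁ c₂ f a b τ = theta A d c₀ c₂ f a b τ - theta A d c₀ c₁ f a b τ := by
  simp only [theta, thetaTerm_sub (A := A) d c₀ c₁ c₂]
  rw [← mul_sub, ← (hasSum_thetaTerm hA hsig hc₀ hc₂ hf hτ ha₂ b).1.of_norm.tsum_sub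
    (hasSum_thetaTerm hA hsig hc₀ hc₁ hf hτ ha₁ b).1.of_norm]

theorem theta_neg_inv (hA : A.IsSymm) (hsig : HasSignature A) {c₀ c₁ c₂ : Fin n → ℝ}
    (hc₀ : Q A c₀ < 0) (hc₁ : c₁ ∈ coneBar A c₀) (hc₂ : c₂ ∈ coneBar A c₀) {d : ℕ}
    {f : MvPolynomial (Fin n) ℂ} (hf : f.IsHomogeneous d) {τ : ℂ} (hτ : 0 < τ.im)
    {a b : Fin n → ℝ} (ha₁ : a ∈ admissible A (intLattice n) c₁)
    (ha₂ : a ∈ admissible A (intLattice n) c₂) (hb₁ : b ∈ admissible A (dualLattice A) c₁)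
    (hb₂ : b ∈ admissible A (dualLattice A) c₂) :
    theta A d c₁ c₂ f a b (-1 / τ) =
      (-Complex.I * τ) ^ ((n : ℂ) / 2 + (d : ℂ)) *
        (Complex.I ^ (d + 1) / (Real.sqrt |(A.det : ℝ)| : ℂ)) *
        Complex.exp (2 * Real.pi * Complex.I * (B A a b : ℂ)) *
        ∑ᶠ x : DiscGroup A, theta A d c₁ c₂ f
          (b + ((Quotient.out x : dualLattice A) : Fin n → ℝ)) (-a) τ := by
  have hdet := isUnit_det_realMat hA hsig hc₀
  have hσ : 0 < (-1 / τ).im := by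
    have hτ0 : τ ≠ 0 := by rintro rfl; simp at hτ
    have : 0 < ‖τ‖ := norm_pos_iff.mpr hτ0
    rw [im_neg_inv τ]
    positivity
  have := finite_discGroup hdet
  have := Fintype.ofFinite (DiscGroup A)
  rw [theta_sub hA hsig hc₀ hc₁ hc₂ hf hσ ha₁ ha₂,
    theta_neg_inv_of_interior hA hsig hc₀ hc₁ hf hτ ha₁ hb₁,
    theta_neg_inv_of_interior hA hsig hc₀ hc₂ hf hτ ha₂ hb₂]
  simp only [finsum_eq_sum_of_fintype]
  rw [← mul_sub, ← Finset.sum_sub_distrib]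
  congr 1
  refine Finset.sum_congr rfl fun x _ => ?_
  exact (theta_sub hA hsig hc₀ hc₁ hc₂ hf hτ (add_mem_admissible hdet hb₁ (Quotient.out x).2)
    (add_mem_admissible hdet hb₂ (Quotient.out x).2) (-a)).symm

end Inversion

end

end IndefTheta

/-! ### The laws which hold summand by summand. -/

namespace IndefTheta

noncomputable section

open Matrix

variable {n : ℕ} {A : Matrix (Fin n) (Fin n) ℤ}

section ElementaryLaws

theorem theta_add_lattice (d : ℕ) (c₁ c₂ : Fin n → ℝ) (f : MvPolynomial (Fin n) ℂ)
    (a b : Fin n → ℝ) (τ : ℂ) {l : Fin n → ℝ} (hl : l ∈ intLattice n) :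
    theta A d c₁ c₂ f (a + l) b τ = theta A d c₁ c₂ f a b τ := by
  unfold theta
  congr 1
  rw [← (Equiv.addLeft (⟨l, hl⟩ : intLattice n)).tsum_eq
    (fun m : intLattice n => thetaTerm A d c₁ c₂ f b τ (a + m))]
  refine tsum_congr fun m => ?_
  rw [add_assoc]
  rfl

/-- If each summand is multiplied by the same factor, so is the theta series. -/
theorem theta_eq_mul {d : ℕ} {c₁ c₂ : Fin n → ℝ} {f : MvPolynomial (Fin n) ℂ}
    {a b b' : Fin n → ℝ} {τ τ' : ℂ} {u : ℂ} (him : τ'.im = τ.im)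
    (h : ∀ l : intLattice n, thetaTerm A d c₁ c₂ f b' τ' (a + l) =
      u * thetaTerm A d c₁ c₂ f b τ (a + l)) :
    theta A d c₁ c₂ f a b' τ' = u * theta A d c₁ c₂ f a b τ := by
  unfold theta
  rw [him, tsum_congr h, tsum_mul_left]
  ring

theorem exp_two_pi_I_int {x : ℝ} (hx : ∃ k : ℤ, x = k) :
    Complex.exp (2 * Real.pi * Complex.I * (x : ℂ)) = 1 := by
  obtain ⟨k, rfl⟩ := hx
  rw [← Complex.exp_int_mul_two_pi_mul_I k]
  congr 1
  push_cast
  ring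

theorem exists_int_dotProduct {x y : Fin n → ℝ} (hx : x ∈ intLattice n) (hy : y ∈ intLattice n) :
    ∃ k : ℤ, x ⬝ᵥ y = k := by
  obtain ⟨k, rfl⟩ := hx
  obtain ⟨m, rfl⟩ := hy
  exact ⟨k ⬝ᵥ m, by simp [dotProduct]⟩

theorem theta_add_dual (hdet : IsUnit (realMat A).det) (d : ℕ) (c₁ c₂ : Fin n → ℝ)
    (f : MvPolynomial (Fin n) ℂ) (a b : Fin n → ℝ) (τ : ℂ) {μ : Fin n → ℝ}
    (hμ : μ ∈ dualLattice A) :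
    theta A d c₁ c₂ f a (b + μ) τ =
      Complex.exp (2 * Real.pi * Complex.I * (B A a μ : ℂ)) * theta A d c₁ c₂ f a b τ := by
  refine theta_eq_mul rfl fun l => ?_
  have h1 := exp_two_pi_I_int (x := B A l μ)
    (exists_int_dotProduct l.2 ((mem_dualLattice_iff hdet).mp hμ))
  have h2 : Complex.exp (2 * Real.pi * Complex.I * (B A (a + l) (b + μ) : ℂ)) =
      Complex.exp (2 * Real.pi * Complex.I * (B A a μ : ℂ)) *
        Complex.exp (2 * Real.pi * Complex.I * (B A (a + l) b : ℂ)) := by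
    rw [← mul_one (Complex.exp _ * _), ← h1, ← Complex.exp_add, ← Complex.exp_add, B_add_right,
      B_add_left A a l μ]
    congr 1
    push_cast
    ring
  rw [thetaTerm, thetaTerm, h2]
  ring

theorem p_neg (hA : A.IsSymm) (hdet : IsUnit (realMat A).det) {d : ℕ}
    {f : MvPolynomial (Fin n) ℂ} (hf : f.IsHomogeneous d) (c v : Fin n → ℝ) :
    p A d c f (-v) = (-1) ^ (d + 1) * p A d c f v := by
  have hpar := hasParity_hat hA hdet hf
  by_cases hc : Q A c < 0
  · rw [p_eq_pSum A hc, p_eq_pSum A hc, pSum_neg (j := 1) (fun k x => derivE_neg k x) hpar]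
  · rw [p, p, if_neg hc, if_neg hc, B_neg_right, Real.sign_neg]
    rw [hpar v]
    push_cast
    ring

theorem theta_neg (hA : A.IsSymm) (hdet : IsUnit (realMat A).det) {d : ℕ}
    {f : MvPolynomial (Fin n) ℂ} (hf : f.IsHomogeneous d) (c₁ c₂ a b : Fin n → ℝ) (τ : ℂ) :
    theta A d c₁ c₂ f (-a) (-b) τ = (-1) ^ (d + 1) * theta A d c₁ c₂ f a b τ := by
  unfold theta
  rw [mul_left_comm]
  congr 1
  rw [← (Equiv.neg (intLattice n)).tsum_eq, ← tsum_mul_left]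
  refine tsum_congr fun l => ?_
  have h : -a + ((Equiv.neg (intLattice n) l : intLattice n) : Fin n → ℝ) = -(a + l) := by
    simp [add_comm]
  rw [h, thetaTerm, thetaTerm, smul_neg, p_neg hA hdet hf, p_neg hA hdet hf, Q_neg, B_neg_left,
    B_neg_right, neg_neg]
  ring

/-- The vector `s` represents `Q` modulo 1 on the lattice as the linear form `B(·,s)`. The two uses
are `s = ½A⁻¹A*` in general and `s = 0` for an even diagonal. -/
theorem theta_add_one (hA : A.IsSymm) (d : ℕ) (c₁ c₂ : Fin n → ℝ) (f : MvPolynomial (Fin n) ℂ)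
    (a b : Fin n → ℝ) (τ : ℂ) {s : Fin n → ℝ}
    (hs : ∀ m ∈ intLattice n, ∃ k : ℤ, Q A m - B A m s = k) :
    theta A d c₁ c₂ f a b (τ + 1) =
      Complex.exp (-2 * Real.pi * Complex.I * (Q A a : ℂ)
          - 2 * Real.pi * Complex.I * (B A s a : ℂ)) *
        theta A d c₁ c₂ f a (a + b + s) τ := by
  refine theta_eq_mul (by simp) fun l => ?_
  have h1 := exp_two_pi_I_int (hs l l.2)
  set m : Fin n → ℝ := (l : Fin n → ℝ)
  have h2 : Complex.exp (2 * Real.pi * Complex.I * (τ + 1) * (Q A (a + m) : ℂ)) *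
      Complex.exp (2 * Real.pi * Complex.I * (B A (a + m) b : ℂ)) =
      Complex.exp (-2 * Real.pi * Complex.I * (Q A a : ℂ)
          - 2 * Real.pi * Complex.I * (B A s a : ℂ)) *
        (Complex.exp (2 * Real.pi * Complex.I * τ * (Q A (a + m) : ℂ)) *
          Complex.exp (2 * Real.pi * Complex.I * (B A (a + m) (a + b + s) : ℂ))) *
        Complex.exp (2 * Real.pi * Complex.I * ((Q A m - B A m s : ℝ) : ℂ)) := by
    rw [← Complex.exp_add, ← Complex.exp_add,
      ← Complex.exp_add, ← Complex.exp_add]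
    congr 1
    have e1 : Q A (a + m) = Q A a + Q A m + B A a m := Q_add hA a m
    have e2 : B A (a + m) (a + b + s) =
        2 * Q A a + B A a m + B A (a + m) b + B A s a + B A m s := by
      rw [B_add_right, B_add_right, B_add_left A a m a, B_add_left A a m s, B_self, B_comm hA m a,
        B_comm hA a s]
      ring
    rw [e2]
    have e3 : ((Q A (a + m) : ℝ) : ℂ) = Q A a + Q A m + B A a m := by rw [e1]; push_cast; ring
    push_cast
    linear_combination 2 * (Real.pi : ℂ) * Complex.I * e3
  rw [h1, mul_one] at h2
  rw [thetaTerm, thetaTerm, Complex.add_im, Complex.one_im, add_zero]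
  linear_combination (p A d c₁ f (Real.sqrt τ.im • (a + m)) -
    p A d c₂ f (Real.sqrt τ.im • (a + m))) * h2

/-- Modulo 2 the difference is additive in `k`, the cross term being `2xᵀAy`. On multiples of a
basis vector it is `A_ii k(k - 1)`, a multiple of a product of consecutive integers. -/
theorem even_quadratic_sub_diag (hA : A.IsSymm) (k : Fin n → ℤ) :
    Even (k ⬝ᵥ (A *ᵥ k) - k ⬝ᵥ (fun i => A i i)) := by
  have hadd : ∀ x y : Fin n → ℤ, Even (x ⬝ᵥ (A *ᵥ x) - x ⬝ᵥ (fun i => A i i)) →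
      Even (y ⬝ᵥ (A *ᵥ y) - y ⬝ᵥ (fun i => A i i)) →
      Even ((x + y) ⬝ᵥ (A *ᵥ (x + y)) - (x + y) ⬝ᵥ (fun i => A i i)) := by
    intro x y hx hy
    have hxy : y ⬝ᵥ (A *ᵥ x) = x ⬝ᵥ (A *ᵥ y) := by
      rw [dotProduct_mulVec, ← mulVec_transpose, hA.eq, dotProduct_comm]
    have : (x + y) ⬝ᵥ (A *ᵥ (x + y)) - (x + y) ⬝ᵥ (fun i => A i i) =
        (x ⬝ᵥ (A *ᵥ x) - x ⬝ᵥ (fun i => A i i)) + (y ⬝ᵥ (A *ᵥ y) - y ⬝ᵥ (fun i => A i i)) +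
          2 * (x ⬝ᵥ (A *ᵥ y)) := by
      rw [mulVec_add, add_dotProduct, add_dotProduct, dotProduct_add, dotProduct_add, hxy]
      ring
    rw [this]
    exact (hx.add hy).add (even_two_mul _)
  have hsum : ∀ s : Finset (Fin n), Even ((∑ i ∈ s, Pi.single i (k i)) ⬝ᵥ
      (A *ᵥ (∑ i ∈ s, Pi.single i (k i))) - (∑ i ∈ s, Pi.single i (k i)) ⬝ᵥ (fun i => A i i)) := by
    intro s
    induction s using Finset.induction_on with
    | empty => simp
    | insert i s hi ih =>
      rw [Finset.sum_insert hi]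
      refine hadd _ _ ?_ ih
      have : Pi.single i (k i) ⬝ᵥ (A *ᵥ Pi.single i (k i)) - Pi.single i (k i) ⬝ᵥ (fun i => A i i) =
          A i i * ((k i - 1) * (k i - 1 + 1)) := by
        simp [single_dotProduct, mulVec_single]
        ring
      rw [this]
      exact (Int.even_mul_succ_self _).mul_left _
  have := hsum Finset.univ
  rwa [Finset.univ_sum_single] at this

theorem B_invDiag (hdet : IsUnit (realMat A).det) (m : Fin n → ℝ) :
    B A m (invDiag A) = m ⬝ᵥ (fun i => (A i i : ℝ)) := by
  rw [B, invDiag, mulVec_mulVec, Matrix.mul_nonsing_inv _ hdet, one_mulVec]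

theorem exists_int_Q_sub_diag (hA : A.IsSymm) {m : Fin n → ℝ} (hm : m ∈ intLattice n) :
    ∃ k : ℤ, Q A m - 1 / 2 * (m ⬝ᵥ (fun i => (A i i : ℝ))) = k := by
  obtain ⟨x, rfl⟩ := hm
  obtain ⟨r, hr⟩ := even_quadratic_sub_diag hA x
  refine ⟨r, ?_⟩
  have h := congrArg (fun z : ℤ => (z : ℝ)) hr
  simp only [Q, B, dotProduct, mulVec, realMat] at h ⊢
  push_cast at h
  have hx : ∀ i, ((Int.castAddHom ℝ).compLeft (Fin n)) x i = (x i : ℝ) := fun _ => rfl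
  simp only [hx, map_apply]
  linarith

theorem theta_add_one_half_diag (hA : A.IsSymm) (hdet : IsUnit (realMat A).det) (d : ℕ)
    (c₁ c₂ : Fin n → ℝ) (f : MvPolynomial (Fin n) ℂ) (a b : Fin n → ℝ) (τ : ℂ) :
    theta A d c₁ c₂ f a b (τ + 1) =
      Complex.exp (-2 * Real.pi * Complex.I * (Q A a : ℂ)
          - Real.pi * Complex.I * (B A (invDiag A) a : ℂ)) *
        theta A d c₁ c₂ f a (a + b + (1 / 2 : ℝ) • invDiag A) τ := by
  rw [theta_add_one hA d c₁ c₂ f a b τ (s := (1 / 2 : ℝ) • invDiag A) fun m hm => by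
    rw [B_smul_right, B_invDiag hdet]
    exact exists_int_Q_sub_diag hA hm]
  congr 2
  rw [B_smul_left]
  push_cast
  ring

theorem theta_add_one_of_even (hA : A.IsSymm) (heven : ∀ i, Even (A i i)) (d : ℕ)
    (c₁ c₂ : Fin n → ℝ) (f : MvPolynomial (Fin n) ℂ) (a b : Fin n → ℝ) (τ : ℂ) :
    theta A d c₁ c₂ f a b (τ + 1) =
      Complex.exp (-2 * Real.pi * Complex.I * (Q A a : ℂ)) *
        theta A d c₁ c₂ f a (a + b) τ := by
  have h := theta_add_one hA d c₁ c₂ f a b τ (s := 0) fun m hm => by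
    obtain ⟨k, hk⟩ := exists_int_Q_sub_diag hA hm
    obtain ⟨x, rfl⟩ := hm
    choose r hr using heven
    refine ⟨k + x ⬝ᵥ r, ?_⟩
    have h2 : 1 / 2 * (((Int.castAddHom ℝ).compLeft (Fin n)) x ⬝ᵥ fun i => (A i i : ℝ)) =
        ((x ⬝ᵥ r : ℤ) : ℝ) := by
      have hx : ∀ i, ((Int.castAddHom ℝ).compLeft (Fin n)) x i = (x i : ℝ) := fun _ => rfl
      simp only [hr, dotProduct, hx, Finset.mul_sum]
      push_cast
      exact Finset.sum_congr rfl fun i _ => by ring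
    rw [B_zero_right]
    push_cast
    linarith
  simpa [B_zero_left] using h

end ElementaryLaws

end

end IndefTheta

theorem theorem2p5 {n d : ℕ} (A : Matrix (Fin n) (Fin n) ℤ) (hA : A.IsSymm)
    (hsig : IndefTheta.HasSignature A)
    (c₀ : Fin n → ℝ) (hc₀ : IndefTheta.Q A c₀ < 0)
    (c₁ c₂ : Fin n → ℝ)
    (hc₁ : c₁ ∈ IndefTheta.coneBar A c₀) (hc₂ : c₂ ∈ IndefTheta.coneBar A c₀)
    (f : MvPolynomial (Fin n) ℂ) (hf : f.IsHomogeneous d) :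
    -- absolute convergence for admissible `a`
    (∀ a ∈ IndefTheta.admissible A (IndefTheta.intLattice n) c₁ ∩
        IndefTheta.admissible A (IndefTheta.intLattice n) c₂,
      ∀ b : Fin n → ℝ, ∀ τ : ℂ, 0 < τ.im →
        Summable (fun l : IndefTheta.intLattice n =>
          ‖IndefTheta.thetaTerm A d c₁ c₂ f b τ (a + (l : Fin n → ℝ))‖)) ∧
    -- elliptic laws, parity and `τ ↦ τ + 1`, whenever the series converges absolutely
    (∀ a b : Fin n → ℝ, ∀ τ : ℂ, 0 < τ.im →
      Summable (fun l : IndefTheta.intLattice n =>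
        ‖IndefTheta.thetaTerm A d c₁ c₂ f b τ (a + (l : Fin n → ℝ))‖) →
        (∀ l ∈ IndefTheta.intLattice n,
          IndefTheta.theta A d c₁ c₂ f (a + l) b τ = IndefTheta.theta A d c₁ c₂ f a b τ) ∧
        (∀ μ ∈ IndefTheta.dualLattice A,
          IndefTheta.theta A d c₁ c₂ f a (b + μ) τ =
            Complex.exp (2 * Real.pi * Complex.I * (IndefTheta.B A a μ : ℂ)) *
              IndefTheta.theta A d c₁ c₂ f a b τ) ∧
        IndefTheta.theta A d c₁ c₂ f (-a) (-b) τ =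
          (-1) ^ (d + 1) * IndefTheta.theta A d c₁ c₂ f a b τ ∧
        IndefTheta.theta A d c₁ c₂ f a b (τ + 1) =
          Complex.exp (-2 * Real.pi * Complex.I * (IndefTheta.Q A a : ℂ)
              - Real.pi * Complex.I * (IndefTheta.B A (IndefTheta.invDiag A) a : ℂ)) *
            IndefTheta.theta A d c₁ c₂ f a (a + b + (1 / 2 : ℝ) • IndefTheta.invDiag A) τ ∧
        ((∀ i, Even (A i i)) →
          IndefTheta.theta A d c₁ c₂ f a b (τ + 1) =
            Complex.exp (-2 * Real.pi * Complex.I * (IndefTheta.Q A a : ℂ)) *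
              IndefTheta.theta A d c₁ c₂ f a (a + b) τ)) ∧
    -- the law for `τ ↦ -1/τ`; the sum runs over the finite group `A⁻¹ ℤⁿ / ℤⁿ`
    Finite (IndefTheta.DiscGroup A) ∧
    (∀ a ∈ IndefTheta.admissible A (IndefTheta.intLattice n) c₁ ∩
        IndefTheta.admissible A (IndefTheta.intLattice n) c₂,
      ∀ b ∈ IndefTheta.admissible A (IndefTheta.dualLattice A) c₁ ∩
        IndefTheta.admissible A (IndefTheta.dualLattice A) c₂,
      ∀ τ : ℂ, 0 < τ.im →
        IndefTheta.theta A d c₁ c₂ f a b (-1 / τ) =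
          (-Complex.I * τ) ^ ((n : ℂ) / 2 + (d : ℂ)) *
            (Complex.I ^ (d + 1) / (Real.sqrt |(A.det : ℝ)| : ℂ)) *
            Complex.exp (2 * Real.pi * Complex.I * (IndefTheta.B A a b : ℂ)) *
            ∑ᶠ x : IndefTheta.DiscGroup A,
              IndefTheta.theta A d c₁ c₂ f
                (b + ((Quotient.out x : IndefTheta.dualLattice A) : Fin n → ℝ)) (-a) τ) := by
  have hdet := IndefTheta.isUnit_det_realMat hA hsig hc₀
  refine ⟨fun a ha b τ hτ =>
      IndefTheta.summable_norm_thetaTerm hA hsig hc₀ hc₁ hc₂ hf hτ ha.1 ha.2 b,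
    fun a b τ _ _ => ⟨fun l hl => IndefTheta.theta_add_lattice d c₁ c₂ f a b τ hl,
      fun μ hμ => IndefTheta.theta_add_dual hdet d c₁ c₂ f a b τ hμ,
      IndefTheta.theta_neg hA hdet hf c₁ c₂ a b τ,
      IndefTheta.theta_add_one_half_diag hA hdet d c₁ c₂ f a b τ,
      fun heven => IndefTheta.theta_add_one_of_even hA heven d c₁ c₂ f a b τ⟩,
    IndefTheta.finite_discGroup hdet,
    fun a ha b hb τ hτ =>
      IndefTheta.theta_neg_inv hA hsig hc₀ hc₁ hc₂ hf hτ ha.1 ha.2 hb.1 hb.2⟩
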